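/- There is an algorithm on the word RAM (words of $w$ bits; single-word arithmetic $+,-,\times,\div$, comparisons and memory accesses take unit time) and there are absolute constants $\kappa$ and $C$ such that the following holds for every $n\ge 1$, every word size $w\ge \kappa\log_2(2n)$, and all sequences $A[1..n]$ and $B[1..n]$ of integers that fit into a (signed) word. For an integer $a$ that is present in $A$ or $B$, let $\mathrm{cnt}(a)$ be the total number of occurrences of $a$ in $A$ and $B$. On the input $n,A,B$ the algorithm halts after at most $$C\cdot\sum_{a}\mathrm{cnt}(a)^2\left(1+\log_2^2\frac{n}{\mathrm{cnt}(a)}\right)$$ steps, where the sum is over all distinct integers $a$ that are present in $A$ or $B$, and it outputs: 1. the length of a longest common increasing subsequence (LCIS) of $A$ and $B$, that is, the largest $\ell\ge 0$ such that there are indices $i_1<\dots<i_\ell$ and $j_1<\dots<j_\ell$ with $A[i_k]=B[j_k]$ for every $k$ and $A[i_1]<\dots<A[i_\ell]$; 2. a list of all matching pairs $(x,y)$ (pairs of indices with $A[x]=B[y]$), each occurring exactly once, together with the length $\mathrm{LCIS}^{\rightarrow}(x,y)$ of a longest common increasing subsequence of $A[1..x]$ and $B[1..y]$ that includes both $A[x]$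 and $B[y]$. -/

import Mathlib

/-! ## Longest common increasing subsequences

Sequences of length `n` are functions on `Fin n`, so positions are `0, …, n - 1`. -/

namespace LCIS

/-- The positions `i 0 < i 1 < …` of `A` and `j 0 < j 1 < …` of `B` spell the same
strictly increasing sequence of length `l`. -/
def IsCommonIncreasing {n : ℕ} (A B : Fin n → ℤ) (l : ℕ) (i j : Fin l → Fin n) : Prop :=
  StrictMono i ∧ StrictMono j ∧ (∀ k, A (i k) = B (j k)) ∧ StrictMono (fun k => A (i k))

/-- `l` is the length of a longest common increasing subsequence of `A` and `B`. -/
def IsLength {n : ℕ} (A B : Fin n → ℤ) (l : ℕ) : Prop :=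
  IsGreatest {m : ℕ | ∃ i j : Fin m → Fin n, IsCommonIncreasing A B m i j} l

/-- `l` is the length of a longest common increasing subsequence of the prefixes of `A` and `B`
that end at the positions `x` and `y`, among those that include both of these positions. -/
def IsLengthAt {n : ℕ} (A B : Fin n → ℤ) (x y : Fin n) (l : ℕ) : Prop :=
  IsGreatest {m : ℕ | ∃ i j : Fin m → Fin n, IsCommonIncreasing A B m i j ∧
    (∀ k, i k ≤ x) ∧ (∀ k, j k ≤ y) ∧ (∃ k, i k = x) ∧ (∃ k, j k = y)} l

/-- The set of matching pairs. -/
abbrev MatchingPair {n : ℕ} (A B : Fin n → ℤ) : Type :=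
  {p : Fin n × Fin n // A p.1 = B p.2}

/-- The set of the distinct integers that are present in `A` or in `B`. -/
def alphabet {n : ℕ} (A B : Fin n → ℤ) : Finset ℤ :=
  Finset.univ.image A ∪ Finset.univ.image B

/-- The total number of occurrences of `a` in `A` and `B`. -/
def cnt {n : ℕ} (A B : Fin n → ℤ) (a : ℤ) : ℕ :=
  (Finset.univ.filter (fun i => A i = a)).card + (Finset.univ.filter (fun j => B j = a)).card

/-- `∑ cnt(a)² (1 + log² (n / cnt(a)))`, over the distinct integers `a` that are present. -/
noncomputable def timeBound {n : ℕ} (A B : Fin n → ℤ) : ℝ :=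
  ∑ a ∈ alphabet A B,
    (cnt A B a : ℝ) ^ 2 * (1 + Real.logb 2 ((n : ℝ) / (cnt A B a : ℝ)) ^ 2)

end LCIS

/-! ## The word RAM

A machine with words of `w` bits, read as signed integers in two's complement.  A program uses
finitely many registers and finitely many random access arrays; an array has one cell for each
word.  Programs are structured programs over single-word operations, and running time is the
number of operations that are carried out. -/

namespace WordRAM

/-- The integer `z` fits into a signed word of `w` bits: `-2 ^ (w-1) ≤ z < 2 ^ (w-1)`. -/
def IsWord (w : ℕ) (z : ℤ) : Prop :=
  -(2 : ℤ) ^ w ≤ 2 * z ∧ 2 * z < (2 : ℤ) ^ w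

/-- Reduction modulo `2 ^ w` to the range of the signed words of `w` bits. -/
def wrap (w : ℕ) (z : ℤ) : ℤ := z.bmod (2 ^ w)

/-- The contents of the registers and of the arrays. -/
structure State where
  reg : ℕ → ℤ
  arr : ℕ → ℤ → ℤ

/-- The operations on words. -/
inductive BinOp
  | add
  | sub
  | mul
  | div
  | lt
  | eq

/-- Arithmetic is modulo `2 ^ w`; division is integer division, with value `0` for a divisor `0`;
a comparison gives `1` or `0`. -/
def BinOp.eval (w : ℕ) : BinOp → ℤ → ℤ → ℤ
  | .add, a, b => wrap w (a + b)
  | .sub, a, b => wrap w (a - b)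
  | .mul, a, b => wrap w (a * b)
  | .div, a, b => wrap w (a / b)
  | .lt, a, b => wrap w (if a < b then 1 else 0)
  | .eq, a, b => wrap w (if a = b then 1 else 0)

/-- Expressions: constants, registers, array cells `arr a [e]`, and operations. -/
inductive Expr
  | const (c : ℤ)
  | reg (r : ℕ)
  | load (a : ℕ) (e : Expr)
  | op (o : BinOp) (e₁ e₂ : Expr)

/-- The value of an expression. -/
def Expr.eval (w : ℕ) (s : State) : Expr → ℤ
  | .const c => wrap w c
  | .reg r => s.reg r
  | .load a e => s.arr a (e.eval w s)
  | .op o e₁ e₂ => o.eval w (e₁.eval w s) (e₂.eval w s)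

/-- The time to evaluate an expression: one unit for each constant, register access,
array access and operation. -/
def Expr.cost : Expr → ℕ
  | .const _ => 1
  | .reg _ => 1
  | .load _ e => e.cost + 1
  | .op _ e₁ e₂ => e₁.cost + e₂.cost + 1

/-- Programs.  `assign r e` is `reg r := e`, and `store a i e` is `arr a [i] := e`.
A condition holds if its value is not `0`. -/
inductive Program
  | skip
  | assign (r : ℕ) (e : Expr)
  | store (a : ℕ) (i e : Expr)
  | seq (p q : Program)
  | ite (c : Expr) (p q : Program)
  | loop (c : Expr) (p : Program)

/-- The state after `reg r := v`. -/
def State.setReg (s : State) (r : ℕ) (v : ℤ) : State :=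
  { s with reg := Function.update s.reg r v }

/-- The state after `arr a [i] := v`. -/
def State.setArr (s : State) (a : ℕ) (i v : ℤ) : State :=
  { s with arr := Function.update s.arr a (Function.update (s.arr a) i v) }

/-- `Exec w p s t s'`: with words of `w` bits, the program `p` started in the state `s` halts
in the state `s'` after exactly `t` units of time.  (`loop c p` is the loop "while `c` do `p`".) -/
inductive Exec (w : ℕ) : Program → State → ℕ → State → Prop
  | skip (s : State) : Exec w .skip s 1 s
  | assign (r : ℕ) (e : Expr) (s : State) :
      Exec w (.assign r e) s (e.cost + 1) (s.setReg r (e.eval w s))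
  | store (a : ℕ) (i e : Expr) (s : State) :
      Exec w (.store a i e) s (i.cost + e.cost + 1) (s.setArr a (i.eval w s) (e.eval w s))
  | seq (p q : Program) (s₀ s₁ s₂ : State) (t₁ t₂ : ℕ)
      (hp : Exec w p s₀ t₁ s₁) (hq : Exec w q s₁ t₂ s₂) :
      Exec w (.seq p q) s₀ (t₁ + t₂) s₂
  | ite_true (c : Expr) (p q : Program) (s s' : State) (t : ℕ)
      (hc : c.eval w s ≠ 0) (hp : Exec w p s t s') :
      Exec w (.ite c p q) s (c.cost + 1 + t) s'
  | ite_false (c : Expr) (p q : Program) (s s' : State) (t : ℕ)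
      (hc : c.eval w s = 0) (hq : Exec w q s t s') :
      Exec w (.ite c p q) s (c.cost + 1 + t) s'
  | loop_exit (c : Expr) (p : Program) (s : State) (hc : c.eval w s = 0) :
      Exec w (.loop c p) s (c.cost + 1) s
  | loop_step (c : Expr) (p : Program) (s₀ s₁ s₂ : State) (t₁ t₂ : ℕ)
      (hc : c.eval w s₀ ≠ 0) (hp : Exec w p s₀ t₁ s₁) (hl : Exec w (.loop c p) s₁ t₂ s₂) :
      Exec w (.loop c p) s₀ (c.cost + 1 + t₁ + t₂) s₂

/-- The cells of an array that holds the sequence `A` in the cells `0, …, n - 1` and `0` in all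
other cells. -/
def cells {n : ℕ} (A : Fin n → ℤ) (z : ℤ) : ℤ :=
  if h : 0 ≤ z ∧ z < n then A ⟨z.toNat, by omega⟩ else 0

/-- The initial state on the input `A`, `B`: register `0` holds the length `n`, array `0` holds `A`,
array `1` holds `B`, and everything else is `0`. -/
def initial (w : ℕ) {n : ℕ} (A B : Fin n → ℤ) : State where
  reg r := if r = 0 then wrap w n else 0
  arr a := if a = 0 then cells A else if a = 1 then cells B else fun _ => 0

end WordRAM

namespace LCIS

/-- The output that is required on the input `A`, `B`: register `0` holds the length of a longest
common increasing subsequence, register `1` holds the number `m` of matching pairs, and the cells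
`0, …, m - 1` of the arrays `2`, `3`, `4` hold a list of all the matching pairs `(x, y)`, each
exactly once, as the triples of `x`, of `y`, and of the length of a longest common increasing
subsequence that ends with the pair `(x, y)`. -/
def IsOutput {n : ℕ} (A B : Fin n → ℤ) (s : WordRAM.State) : Prop :=
  (∃ l : ℕ, IsLength A B l ∧ s.reg 0 = l) ∧
  ∃ (m : ℕ) (e : Fin m ≃ MatchingPair A B), s.reg 1 = m ∧
    ∀ k : Fin m,
      s.arr 2 (k : ℕ) = ((e k).1.1 : ℕ) ∧
      s.arr 3 (k : ℕ) = ((e k).1.2 : ℕ) ∧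
      ∃ l : ℕ, IsLengthAt A B (e k).1.1 (e k).1.2 l ∧ s.arr 4 (k : ℕ) = l

end LCIS

/-!
# An algorithm for longest common increasing subsequences

Positions are counted from `1`.  Let `lenAt x y` be the length of a longest common increasing
subsequence that ends with the matching pair `(x, y)`.  It is `1` plus the maximum of `lenAt` over
the matching pairs of smaller integers to the upper left (`lenAt_lt`, `exists_lenAt`).  The program
goes through the integers of `A` in increasing order, which a tournament tree supplies, and keeps
the values of `lenAt` so far in a two-dimensional Fenwick tree for prefix maxima.

One query in such a tree takes `log² n` steps, which is too slow for an integer with many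
occurrences.  All queries and updates for one integer `a` together are cheaper, because its matching
pairs form a grid.

* The prefix that belongs to a grid point is the union of the prefixes of its left and its upper
  neighbour in the grid and of the rectangle between the neighbours and the point.  Hence a query
  only walks down the tree until it passes the previous occurrence of `a`, in both coordinates
  (`query_eq_lenAt`).
* On the grid, `lenAt` is monotone (`lenAt_mono`), and a node that reaches beyond the next occurrence
  of `a` also covers this occurrence.  Hence an update only walks up the tree until it reaches the
  next occurrence (`TableOk.insert`).

The lengths of these walks are logarithmic in the gap between neighbouring occurrences
(`Fenwick.down_le`, `Fenwick.up_le`), since the step width at least doubles at every step.  The gaps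
sum to at most `n`, so by concavity the walks in one coordinate have a total length of
`O(cnt(a) (1 + |log (n / cnt(a))|))` (`sum_log_gap_le`), and the costs for `a` are dominated by the
product of two such sums.  The remaining work is `O(log n)` per position, which is within the bound,
too (`cost_le`).  The numerical constants in the time bounds are generous.

The program uses the registers `0` (`n`, and the result at the end), `1` (number of pairs that were
output), `2` (`n + 1`), `3` (position of a scan), `4` and `5` (`x` and `y`), `6` (a length),
`7` and `8` (node of the Fenwick tree), `9` (first pair that is not in the Fenwick tree),
`10` (greatest length), `11` and `12` (first occurrences in `A` and `B`) and `13` (node of the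
tournament tree), and the arrays `0` and `1` (`A` and `B`), `2`, `3`, `4` (output), `5` and `7`
(first occurrence of each integer in `A` and `B`, less `n + 1`), `6` and `8` (next occurrences),
`9` and `11` (last occurrence of each integer so far), `10` and `12` (previous occurrences),
`13` (`low`), `14` (tournament tree), `15` (lengths in the previous row of the grid) and
`16` (Fenwick tree).
-/

/-! ### Fenwick trees -/

namespace Fenwick

/-- The largest power of two that divides `u`; the value at `0` is `0`. -/
def low (u : ℕ) : ℕ :=
  if u = 0 then 0 else if u % 2 = 1 then 1 else 2 * low (u / 2)
decreasing_by omega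

theorem low_odd {u : ℕ} (h : u % 2 = 1) : low u = 1 := by
  rw [low, if_neg (by omega), if_pos h]

theorem low_even {u : ℕ} (h : u % 2 = 0) : low u = 2 * low (u / 2) := by
  rcases Nat.eq_zero_or_pos u with rfl | hu
  · simp [low]
  · rw [low, if_neg (by omega), if_neg (by omega)]

theorem low_pos {u : ℕ} (h : 1 ≤ u) : 1 ≤ low u := by
  induction u using Nat.strong_induction_on with
  | _ u ih =>
    rcases Nat.mod_two_eq_zero_or_one u with h2 | h2
    · rw [low_even h2]
      have := ih (u / 2) (by omega) (by omega)
      omega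
    · rw [low_odd h2]

theorem low_le (u : ℕ) : low u ≤ u := by
  induction u using Nat.strong_induction_on with
  | _ u ih =>
    rcases Nat.mod_two_eq_zero_or_one u with h2 | h2
    · rcases Nat.eq_zero_or_pos u with rfl | hu
      · simp [low]
      · rw [low_even h2]
        have := ih (u / 2) (by omega)
        omega
    · rw [low_odd h2]; omega

theorem two_mul_low_le_low_sub {u : ℕ} (h : low u < u) : 2 * low u ≤ low (u - low u) := by
  induction u using Nat.strong_induction_on with
  | _ u ih =>
    rcases Nat.mod_two_eq_zero_or_one u with h2 | h2
    · rw [low_even h2] at h ⊢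
      have h3 := ih (u / 2) (by omega) (by omega)
      rw [low_even (u := u - _) (by omega),
        show (u - 2 * low (u / 2)) / 2 = u / 2 - low (u / 2) by omega]
      omega
    · rw [low_odd h2] at h ⊢
      rw [low_even (u := u - 1) (by omega)]
      have := low_pos (u := (u - 1) / 2) (by omega)
      omega

theorem two_mul_low_le_low_add (u : ℕ) : 2 * low u ≤ low (u + low u) := by
  induction u using Nat.strong_induction_on with
  | _ u ih =>
    rcases Nat.mod_two_eq_zero_or_one u with h2 | h2
    · rcases Nat.eq_zero_or_pos u with rfl | hu
      · simp [low]
      rw [low_even h2]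
      have h3 := ih (u / 2) (by omega)
      rw [low_even (u := u + _) (by omega),
        show (u + 2 * low (u / 2)) / 2 = u / 2 + low (u / 2) by omega]
      omega
    · rw [low_odd h2]
      rw [low_even (u := u + 1) (by omega)]
      have := low_pos (u := (u + 1) / 2) (by omega)
      omega

/-- The position `x` is among the positions `u - low u + 1, …, u` that the node `u` of a Fenwick
tree is responsible for. -/
def InNode (u x : ℕ) : Prop := x ≤ u ∧ u < x + low u

/-- A node above `x` whose range contains `x` is at least the successor `x + low x` of `x`. -/
theorem InNode.add_low_le {u x : ℕ} (h : InNode u x) (hx : x < u) : x + low x ≤ u := by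
  induction u using Nat.strong_induction_on generalizing x with
  | _ u ih =>
    obtain ⟨h0, h1⟩ := h
    rcases Nat.mod_two_eq_zero_or_one u with h2 | h2
    · rcases Nat.mod_two_eq_zero_or_one x with h3 | h3
      · rw [low_even h3]
        rw [low_even h2] at h1
        have := @ih (u / 2) (by omega) (x / 2) ⟨by omega, by omega⟩ (by omega)
        omega
      · rw [low_odd h3]; omega
    · rw [low_odd h2] at h1
      omega

/-- The number of nodes on the way down from `u` that are greater than `p`. -/
def down (p u : ℕ) : ℕ :=
  if h : p < u then down p (u - low u) + 1 else 0
termination_by u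
decreasing_by have := low_pos (u := u) (by omega); omega

theorem down_of_lt {p u : ℕ} (h : p < u) : down p u = down p (u - low u) + 1 := by
  rw [down, dif_pos h]

/-- The number of nodes on the way up from `u` that are less than `q`. -/
def up (q u : ℕ) : ℕ :=
  if h : 0 < u ∧ u < q then up q (u + low u) + 1 else 0
termination_by q - u
decreasing_by have := low_pos (u := u) (by omega); omega

theorem up_of_lt {q u : ℕ} (h0 : 0 < u) (h : u < q) : up q u = up q (u + low u) + 1 := by
  rw [up, dif_pos ⟨h0, h⟩]

/-- All steps but the last one stay above `p`, and their widths at least double from step to step;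
so the last of these widths is at most `u - p`, up to the first width. -/
theorem low_mul_two_pow_down_le {p u : ℕ} (h : p < u) :
    low u * 2 ^ (down p u - 1) ≤ (u - p - 1) + low u := by
  induction u using Nat.strong_induction_on with
  | _ u ih =>
    rw [down_of_lt h]
    have hl := low_pos (u := u) (by omega)
    by_cases h2 : p < u - low u
    · have h3 := ih (u - low u) (by omega) h2
      have h4 := two_mul_low_le_low_sub (u := u) (by omega)
      have h5 : down p (u - low u) = down p (u - low u) - 1 + 1 := by
        rw [down_of_lt h2]; omega
      generalize down p (u - low u) - 1 = k at *
      rw [h5, Nat.add_sub_cancel, pow_succ]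
      have h6 : 1 ≤ 2 ^ k := Nat.one_le_two_pow
      obtain ⟨c, hc⟩ := Nat.exists_eq_add_of_le h4
      rw [hc] at h3
      obtain ⟨j, hj⟩ := Nat.exists_eq_add_of_le h6
      rw [hj] at h3 ⊢
      ring_nf at h3 ⊢
      have : c * (1 + j) = c + c * j := by ring
      omega
    · have h3 : down p (u - low u) = 0 := by rw [down, dif_neg h2]
      rw [h3]; simp

/-- All steps but the last one stay below `q`, and their widths at least double from step to
step. -/
theorem low_mul_two_pow_up_le {q u : ℕ} (h0 : 0 < u) (h : u < q) :
    low u * 2 ^ (up q u - 1) ≤ (q - u - 1) + low u := by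
  induction hk : q - u using Nat.strong_induction_on generalizing u with
  | _ m ih =>
    subst hk
    rw [up_of_lt h0 h]
    have hl := low_pos (u := u) (by omega)
    by_cases h2 : u + low u < q
    · have h3 := ih (q - (u + low u)) (by omega) (u := u + low u) (by omega) h2 rfl
      have h4 := two_mul_low_le_low_add u
      have h5 : up q (u + low u) = up q (u + low u) - 1 + 1 := by
        rw [up_of_lt (by omega) h2]; omega
      generalize up q (u + low u) - 1 = k at *
      rw [h5, Nat.add_sub_cancel, pow_succ]
      have h6 : 1 ≤ 2 ^ k := Nat.one_le_two_pow
      obtain ⟨c, hc⟩ := Nat.exists_eq_add_of_le h4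
      rw [hc] at h3
      obtain ⟨j, hj⟩ := Nat.exists_eq_add_of_le h6
      rw [hj] at h3 ⊢
      ring_nf at h3 ⊢
      have : c * (1 + j) = c + c * j := by ring
      omega
    · have h3 : up q (u + low u) = 0 := by rw [up, dif_neg (by omega)]
      rw [h3]; simp

theorem le_of_mul_le_add_sub {l p d : ℕ} (hl : 1 ≤ l) (hp : 1 ≤ p) (hd : 1 ≤ d)
    (h : l * p ≤ (d - 1) + l) : p ≤ d := by
  obtain ⟨l, rfl⟩ := Nat.exists_eq_add_of_le hl
  obtain ⟨p, rfl⟩ := Nat.exists_eq_add_of_le hp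
  obtain ⟨d, rfl⟩ := Nat.exists_eq_add_of_le hd
  ring_nf at h ⊢
  have := Nat.zero_le (l * p)
  omega

theorem down_le {p u : ℕ} (h : p < u) : down p u ≤ Nat.log 2 (u - p) + 1 := by
  have h1 := le_of_mul_le_add_sub (low_pos (by omega)) Nat.one_le_two_pow
    (by omega) (low_mul_two_pow_down_le h)
  have := Nat.le_log_of_pow_le (by omega) h1
  omega

theorem up_le {q u : ℕ} (h0 : 0 < u) (h : u < q) : up q u ≤ Nat.log 2 (q - u) + 1 := by
  have h1 := le_of_mul_le_add_sub (low_pos (by omega)) Nat.one_le_two_pow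
    (by omega) (low_mul_two_pow_up_le h0 h)
  have := Nat.le_log_of_pow_le (by omega) h1
  omega

end Fenwick

/-! ### Common increasing subsequences that end with a given matching pair -/

namespace LCIS

variable {n : ℕ} (A B : Fin n → ℤ)

/-- The entry of `A` at the position `x`, where positions are counted from `1`. -/
def val (x : ℕ) : ℤ := WordRAM.cells A ((x : ℤ) - 1)

theorem val_add_one (i : Fin n) : val A (i + 1) = A i := by
  have := i.2
  simp [val, WordRAM.cells]

theorem val_eq {x : ℕ} (h1 : 1 ≤ x) (h2 : x ≤ n) : val A x = A ⟨x - 1, by omega⟩ := by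
  rw [← val_add_one A ⟨x - 1, by omega⟩]
  congr 1
  simp; omega

/-- The positions `x` of `A` and `y` of `B`, counted from `1`, carry the same integer. -/
def Match (x y : ℕ) : Prop := 1 ≤ x ∧ x ≤ n ∧ 1 ≤ y ∧ y ≤ n ∧ val A x = val B y

theorem match_add_one (i j : Fin n) : Match A B (i + 1) (j + 1) ↔ A i = B j := by
  have := i.2
  have := j.2
  simp only [Match, val_add_one]
  constructor
  · exact fun h => h.2.2.2.2
  · exact fun h => ⟨by omega, by omega, by omega, by omega, h⟩

/-- There is a common increasing subsequence of length `m` that ends with the pair `(x, y)`. -/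
inductive Chain : ℕ → ℕ → ℕ → Prop
  | one {x y : ℕ} (h : Match A B x y) : Chain x y 1
  | cons {x' y' x y m : ℕ} (hc : Chain x' y' m) (h : Match A B x y) (hx : x' < x) (hy : y' < y)
      (hv : val A x' < val A x) : Chain x y (m + 1)

variable {A B}

theorem Chain.matches {x y m : ℕ} (h : Chain A B x y m) : Match A B x y := by
  cases h <;> assumption

theorem Chain.le {x y m : ℕ} (h : Chain A B x y m) : m ≤ x := by
  induction h with
  | one h => exact h.1
  | cons => omega

theorem Chain.pos {x y m : ℕ} (h : Chain A B x y m) : 1 ≤ m := by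
  cases h <;> omega

theorem Chain.exists_isCommonIncreasing {x y m : ℕ} (h : Chain A B x y m) :
    ∃ i j : Fin m → Fin n, IsCommonIncreasing A B m i j ∧
      ∀ k : Fin m, (k : ℕ) + 1 = m → (i k : ℕ) + 1 = x ∧ (j k : ℕ) + 1 = y := by
  induction h with
  | @one x y h =>
    obtain ⟨h1, h2, h3, h4, h5⟩ := h
    refine ⟨fun _ => ⟨x - 1, by omega⟩, fun _ => ⟨y - 1, by omega⟩, ⟨?_, ?_, ?_, ?_⟩, ?_⟩
    · exact Subsingleton.strictMono _
    · exact Subsingleton.strictMono _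
    · intro _
      rw [← val_eq A h1 h2, ← val_eq B h3 h4, h5]
    · exact Subsingleton.strictMono _
    · intro k _
      simp; omega
  | @cons x' y' x y m hc h hx hy hv ih =>
    obtain ⟨i, j, ⟨hi, hj, hij, hA⟩, hl⟩ := ih
    obtain ⟨h1, h2, h3, h4, h5⟩ := h
    have hm := hc.pos
    obtain ⟨m, rfl⟩ := Nat.exists_eq_add_of_le' hm
    have hlast := hl (Fin.last m) (by simp)
    have hAx : A ⟨x - 1, by omega⟩ = val A x := (val_eq A h1 h2).symm
    have hBy : B ⟨y - 1, by omega⟩ = val B y := (val_eq B h3 h4).symm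
    have hAl : A (i (Fin.last m)) = val A x' := by rw [← val_add_one A, hlast.1]
    refine ⟨Fin.snoc (α := fun _ => Fin n) i ⟨x - 1, by omega⟩,
      Fin.snoc (α := fun _ => Fin n) j ⟨y - 1, by omega⟩, ⟨?_, ?_, ?_, ?_⟩, ?_⟩
    · rw [Fin.strictMono_iff_lt_succ]
      intro k
      refine Fin.lastCases ?_ (fun k => ?_) k
      · rw [Fin.succ_last, Fin.snoc_last, Fin.snoc_castSucc, Fin.lt_def]
        simp; omega
      · rw [Fin.succ_castSucc, Fin.snoc_castSucc, Fin.snoc_castSucc]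
        exact hi (Fin.castSucc_lt_succ)
    · rw [Fin.strictMono_iff_lt_succ]
      intro k
      refine Fin.lastCases ?_ (fun k => ?_) k
      · rw [Fin.succ_last, Fin.snoc_last, Fin.snoc_castSucc, Fin.lt_def]
        simp; omega
      · rw [Fin.succ_castSucc, Fin.snoc_castSucc, Fin.snoc_castSucc]
        exact hj (Fin.castSucc_lt_succ)
    · intro k
      refine Fin.lastCases ?_ (fun k => ?_) k
      · rw [Fin.snoc_last, Fin.snoc_last, hAx, hBy, h5]
      · rw [Fin.snoc_castSucc, Fin.snoc_castSucc, hij]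
    · rw [Fin.strictMono_iff_lt_succ]
      intro k
      refine Fin.lastCases ?_ (fun k => ?_) k
      · simp only [Fin.succ_last, Fin.snoc_last, Fin.snoc_castSucc]
        rw [hAx, hAl]; exact hv
      · simp only [Fin.succ_castSucc, Fin.snoc_castSucc]
        exact hA (Fin.castSucc_lt_succ)
    · intro k hk
      have : k = Fin.last (m + 1) := by ext; simp; omega
      subst this
      rw [Fin.snoc_last, Fin.snoc_last]
      simp; omega

theorem IsCommonIncreasing.chain {m : ℕ} {i j : Fin (m + 1) → Fin n}
    (h : IsCommonIncreasing A B (m + 1) i j) :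
    Chain A B (i (Fin.last m) + 1) (j (Fin.last m) + 1) (m + 1) := by
  induction m with
  | zero => exact .one ((match_add_one A B _ _).2 (h.2.2.1 _))
  | succ m ih =>
    obtain ⟨hi, hj, hij, hA⟩ := h
    have hc := ih (i := fun k => i k.castSucc) (j := fun k => j k.castSucc)
      ⟨hi.comp (Fin.strictMono_castSucc), hj.comp (Fin.strictMono_castSucc), fun k => hij _,
        hA.comp (Fin.strictMono_castSucc)⟩
    refine .cons hc ((match_add_one A B _ _).2 (hij _)) ?_ ?_ ?_
    · have := hi (Fin.castSucc_lt_last (Fin.last m))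
      simpa using this
    · have := hj (Fin.castSucc_lt_last (Fin.last m))
      simpa using this
    · rw [val_add_one, val_add_one]
      exact hA (Fin.castSucc_lt_last (Fin.last m))

variable (A B) in
/-- The length of a longest common increasing subsequence that ends with the pair `(x, y)`; it is
`0` if the pair does not match. -/
noncomputable def lenAt (x y : ℕ) : ℕ := sSup {m | Chain A B x y m}

theorem bddAbove_chain (x y : ℕ) : BddAbove {m | Chain A B x y m} :=
  ⟨x, fun _ h => Chain.le h⟩

theorem Chain.le_lenAt {x y m : ℕ} (h : Chain A B x y m) : m ≤ lenAt A B x y :=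
  le_csSup (bddAbove_chain x y) h

theorem chain_lenAt {x y : ℕ} (h : Match A B x y) : Chain A B x y (lenAt A B x y) :=
  Nat.sSup_mem ⟨1, Chain.one h⟩ (bddAbove_chain x y)

theorem one_le_lenAt {x y : ℕ} (h : Match A B x y) : 1 ≤ lenAt A B x y :=
  (chain_lenAt h).pos

theorem lenAt_eq_zero {x y : ℕ} (h : ¬ Match A B x y) : lenAt A B x y = 0 := by
  have : {m | Chain A B x y m} = ∅ := by
    ext m
    simp only [Set.mem_ofPred_eq, Set.mem_empty_iff_false, iff_false]
    exact fun hc => h hc.matches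
  rw [lenAt, this, csSup_empty]; rfl

theorem lenAt_le (x y : ℕ) : lenAt A B x y ≤ x := by
  by_cases h : Match A B x y
  · exact (chain_lenAt h).le
  · rw [lenAt_eq_zero h]; omega

theorem lenAt_lt {x y x' y' : ℕ} (h : Match A B x y) (h' : Match A B x' y') (hx : x' < x)
    (hy : y' < y) (hv : val A x' < val A x) : lenAt A B x' y' < lenAt A B x y :=
  ((chain_lenAt h').cons h hx hy hv).le_lenAt

theorem exists_lenAt {x y : ℕ} (h : Match A B x y) :
    lenAt A B x y = 1 ∨ ∃ x' y', Match A B x' y' ∧ x' < x ∧ y' < y ∧ val A x' < val A x ∧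
      lenAt A B x y ≤ lenAt A B x' y' + 1 := by
  have hc := chain_lenAt h
  generalize lenAt A B x y = l at hc
  cases hc with
  | one => exact .inl rfl
  | cons hc h hx hy hv =>
    exact .inr ⟨_, _, hc.matches, hx, hy, hv, Nat.succ_le_succ hc.le_lenAt⟩

/-- Among the pairs that carry the same integer, `lenAt` is monotone. -/
theorem lenAt_mono {x y x' y' : ℕ} (h : Match A B x y) (h' : Match A B x' y')
    (hv : val A x' = val A x) (hx : x' ≤ x) (hy : y' ≤ y) :
    lenAt A B x' y' ≤ lenAt A B x y := by
  rcases exists_lenAt h' with h1 | ⟨x₁, y₁, hm, hx1, hy1, hv1, h1⟩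
  · rw [h1]; exact one_le_lenAt h
  · have := lenAt_lt h hm (by omega) (by omega) (hv ▸ hv1)
    omega

theorem isLengthAt_lenAt {x y : Fin n} (h : A x = B y) :
    IsLengthAt A B x y (lenAt A B (x + 1) (y + 1)) := by
  constructor
  · have hc := chain_lenAt ((match_add_one A B x y).2 h)
    obtain ⟨i, j, hij, hl⟩ := hc.exists_isCommonIncreasing
    have hpos := hc.pos
    generalize lenAt A B (x + 1) (y + 1) = m at *
    obtain ⟨m, rfl⟩ := Nat.exists_eq_add_of_le' hpos
    have hlast := hl (Fin.last m) (by simp)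
    have hx : i (Fin.last m) = x := by ext; omega
    have hy : j (Fin.last m) = y := by ext; omega
    refine ⟨i, j, hij, ?_, ?_, ⟨_, hx⟩, ⟨_, hy⟩⟩
    · intro k; rw [← hx]; exact hij.1.monotone (Fin.le_last k)
    · intro k; rw [← hy]; exact hij.2.1.monotone (Fin.le_last k)
  · rintro m ⟨i, j, hij, hx, hy, ⟨k, hk⟩, ⟨k', hk'⟩⟩
    obtain _ | m := m
    · exact k.elim0
    · have h1 := hij.chain
      have h2 : i (Fin.last m) = x :=
        le_antisymm (hx _) (hk ▸ hij.1.monotone (Fin.le_last k))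
      have h3 : j (Fin.last m) = y :=
        le_antisymm (hy _) (hk' ▸ hij.2.1.monotone (Fin.le_last k'))
      rw [h2, h3] at h1
      exact h1.le_lenAt

/-- The length of a longest common increasing subsequence is the maximum of `lenAt`, and `0` if
there are no matching pairs. -/
theorem isLength_of_lenAt {l : ℕ} (hle : ∀ x y, Match A B x y → lenAt A B x y ≤ l)
    (hex : l = 0 ∨ ∃ x y, Match A B x y ∧ lenAt A B x y = l) : IsLength A B l := by
  constructor
  · rcases hex with rfl | ⟨x, y, hm, rfl⟩
    · exact ⟨fun k => k.elim0, fun k => k.elim0, fun k => k.elim0, fun k => k.elim0,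
        fun k => k.elim0, fun k => k.elim0⟩
    · obtain ⟨i, j, hij, -⟩ := (chain_lenAt hm).exists_isCommonIncreasing
      exact ⟨i, j, hij⟩
  · rintro m ⟨i, j, hij⟩
    obtain _ | m := m
    · omega
    · have h1 := hij.chain
      exact h1.le_lenAt.trans (hle _ _ h1.matches)

/-! ### Neighbouring occurrences of the same integer -/

variable (A)

/-- The last position before `x` that carries the integer `v`, and `0` if there is none. -/
def prevOcc (v : ℤ) (x : ℕ) : ℕ := Nat.findGreatest (fun z => val A z = v) (x - 1)

theorem exists_nextOcc (v : ℤ) (x : ℕ) : ∃ z, x ≤ z ∧ (n < z ∨ val A z = v) :=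
  ⟨x + n + 1, by omega, by omega⟩

open Classical in
/-- The first position from `x` on that carries the integer `v`, and `n + 1` if there is none
(for `x ≤ n + 1`). -/
noncomputable def nextOcc (v : ℤ) (x : ℕ) : ℕ := Nat.find (exists_nextOcc A v x)

theorem prevOcc_lt (v : ℤ) {x : ℕ} (hx : 1 ≤ x) : prevOcc A v x < x := by
  have := Nat.findGreatest_le (P := fun z => val A z = v) (x - 1)
  rw [prevOcc]; omega

theorem val_prevOcc {v : ℤ} {x : ℕ} (h : 1 ≤ prevOcc A v x) : val A (prevOcc A v x) = v :=
  Nat.findGreatest_of_ne_zero (P := fun z => val A z = v) (n := x - 1) rfl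
    (Nat.one_le_iff_ne_zero.1 h)

theorem val_ne_of_prevOcc_lt {v : ℤ} {x z : ℕ} (h1 : prevOcc A v x < z) (h2 : z < x) :
    val A z ≠ v :=
  Nat.findGreatest_is_greatest (P := fun z => val A z = v) h1 (by omega)

theorem le_nextOcc (v : ℤ) (x : ℕ) : x ≤ nextOcc A v x := by
  classical
  exact (Nat.find_spec (exists_nextOcc A v x)).1

theorem val_nextOcc {v : ℤ} {x : ℕ} (h : nextOcc A v x ≤ n) : val A (nextOcc A v x) = v := by
  classical
  exact (Nat.find_spec (exists_nextOcc A v x)).2.resolve_left (by rw [nextOcc] at h; omega)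

theorem val_ne_of_lt_nextOcc {v : ℤ} {x z : ℕ} (h1 : x ≤ z) (h2 : z < nextOcc A v x) :
    val A z ≠ v := by
  classical
  have := Nat.find_min (exists_nextOcc A v x) h2
  tauto

theorem nextOcc_le {v : ℤ} {x z : ℕ} (h1 : x ≤ z) (h2 : n < z ∨ val A z = v) :
    nextOcc A v x ≤ z := by
  classical
  exact Nat.find_le ⟨h1, h2⟩

theorem nextOcc_le_succ (v : ℤ) {x : ℕ} (h : x ≤ n + 1) : nextOcc A v x ≤ n + 1 :=
  nextOcc_le A h (by omega)

theorem nextOcc_step_of_eq {v : ℤ} {x : ℕ} (h : val A x = v) : nextOcc A v x = x :=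
  le_antisymm (nextOcc_le A le_rfl (.inr h)) (le_nextOcc A v x)

theorem nextOcc_step_of_ne {v : ℤ} {x : ℕ} (hx : x ≤ n) (h : val A x ≠ v) :
    nextOcc A v x = nextOcc A v (x + 1) := by
  classical
  apply le_antisymm
  · exact nextOcc_le A (by have := le_nextOcc A v (x + 1); omega)
      (Nat.find_spec (exists_nextOcc A v (x + 1))).2
  · refine nextOcc_le A ?_ (Nat.find_spec (exists_nextOcc A v x)).2
    have h1 := le_nextOcc A v x
    rcases h1.lt_or_eq with h2 | h2
    · exact h2
    · exact absurd (val_nextOcc A (v := v) (x := x) (by omega)) (h2 ▸ h)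

theorem prevOcc_step_of_eq {v : ℤ} {x : ℕ} (h : val A x = v) : prevOcc A v (x + 1) = x := by
  rw [prevOcc, Nat.add_sub_cancel]
  exact Nat.findGreatest_eq (P := fun z => val A z = v) h

theorem prevOcc_step_of_ne {v : ℤ} {x : ℕ} (hx : 1 ≤ x) (h : val A x ≠ v) :
    prevOcc A v (x + 1) = prevOcc A v x := by
  obtain ⟨x, rfl⟩ := Nat.exists_eq_add_of_le' hx
  rw [prevOcc, prevOcc, Nat.add_sub_cancel, Nat.add_sub_cancel]
  exact Nat.findGreatest_of_not (P := fun z => val A z = v) h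

end LCIS

/-! ### Reasoning about programs of the word RAM -/

namespace WordRAM

/-- The program `p` started in the state `s` halts, and its running time and its final state
satisfy `Q`. -/
def Run (w : ℕ) (p : Program) (s : State) (Q : ℕ → State → Prop) : Prop :=
  ∃ t s', Exec w p s t s' ∧ Q t s'

variable {w : ℕ} {p q : Program} {c e i : Expr} {r a : ℕ} {s s' : State} {Q Q' : ℕ → State → Prop}

theorem Run.mono (h : Run w p s Q) (hQ : ∀ t s', Q t s' → Q' t s') : Run w p s Q' := by
  obtain ⟨t, s', he, hq⟩ := h
  exact ⟨t, s', he, hQ t s' hq⟩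

theorem run_skip : Run w .skip s Q ↔ Q 1 s := by
  constructor
  · rintro ⟨t, s', h, hq⟩
    cases h; exact hq
  · exact fun h => ⟨_, _, .skip s, h⟩

theorem run_assign : Run w (.assign r e) s Q ↔ Q (e.cost + 1) (s.setReg r (e.eval w s)) := by
  constructor
  · rintro ⟨t, s', h, hq⟩
    cases h; exact hq
  · exact fun h => ⟨_, _, .assign r e s, h⟩

theorem run_store : Run w (.store a i e) s Q ↔
    Q (i.cost + e.cost + 1) (s.setArr a (i.eval w s) (e.eval w s)) := by
  constructor
  · rintro ⟨t, s', h, hq⟩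
    cases h; exact hq
  · exact fun h => ⟨_, _, .store a i e s, h⟩

theorem run_seq : Run w (.seq p q) s Q ↔
    Run w p s fun t₁ s₁ => Run w q s₁ fun t₂ s₂ => Q (t₁ + t₂) s₂ := by
  constructor
  · rintro ⟨t, s', h, hq⟩
    cases h with
    | seq _ _ _ s₁ _ t₁ t₂ hp hq' => exact ⟨t₁, s₁, hp, t₂, s', hq', hq⟩
  · rintro ⟨t₁, s₁, hp, t₂, s₂, hq, h⟩
    exact ⟨_, _, .seq p q _ _ _ _ _ hp hq, h⟩

theorem run_ite_of_ne (hc : c.eval w s ≠ 0) (h : Run w p s fun t s' => Q (c.cost + 1 + t) s') :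
    Run w (.ite c p q) s Q := by
  obtain ⟨t, s', he, hq⟩ := h
  exact ⟨_, _, .ite_true c p q s s' t hc he, hq⟩

theorem run_ite_of_eq (hc : c.eval w s = 0) (h : Run w q s fun t s' => Q (c.cost + 1 + t) s') :
    Run w (.ite c p q) s Q := by
  obtain ⟨t, s', he, hq⟩ := h
  exact ⟨_, _, .ite_false c p q s s' t hc he, hq⟩

/-- The registers that a program may write to. -/
def Program.regs : Program → List ℕ
  | .skip => []
  | .assign r _ => [r]
  | .store _ _ _ => []
  | .seq p q => p.regs ++ q.regs
  | .ite _ p q => p.regs ++ q.regs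
  | .loop _ p => p.regs

/-- The arrays that a program may write to. -/
def Program.arrs : Program → List ℕ
  | .skip => []
  | .assign _ _ => []
  | .store a _ _ => [a]
  | .seq p q => p.arrs ++ q.arrs
  | .ite _ p q => p.arrs ++ q.arrs
  | .loop _ p => p.arrs

/-- The states `s` and `s'` differ at most in the registers and arrays that `p` may write to. -/
def Frame (p : Program) (s s' : State) : Prop :=
  (∀ r, r ∉ p.regs → s'.reg r = s.reg r) ∧ ∀ a, a ∉ p.arrs → s'.arr a = s.arr a

theorem Frame.refl (p : Program) (s : State) : Frame p s s := ⟨fun _ _ => rfl, fun _ _ => rfl⟩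

theorem Frame.trans {s'' : State} (h : Frame p s s') (h' : Frame p s' s'') : Frame p s s'' :=
  ⟨fun r hr => (h'.1 r hr).trans (h.1 r hr), fun a ha => (h'.2 a ha).trans (h.2 a ha)⟩

theorem Frame.of_subset (h : Frame p s s') (hr : p.regs ⊆ q.regs) (ha : p.arrs ⊆ q.arrs) :
    Frame q s s' :=
  ⟨fun r h' => h.1 r fun h'' => h' (hr h''), fun a h' => h.2 a fun h'' => h' (ha h'')⟩

theorem Exec.frame {t : ℕ} (h : Exec w p s t s') : Frame p s s' := by
  induction h with
  | skip => exact Frame.refl _ _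
  | assign r e s =>
    refine ⟨fun r' hr => ?_, fun _ _ => rfl⟩
    simp only [Program.regs, List.mem_singleton] at hr
    exact Function.update_of_ne hr _ _
  | store a i e s =>
    refine ⟨fun _ _ => rfl, fun a' ha => ?_⟩
    simp only [Program.arrs, List.mem_singleton] at ha
    exact Function.update_of_ne ha _ _
  | seq p q _ _ _ _ _ _ _ ih₁ ih₂ =>
    exact (ih₁.of_subset (List.subset_append_left _ _) (List.subset_append_left _ _)).trans
      (ih₂.of_subset (List.subset_append_right _ _) (List.subset_append_right _ _))
  | ite_true c p q _ _ _ _ _ ih =>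
    exact ih.of_subset (List.subset_append_left _ _) (List.subset_append_left _ _)
  | ite_false c p q _ _ _ _ _ ih =>
    exact ih.of_subset (List.subset_append_right _ _) (List.subset_append_right _ _)
  | loop_exit => exact Frame.refl _ _
  | loop_step c p _ _ _ _ _ _ _ _ ih₁ ih₂ =>
    exact Frame.trans (ih₁.of_subset (List.Subset.refl _) (List.Subset.refl _)) ih₂

theorem Run.frame (h : Run w p s Q) : Run w p s fun t s' => Q t s' ∧ Frame p s s' := by
  obtain ⟨t, s', he, hq⟩ := h
  exact ⟨t, s', he, hq, he.frame⟩

theorem Run.and_frame {Q₁ Q₂ : ℕ → State → Prop} (h : Run w p s fun t s' => Q₁ t s' ∧ Q₂ t s') :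
    Run w p s fun t s' => Q₁ t s' ∧ Q₂ t s' ∧ Frame p s s' :=
  h.frame.mono fun _ _ h => ⟨h.1.1, h.1.2, h.2⟩

/-- The rule for loops.  The invariant `I` depends on a ghost value of type `ι`, the potential `Φ`
bounds the time that is left, and the states are known to differ from the initial one only in what
the loop writes to. -/
theorem run_loop {ι : Type*} (I : ι → State → Prop) (Φ : ι → ℕ) {s₀ : State} {R : State → Prop}
    (step : ∀ g s, Frame (.loop c p) s₀ s → I g s →
      (c.eval w s = 0 ∧ c.cost + 1 ≤ Φ g ∧ R s) ∨
      (c.eval w s ≠ 0 ∧ Run w p s fun t s' => ∃ g', I g' s' ∧ c.cost + 1 + t + Φ g' ≤ Φ g))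
    (g : ι) (h : I g s₀) :
    Run w (.loop c p) s₀ fun t s' => t ≤ Φ g ∧ R s' ∧ Frame (.loop c p) s₀ s' := by
  suffices H : ∀ m g s, Φ g ≤ m → Frame (.loop c p) s₀ s → I g s →
      Run w (.loop c p) s fun t s' => t ≤ Φ g ∧ R s' ∧ Frame (.loop c p) s₀ s' from
    H _ g s₀ le_rfl (Frame.refl _ _) h
  intro m
  induction m with
  | zero =>
    intro g s hm hf hI
    rcases step g s hf hI with ⟨_, h, _⟩ | ⟨_, t, s', _, g', _, h⟩ <;> omega
  | succ m ih =>
    intro g s hm hf hI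
    rcases step g s hf hI with ⟨hc, h, hR⟩ | ⟨hc, t, s', he, g', hI', h⟩
    · exact ⟨_, _, .loop_exit c p s hc, h, hR, hf⟩
    · have hf' : Frame (.loop c p) s₀ s' :=
        hf.trans (he.frame.of_subset (List.Subset.refl _) (List.Subset.refl _))
      obtain ⟨t₂, s₂, he₂, ht₂, hR₂, hf₂⟩ := ih g' s' (by omega) hf' hI'
      exact ⟨_, _, .loop_step c p _ _ _ _ _ hc he he₂, by omega, hR₂, hf₂⟩

/-! ### Words that do not overflow -/

theorem wrap_eq {z : ℤ} (h : IsWord w z) : wrap w z = z := by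
  obtain ⟨h1, h2⟩ := h
  have : ((2 ^ w : ℕ) : ℤ) = 2 ^ w := by push_cast; rfl
  exact Int.bmod_eq_of_le_mul_two (by rw [this]; omega) (by rw [this]; omega)

/-- Numbers of absolute value at most `2 * K` do not overflow. In this form, `omega` can discharge
the side conditions. -/
theorem wrap_of_le {z : ℤ} {K : ℤ} (hK : 4 * K < 2 ^ w) (h1 : -(2 * K) ≤ z) (h2 : z ≤ 2 * K) :
    wrap w z = z :=
  wrap_eq ⟨by omega, by omega⟩

theorem wrap_ite {P : Prop} [Decidable P] (hw : (4 : ℤ) < 2 ^ w) :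
    wrap w (if P then 1 else 0) = if P then 1 else 0 := by
  split_ifs <;> exact wrap_eq ⟨by omega, by omega⟩

theorem setReg_reg (s : State) (r r' : ℕ) (v : ℤ) :
    (s.setReg r v).reg r' = if r' = r then v else s.reg r' := by
  simp [State.setReg, Function.update_apply]

theorem setReg_arr (s : State) (r : ℕ) (v : ℤ) : (s.setReg r v).arr = s.arr := rfl

theorem setArr_reg (s : State) (a : ℕ) (i v : ℤ) : (s.setArr a i v).reg = s.reg := rfl

theorem setArr_arr_self (s : State) (a : ℕ) (i v z : ℤ) :
    (s.setArr a i v).arr a z = if z = i then v else s.arr a z := by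
  simp [State.setArr, Function.update_apply]

theorem setArr_arr_of_ne (s : State) {a a' : ℕ} (i v : ℤ) (h : a' ≠ a) :
    (s.setArr a i v).arr a' = s.arr a' := by
  simp [State.setArr, h]

end WordRAM

/-! ### Notation for expressions -/

namespace WordRAM

instance : Add Expr := ⟨Expr.op .add⟩
instance : Sub Expr := ⟨Expr.op .sub⟩
instance : Mul Expr := ⟨Expr.op .mul⟩
instance : Div Expr := ⟨Expr.op .div⟩
instance (k : ℕ) : OfNat Expr k := ⟨Expr.const k⟩

/-- The comparison `e₁ < e₂`. -/
abbrev Expr.lt (e₁ e₂ : Expr) : Expr := .op .lt e₁ e₂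

/-- The comparison `e₁ = e₂`. -/
abbrev Expr.eq (e₁ e₂ : Expr) : Expr := .op .eq e₁ e₂

/-- The maximum of `e₁` and `e₂`, as `e₁ + (e₁ < e₂) * (e₂ - e₁)`. -/
def Expr.max (e₁ e₂ : Expr) : Expr := e₁ + .op .lt e₁ e₂ * (e₂ - e₁)

/-- The value of `Expr.max`, in terms of the values of its arguments. -/
def wrapMax (w : ℕ) (a b : ℤ) : ℤ :=
  wrap w (a + wrap w (wrap w (if a < b then 1 else 0) * wrap w (b - a)))

theorem wrapMax_of_le {w : ℕ} {K a b : ℤ} (hK : 4 * K < 2 ^ w) (hK1 : 1 ≤ K) (ha : 0 ≤ a)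
    (ha' : a ≤ K) (hb : 0 ≤ b) (hb' : b ≤ K) : wrapMax w a b = max a b := by
  rw [wrapMax]
  split_ifs with hab
  · simp (disch := omega) [wrap_of_le hK]
  · simp (disch := omega) [wrap_of_le hK]

section
variable {w : ℕ} {s : State} (e₁ e₂ : Expr)

@[simp] theorem eval_max :
    (e₁.max e₂).eval w s = wrapMax w (e₁.eval w s) (e₂.eval w s) := rfl
@[simp] theorem cost_max : (e₁.max e₂).cost = 3 * e₁.cost + 2 * e₂.cost + 4 := by
  simp only [Expr.max]
  change e₁.cost + ((e₁.cost + e₂.cost + 1) + (e₂.cost + e₁.cost + 1) + 1) + 1 = _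
  ring

@[simp] theorem eval_add : (e₁ + e₂).eval w s = wrap w (e₁.eval w s + e₂.eval w s) := rfl
@[simp] theorem eval_sub : (e₁ - e₂).eval w s = wrap w (e₁.eval w s - e₂.eval w s) := rfl
@[simp] theorem eval_mul : (e₁ * e₂).eval w s = wrap w (e₁.eval w s * e₂.eval w s) := rfl
@[simp] theorem eval_div : (e₁ / e₂).eval w s = wrap w (e₁.eval w s / e₂.eval w s) := rfl
@[simp] theorem eval_ofNat (k : ℕ) : Expr.eval w s (no_index (OfNat.ofNat k)) = wrap w k := rfl
@[simp] theorem eval_reg (r : ℕ) : Expr.eval w s (.reg r) = s.reg r := rfl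
@[simp] theorem eval_load (a : ℕ) (e : Expr) :
    Expr.eval w s (.load a e) = s.arr a (e.eval w s) := rfl
@[simp] theorem eval_lt : Expr.eval w s (.op .lt e₁ e₂) =
    wrap w (if e₁.eval w s < e₂.eval w s then 1 else 0) := rfl
@[simp] theorem eval_eq : Expr.eval w s (.op .eq e₁ e₂) =
    wrap w (if e₁.eval w s = e₂.eval w s then 1 else 0) := rfl
@[simp] theorem cost_add : (e₁ + e₂).cost = e₁.cost + e₂.cost + 1 := rfl
@[simp] theorem cost_sub : (e₁ - e₂).cost = e₁.cost + e₂.cost + 1 := rfl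
@[simp] theorem cost_mul : (e₁ * e₂).cost = e₁.cost + e₂.cost + 1 := rfl
@[simp] theorem cost_div : (e₁ / e₂).cost = e₁.cost + e₂.cost + 1 := rfl
@[simp] theorem cost_op (o : BinOp) : (Expr.op o e₁ e₂).cost = e₁.cost + e₂.cost + 1 := rfl
@[simp] theorem cost_ofNat (k : ℕ) : Expr.cost (no_index (OfNat.ofNat k)) = 1 := rfl
@[simp] theorem cost_reg (r : ℕ) : Expr.cost (.reg r) = 1 := rfl
@[simp] theorem cost_load (a : ℕ) (e : Expr) : Expr.cost (.load a e) = e.cost + 1 := rfl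

end

attribute [simp] run_skip run_assign run_store run_seq setReg_reg setReg_arr setArr_reg
  setArr_arr_self setArr_arr_of_ne

end WordRAM

namespace LCIS

open WordRAM Fenwick

/-! ### Queries and updates of the Fenwick tree -/

/-- Words of `w` bits are large enough for the numbers that the program computes on sequences of
length `n`; `K` is a bound on these numbers. -/
structure Fits (w n : ℕ) (K : ℤ) : Prop where
  lt : 4 * K < 2 ^ w
  lin : 4 * ((n : ℤ) + 1) ≤ K
  sq : ((n : ℤ) + 1) * (n + 1) ≤ K

theorem Fits.addr {w n : ℕ} {K : ℤ} (h : Fits w n K) {u : ℕ} (hu : u ≤ n) :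
    0 ≤ (u : ℤ) * (n + 1) ∧ (u : ℤ) * (n + 1) ≤ K := by
  refine ⟨by positivity, ?_⟩
  have := h.sq
  have : (u : ℤ) * (n + 1) ≤ (n + 1) * (n + 1) := by gcongr; omega
  omega

theorem addr_inj {n u v u' v' : ℕ} (hv : v ≤ n) (hv' : v' ≤ n)
    (h : (u : ℤ) * (n + 1) + v = u' * (n + 1) + v') : u = u' ∧ v = v' := by
  have h1 : u * (n + 1) + v = u' * (n + 1) + v' := by exact_mod_cast h
  have h2 : u = u' := by
    have := congrArg (· / (n + 1)) h1
    simpa [Nat.add_div_of_dvd_right, Nat.mul_add_div, Nat.div_eq_of_lt (Nat.lt_succ_of_le hv),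
      Nat.div_eq_of_lt (Nat.lt_succ_of_le hv'), mul_comm _ (n + 1)] using this
  subst h2
  exact ⟨rfl, by omega⟩

variable {n : ℕ} {A B : Fin n → ℤ}

theorem Fits.eval_max {w n : ℕ} {K : ℤ} (h : Fits w n K) {s : State} {e₁ e₂ : Expr} {a b : ℕ}
    (h₁ : e₁.eval w s = a) (h₂ : e₂.eval w s = b) (ha : a ≤ n) (hb : b ≤ n) :
    (e₁.max e₂).eval w s = (max a b : ℕ) := by
  obtain ⟨hK, hl, -⟩ := h
  rw [WordRAM.eval_max, h₁, h₂, wrapMax_of_le hK] <;> omega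

variable (A B) in
/-- The part of the memory that the main loop only reads: the input, the links between the
occurrences of the same integer, and the table of the function `low`. -/
structure Static (s : State) : Prop where
  reg_len : s.reg 0 = n
  reg_succ : s.reg 2 = n + 1
  seqA : ∀ x : ℕ, s.arr 0 ((x : ℤ) - 1) = val A x
  headB : ∀ v : ℤ, s.arr 7 v = nextOcc B v 1 - ((n : ℤ) + 1)
  nextA : ∀ x : ℕ, 1 ≤ x → x ≤ n → s.arr 6 x = nextOcc A (val A x) (x + 1)
  nextB : ∀ y : ℕ, 1 ≤ y → y ≤ n → s.arr 8 y = nextOcc B (val B y) (y + 1)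
  prevA : ∀ x : ℕ, 1 ≤ x → x ≤ n → s.arr 10 x = prevOcc A (val A x) x
  prevB : ∀ y : ℕ, 1 ≤ y → y ≤ n → s.arr 12 y = prevOcc B (val B y) y
  low : ∀ u : ℕ, 1 ≤ u → u ≤ n → s.arr 13 u = low u

theorem Static.frame {p : Program} {s s' : State} (h : Static A B s) (hf : Frame p s s')
    (hr : ∀ r ∈ [0, 2], r ∉ p.regs) (ha : ∀ a ∈ [0, 6, 7, 8, 10, 12, 13], a ∉ p.arrs) :
    Static A B s' := by
  constructor
  · rw [hf.1 0 (hr 0 (by simp)), h.reg_len]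
  · rw [hf.1 2 (hr 2 (by simp)), h.reg_succ]
  · rw [hf.2 0 (ha 0 (by simp))]; exact h.seqA
  · rw [hf.2 7 (ha 7 (by simp))]; exact h.headB
  · rw [hf.2 6 (ha 6 (by simp))]; exact h.nextA
  · rw [hf.2 8 (ha 8 (by simp))]; exact h.nextB
  · rw [hf.2 10 (ha 10 (by simp))]; exact h.prevA
  · rw [hf.2 12 (ha 12 (by simp))]; exact h.prevB
  · rw [hf.2 13 (ha 13 (by simp))]; exact h.low

theorem Static.setReg {s : State} (h : Static A B s) {r : ℕ} (v : ℤ) (hr : r ∉ [0, 2]) :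
    Static A B (s.setReg r v) :=
  h.frame (p := .assign r (.const 0))
    ⟨fun r' hr' => by simp_all [Program.regs], fun _ _ => rfl⟩
    (by intro r' h1 h2; simp only [Program.regs, List.mem_singleton] at h2; exact hr (h2 ▸ h1))
    (by simp [Program.arrs])

/-- The array `16` holds the table `t` of a two-dimensional Fenwick tree, row by row. -/
def Table (n : ℕ) (t : ℕ → ℕ → ℕ) (s : State) : Prop :=
  ∀ u v : ℕ, 1 ≤ u → u ≤ n → 1 ≤ v → v ≤ n → s.arr 16 ((u : ℤ) * (n + 1) + v) = t u v

theorem Table.congr {t : ℕ → ℕ → ℕ} {s s' : State} (h : Table n t s) (h' : s'.arr 16 = s.arr 16) :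
    Table n t s' := by
  unfold Table; rw [h']; exact h

/-- The entry of the table at the node `(u, v)` (registers `7` and `8`). -/
abbrev entry : Expr := .load 16 (.reg 7 * .reg 2 + .reg 8)

/-- Raise `g` (register `6`) to the entries of row `u` (register `7`) at the nodes on the way
down from `y` (register `5`) to its previous occurrence. -/
def queryRow : Program :=
  .loop ((Expr.load 12 (.reg 5)).lt (.reg 8)) <|
  .seq (.assign 6 ((Expr.reg 6).max entry)) <|
  .assign 8 (.reg 8 - .load 13 (.reg 8))

/-- The final `g'` is at most every bound of `g` and of the entries that a prefix query may read,
and at least some entry whose node covers `y'`, for each `y'` after the previous occurrence. -/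
theorem run_queryRow {w : ℕ} {K : ℤ} (hw : Fits w n K) {s : State} (hS : Static A B s)
    {t : ℕ → ℕ → ℕ} (hT : Table n t s) (ht : ∀ u v, t u v ≤ n) {y u g p : ℕ} (hy : 1 ≤ y)
    (hyn : y ≤ n) (hu : 1 ≤ u) (hun : u ≤ n) (hg : g ≤ n) (hp : prevOcc B (val B y) y = p)
    (h5 : s.reg 5 = y) (h6 : s.reg 6 = g) (h7 : s.reg 7 = u) (h8 : s.reg 8 = y) :
    Run w queryRow s fun τ s' => τ ≤ 40 * down p y + 10 ∧ (∃ g' : ℕ, s'.reg 6 = g' ∧ g ≤ g' ∧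
      (∀ c, g ≤ c → (∀ v, 1 ≤ v → v ≤ y → t u v ≤ c) → g' ≤ c) ∧
      ∀ y', p < y' → y' ≤ y → ∃ v, v ≤ y ∧ InNode v y' ∧ t u v ≤ g') ∧ Frame queryRow s s' := by
  obtain ⟨hK, hl, -⟩ := id hw
  obtain ⟨ha0, ha⟩ := hw.addr hun
  refine run_loop (fun (b : ℕ × ℕ) s' => s'.reg 8 = b.1 ∧ b.1 ≤ y ∧ s'.reg 6 = b.2 ∧ g ≤ b.2 ∧
      (∀ c, g ≤ c → (∀ v, 1 ≤ v → v ≤ y → t u v ≤ c) → b.2 ≤ c) ∧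
      ∀ y', b.1 < y' → p < y' → y' ≤ y → ∃ v, v ≤ y ∧ InNode v y' ∧ t u v ≤ b.2)
      (fun b => 40 * down p b.1 + 10) ?_ (y, g) ?_
  swap
  · exact ⟨h8, le_rfl, h6, le_rfl, fun c h _ => h, fun y' h1 _ h2 => absurd h1 (by simpa using h2)⟩
  rintro ⟨v, g1⟩ s1 hF ⟨h8, hv, h6, hg1, hub, hcov⟩
  dsimp only at *
  have hS1 : Static A B s1 := hS.frame hF (by decide) (by decide)
  have h5' : s1.reg 5 = y := by rw [hF.1 5 (by decide), h5]
  have h7' : s1.reg 7 = u := by rw [hF.1 7 (by decide), h7]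
  have hT1 : Table n t s1 := hT.congr (hF.2 16 (by decide))
  have hc : Expr.eval w s1 ((Expr.load 12 (.reg 5)).lt (.reg 8)) = if p < v then 1 else 0 := by
    simp (disch := omega) [wrap_ite, h5', h8, hS1.prevB y hy hyn, hp]
  rw [hc]
  by_cases hpv : p < v
  · right
    refine ⟨by simp [hpv], ?_⟩
    have hlow := low_le v
    have hlow' := low_pos (u := v) (by omega)
    have hld : Expr.eval w s1 entry = t u v := by
      simp (disch := omega) [h7', h8, hS1.reg_succ, wrap_of_le hK,
        hT1 u v hu hun (by omega) (by omega)]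
    have hgn : g1 ≤ n := hub n hg (fun v _ _ => ht u v)
    rw [run_seq, run_assign, hw.eval_max (e₁ := .reg 6) h6 hld hgn (ht u v), run_assign]
    refine ⟨(v - low v, max g1 (t u v)), ⟨?_, by simp; omega, by simp, by simp; omega, ?_, ?_⟩, ?_⟩
    · simp (disch := omega) [h8, hS1.low v (by omega) (by omega), wrap_of_le hK]
    · exact fun c h1 h2 => max_le (hub c h1 h2) (h2 v (by omega) hv)
    · intro y' h1 h2 h3
      dsimp only at *
      by_cases hvy : v < y'
      · obtain ⟨v', h4, h5, h6⟩ := hcov y' hvy h2 h3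
        exact ⟨v', h4, h5, h6.trans (le_max_left _ _)⟩
      · exact ⟨v, hv, ⟨by omega, by omega⟩, le_max_right _ _⟩
    · rw [down_of_lt hpv]
      simp; omega
  · left
    refine ⟨by simp [hpv], by simp, g1, h6, hg1, hub, fun y' h1 h2 => hcov y' (by omega) h1 h2⟩

/-- Raise `g` (register `6`) to the entries at the nodes on the way down from `x` (register `4`)
to its previous occurrence in `A`, and from `y` (register `5`) to its previous occurrence
in `B`. -/
def query : Program :=
  .seq (.assign 7 (.reg 4)) <|
  .loop ((Expr.load 10 (.reg 4)).lt (.reg 7)) <|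
  .seq (.assign 8 (.reg 5)) <|
  .seq queryRow <|
  .assign 7 (.reg 7 - .load 13 (.reg 7))

/-- The two-dimensional version of `run_queryRow`: the final `g'` accounts for the whole rectangle
between the previous occurrences and `(x, y)`, and for nothing outside the prefix that ends at
`(x, y)`. -/
theorem run_query {w : ℕ} {K : ℤ} (hw : Fits w n K) {s : State} (hS : Static A B s)
    {t : ℕ → ℕ → ℕ} (hT : Table n t s) (ht : ∀ u v, t u v ≤ n) {x y g p q : ℕ} (hx : 1 ≤ x)
    (hxn : x ≤ n) (hy : 1 ≤ y) (hyn : y ≤ n) (hg : g ≤ n) (hp : prevOcc A (val A x) x = p)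
    (hq : prevOcc B (val B y) y = q) (h4 : s.reg 4 = x) (h5 : s.reg 5 = y) (h6 : s.reg 6 = g) :
    Run w query s fun τ s' => τ ≤ 80 * (down p x * down q y) + 20 ∧
      (∃ g' : ℕ, s'.reg 6 = g' ∧ g ≤ g' ∧
        (∀ c, g ≤ c → (∀ u v, 1 ≤ u → u ≤ x → 1 ≤ v → v ≤ y → t u v ≤ c) → g' ≤ c) ∧
        ∀ x' y', p < x' → x' ≤ x → q < y' → y' ≤ y →
          ∃ u v, u ≤ x ∧ v ≤ y ∧ InNode u x' ∧ InNode v y' ∧ t u v ≤ g') ∧ Frame query s s' := by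
  obtain ⟨hK, hl, -⟩ := id hw
  have hqy : q < y := hq ▸ prevOcc_lt B _ hy
  refine Run.and_frame ?_
  rw [query, run_seq, run_assign, eval_reg, h4]
  have hdq : 1 ≤ down q y := by rw [down_of_lt hqy]; omega
  have hpx : p < x := hp ▸ prevOcc_lt A _ hx
  have hdp : 1 ≤ down p x := by rw [down_of_lt hpx]; omega
  refine Run.mono (run_loop (fun (b : ℕ × ℕ) s' => s'.reg 7 = b.1 ∧ b.1 ≤ x ∧ s'.reg 6 = b.2 ∧
      g ≤ b.2 ∧ (∀ c, g ≤ c → (∀ u v, 1 ≤ u → u ≤ x → 1 ≤ v → v ≤ y → t u v ≤ c) → b.2 ≤ c) ∧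
      ∀ x' y', b.1 < x' → p < x' → x' ≤ x → q < y' → y' ≤ y →
          ∃ u v, u ≤ x ∧ v ≤ y ∧ InNode u x' ∧ InNode v y' ∧ t u v ≤ b.2)
      (fun b => (40 * down q y + 40) * down p b.1 + 10)
      (R := fun s' => ∃ g' : ℕ, s'.reg 6 = g' ∧ g ≤ g' ∧
        (∀ c, g ≤ c → (∀ u v, 1 ≤ u → u ≤ x → 1 ≤ v → v ≤ y → t u v ≤ c) → g' ≤ c) ∧
        ∀ x' y', p < x' → x' ≤ x → q < y' → y' ≤ y →
          ∃ u v, u ≤ x ∧ v ≤ y ∧ InNode u x' ∧ InNode v y' ∧ t u v ≤ g') ?_ (x, g) ?_) ?_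
  rotate_left
  · exact ⟨by simp, le_rfl, by simpa using h6, le_rfl, fun c h _ => h,
      fun x' y' h1 _ h2 => absurd h1 (by simpa using h2)⟩
  · rintro τ s' ⟨h1, h2, -⟩
    refine ⟨?_, h2⟩
    have : down p x ≤ down p x * down q y := Nat.le_mul_of_pos_right _ hdq
    have : (40 * down q y + 40) * down p x = 40 * (down p x * down q y) + 40 * down p x := by ring
    simp only [cost_reg] at h1 ⊢
    omega
  rintro ⟨u, g1⟩ s1 hF ⟨h7, hu, h6, hg1, hub, hcov⟩
  dsimp only at *
  have hS1 : Static A B s1 :=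
    (hS.setReg (r := 7) x (by decide)).frame hF (by decide) (by decide)
  have h4' : s1.reg 4 = x := by rw [hF.1 4 (by decide)]; simpa using h4
  have h5' : s1.reg 5 = y := by rw [hF.1 5 (by decide)]; simpa using h5
  have hT1 : Table n t s1 := hT.congr (hF.2 16 (by decide))
  have hc : Expr.eval w s1 ((Expr.load 10 (.reg 4)).lt (.reg 7)) = if p < u then 1 else 0 := by
    simp (disch := omega) [wrap_ite, h4', h7, hS1.prevA x hx hxn, hp]
  rw [hc]
  by_cases hpu : p < u
  · right
    refine ⟨by simp [hpu], ?_⟩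
    have hlow := low_le u
    have hlow' := low_pos (u := u) (by omega)
    have hgn : g1 ≤ n := hub n hg (fun u v _ _ _ _ => ht u v)
    rw [run_seq, run_assign, eval_reg, h5', run_seq]
    have hS2 : Static A B (s1.setReg 8 y) :=
      hS1.setReg (r := 8) y (by decide)
    refine Run.mono (run_queryRow hw hS2 (t := t) (u := u) (g := g1) hT1 ht hy hyn (by omega)
      (by omega) hgn hq (by simpa using h5') (by simpa using h6) (by simpa using h7) (by simp)) ?_
    rintro τ s2 ⟨hτ, ⟨g2, h6, hg2, hub2, hcov2⟩, hF2⟩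
    have hS3 : Static A B s2 := hS2.frame hF2 (by decide) (by decide)
    have h7 : s2.reg 7 = u := by rw [hF2.1 7 (by decide)]; simpa using h7
    rw [run_assign]
    refine ⟨(u - low u, g2), ⟨?_, by simp; omega, by simpa using h6, by simp; omega, ?_, ?_⟩, ?_⟩
    · simp (disch := omega) [h7, hS3.low u (by omega) (by omega), wrap_of_le hK]
    · exact fun c h1 h2 => hub2 c (hub c h1 h2) (fun v hv hv' => h2 u v (by omega) hu hv hv')
    · intro x' y' h1 h2 h3 h4 h5
      dsimp only at *
      by_cases hux : u < x'
      · obtain ⟨u', v', H1, H2, H3, H4, H5⟩ := hcov x' y' hux h2 h3 h4 h5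
        exact ⟨u', v', H1, H2, H3, H4, H5.trans hg2⟩
      · obtain ⟨v, H1, H2, H3⟩ := hcov2 y' h4 h5
        exact ⟨u, v, hu, H1, ⟨by omega, by omega⟩, H2, H3⟩
    · rw [down_of_lt hpu]
      simp only [cost_op, cost_load, cost_reg, cost_sub, Nat.mul_add]
      omega
  · left
    refine ⟨by simp [hpu], by simp, g1, h6, hg1, hub, fun x' y' h1 h2 => hcov x' y' (by omega) h1 h2⟩

/-- Raise the entries of row `u` (register `7`) at the nodes on the way up from `y` (register `5`)
to its next occurrence to `g` (register `6`). -/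
def updateRow : Program :=
  .loop ((Expr.reg 8).lt (.load 8 (.reg 5))) <|
  .seq (.store 16 (.reg 7 * .reg 2 + .reg 8) (entry.max (.reg 6))) <|
  .assign 8 (.reg 8 + .load 13 (.reg 8))

theorem run_updateRow {w : ℕ} {K : ℤ} (hw : Fits w n K) {s : State} (hS : Static A B s)
    {t : ℕ → ℕ → ℕ} (hT : Table n t s) (ht : ∀ u v, t u v ≤ n) {y u g q : ℕ} (hy : 1 ≤ y)
    (hyn : y ≤ n) (hu : 1 ≤ u) (hun : u ≤ n) (hg : g ≤ n) (hq : nextOcc B (val B y) (y + 1) = q)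
    (h5 : s.reg 5 = y) (h6 : s.reg 6 = g) (h7 : s.reg 7 = u) (h8 : s.reg 8 = y) :
    Run w updateRow s fun τ s' => τ ≤ 40 * up q y + 10 ∧ (∃ t' : ℕ → ℕ → ℕ, Table n t' s' ∧
      (∀ u' v', t u' v' ≤ t' u' v') ∧
      (∀ u' v', t' u' v' = t u' v' ∨ (t' u' v' = g ∧ u' = u ∧ y ≤ v')) ∧
      ∀ v, v < q → InNode v y → g ≤ t' u v) ∧ Frame updateRow s s' := by
  obtain ⟨hK, hl, -⟩ := id hw
  obtain ⟨ha0, ha⟩ := hw.addr hun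
  have hqn : q ≤ n + 1 := hq ▸ nextOcc_le_succ B _ (by omega)
  refine run_loop (fun (b : ℕ × (ℕ → ℕ → ℕ)) s' => s'.reg 8 = b.1 ∧ y ≤ b.1 ∧ Table n b.2 s' ∧
      (∀ u' v', t u' v' ≤ b.2 u' v') ∧
      (∀ u' v', b.2 u' v' = t u' v' ∨ (b.2 u' v' = g ∧ u' = u ∧ y ≤ v')) ∧
      ∀ v, v < b.1 → v < q → InNode v y → g ≤ b.2 u v)
      (fun b => 40 * up q b.1 + 10) ?_ (y, t) ?_
  swap
  · exact ⟨h8, le_rfl, hT, fun _ _ => le_rfl, fun _ _ => .inl rfl,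
      fun v h1 _ h2 => absurd h2.1 (by simpa using h1)⟩
  rintro ⟨v, t1⟩ s1 hF ⟨h8, hv, hT1, hle, hor, hcov⟩
  dsimp only at *
  have hS1 : Static A B s1 := hS.frame hF (by decide) (by decide)
  have h5' : s1.reg 5 = y := by rw [hF.1 5 (by decide), h5]
  have h6' : s1.reg 6 = g := by rw [hF.1 6 (by decide), h6]
  have h7' : s1.reg 7 = u := by rw [hF.1 7 (by decide), h7]
  have hc : Expr.eval w s1 ((Expr.reg 8).lt (.load 8 (.reg 5))) = if v < q then 1 else 0 := by
    simp (disch := omega) [wrap_ite, h5', h8, hS1.nextB y hy hyn, hq]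
  rw [hc]
  by_cases hpv : v < q
  · right
    refine ⟨by simp [hpv], ?_⟩
    have hlow := low_le v
    have hlow' := low_pos (u := v) (by omega)
    have had : Expr.eval w s1 (.reg 7 * .reg 2 + .reg 8) = (u : ℤ) * (n + 1) + v := by
      simp (disch := omega) [h7', h8, hS1.reg_succ, wrap_of_le hK]
    have hld : Expr.eval w s1 entry = t1 u v := by
      rw [eval_load, had, hT1 u v hu hun (by omega) (by omega)]
    have htn : t1 u v ≤ n := by
      have := ht u v
      rcases hor u v with h | h <;> omega
    rw [run_seq, run_store, had, hw.eval_max hld (e₂ := .reg 6) h6' htn hg, run_assign]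
    refine ⟨(v + low v, fun u' v' => if u' = u ∧ v' = v then max (t1 u v) g else t1 u' v'),
      ⟨?_, by simp; omega, ?_, ?_, ?_, ?_⟩, ?_⟩
    · simp (disch := omega) [h8, hS1.low v (by omega) (by omega), wrap_of_le hK]
    · intro u' v' h1 h2 h3 h4
      simp only [setReg_arr, setArr_arr_self]
      by_cases h : u' = u ∧ v' = v
      · rw [if_pos h, if_pos (by rw [h.1, h.2])]
      · rw [if_neg h, if_neg (fun h' => h (addr_inj h4 (by omega) h')), hT1 u' v' h1 h2 h3 h4]
    · intro u' v'
      dsimp only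
      split_ifs with h
      · rw [h.1, h.2]; exact (hle u v).trans (le_max_left _ _)
      · exact hle u' v'
    · intro u' v'
      dsimp only
      split_ifs with h
      · rw [h.1, h.2]
        rcases le_total g (t1 u v) with h1 | h1
        · rw [max_eq_left h1]
          have := hor u v
          tauto
        · rw [max_eq_right h1]
          exact .inr ⟨rfl, rfl, hv⟩
      · exact hor u' v'
    · intro v' h1 h2 h3
      dsimp only at *
      split_ifs with h
      · exact le_max_right _ _
      · by_cases hvy : v' < v
        · exact hcov v' hvy h2 h3
        · -- a later node that covers `y` covers `v`, so the walk does not skip it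
          exfalso
          have h4 : InNode v' v := ⟨by omega, by have := h3.2; omega⟩
          have h5 := h4.add_low_le (by have := h4.1; have : v' ≠ v := fun h6 => h ⟨rfl, h6⟩; omega)
          omega
    · rw [up_of_lt (by omega) hpv]
      simp; omega
  · left
    refine ⟨by simp [hpv], by simp, t1, hT1, hle, hor, fun v' h1 h2 => hcov v' (by omega) h1 h2⟩

/-- Raise the entries at the nodes on the way up from `x` (register `4`) to its next occurrence in
`A`, and from `y` (register `5`) to its next occurrence in `B`, to `g` (register `6`). -/
def update : Program :=
  .seq (.assign 7 (.reg 4)) <|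
  .loop ((Expr.reg 7).lt (.load 6 (.reg 4))) <|
  .seq (.assign 8 (.reg 5)) <|
  .seq updateRow <|
  .assign 7 (.reg 7 + .load 13 (.reg 7))

/-- Entries change to `g` only at nodes that may see `(x, y)`, and all nodes before the next
occurrences that cover `(x, y)` are raised to `g`. -/
theorem run_update {w : ℕ} {K : ℤ} (hw : Fits w n K) {s : State} (hS : Static A B s)
    {t : ℕ → ℕ → ℕ} (hT : Table n t s) (ht : ∀ u v, t u v ≤ n) {x y g p q : ℕ} (hx : 1 ≤ x)
    (hxn : x ≤ n) (hy : 1 ≤ y) (hyn : y ≤ n) (hg : g ≤ n)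
    (hp : nextOcc A (val A x) (x + 1) = p) (hq : nextOcc B (val B y) (y + 1) = q)
    (h4 : s.reg 4 = x) (h5 : s.reg 5 = y) (h6 : s.reg 6 = g) :
    Run w update s fun τ s' => τ ≤ 80 * (up p x * up q y) + 20 ∧ (∃ t' : ℕ → ℕ → ℕ, Table n t' s' ∧
      (∀ u v, t u v ≤ t' u v) ∧
      (∀ u v, t' u v = t u v ∨ (t' u v = g ∧ x ≤ u ∧ y ≤ v)) ∧
      ∀ u v, u < p → v < q → InNode u x → InNode v y → g ≤ t' u v) ∧ Frame update s s' := by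
  obtain ⟨hK, hl, -⟩ := id hw
  have hyq : y < q := hq ▸ le_nextOcc B _ _
  have hxp : x < p := hp ▸ le_nextOcc A _ _
  have hpn : p ≤ n + 1 := hp ▸ nextOcc_le_succ A _ (by omega)
  have huq : 1 ≤ up q y := by rw [up_of_lt (by omega) hyq]; omega
  have hup : 1 ≤ up p x := by rw [up_of_lt (by omega) hxp]; omega
  refine Run.and_frame ?_
  rw [update, run_seq, run_assign, eval_reg, h4]
  refine Run.mono (run_loop (fun (b : ℕ × (ℕ → ℕ → ℕ)) s' => s'.reg 7 = b.1 ∧ x ≤ b.1 ∧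
      Table n b.2 s' ∧ (∀ u v, t u v ≤ b.2 u v) ∧
      (∀ u v, b.2 u v = t u v ∨ (b.2 u v = g ∧ x ≤ u ∧ y ≤ v)) ∧
      ∀ u v, u < b.1 → u < p → v < q → InNode u x → InNode v y → g ≤ b.2 u v)
      (fun b => (40 * up q y + 40) * up p b.1 + 10)
      (R := fun s' => ∃ t' : ℕ → ℕ → ℕ, Table n t' s' ∧ (∀ u v, t u v ≤ t' u v) ∧
      (∀ u v, t' u v = t u v ∨ (t' u v = g ∧ x ≤ u ∧ y ≤ v)) ∧
      ∀ u v, u < p → v < q → InNode u x → InNode v y → g ≤ t' u v) ?_ (x, t) ?_) ?_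
  rotate_left
  · exact ⟨by simp, le_rfl, hT, fun _ _ => le_rfl, fun _ _ => .inl rfl,
      fun u v h1 _ _ h2 => absurd h2.1 (by simpa using h1)⟩
  · rintro τ s' ⟨h1, h2, -⟩
    refine ⟨?_, h2⟩
    have : up p x ≤ up p x * up q y := Nat.le_mul_of_pos_right _ huq
    have : (40 * up q y + 40) * up p x = 40 * (up p x * up q y) + 40 * up p x := by ring
    simp only [cost_reg] at h1 ⊢
    omega
  rintro ⟨u, t1⟩ s1 hF ⟨h7, hu, hT1, hle, hor, hcov⟩
  dsimp only at *
  have hS1 : Static A B s1 :=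
    (hS.setReg (r := 7) x (by decide)).frame hF (by decide) (by decide)
  have h4' : s1.reg 4 = x := by rw [hF.1 4 (by decide)]; simpa using h4
  have h5' : s1.reg 5 = y := by rw [hF.1 5 (by decide)]; simpa using h5
  have h6' : s1.reg 6 = g := by rw [hF.1 6 (by decide)]; simpa using h6
  have hc : Expr.eval w s1 ((Expr.reg 7).lt (.load 6 (.reg 4))) = if u < p then 1 else 0 := by
    simp (disch := omega) [wrap_ite, h4', h7, hS1.nextA x hx hxn, hp]
  rw [hc]
  by_cases hpu : u < p
  · right
    refine ⟨by simp [hpu], ?_⟩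
    have hlow := low_le u
    have hlow' := low_pos (u := u) (by omega)
    have ht1 : ∀ u v, t1 u v ≤ n := by
      intro u v
      have := ht u v
      rcases hor u v with h | h <;> omega
    rw [run_seq, run_assign, eval_reg, h5', run_seq]
    have hS2 : Static A B (s1.setReg 8 y) :=
      hS1.setReg (r := 8) y (by decide)
    refine Run.mono (run_updateRow hw hS2 (t := t1) (u := u) (g := g) hT1 ht1 hy hyn (by omega)
      (by omega) hg hq (by simpa using h5') (by simpa using h6') (by simpa using h7) (by simp)) ?_
    rintro τ s2 ⟨hτ, ⟨t2, hT2, hle2, hor2, hcov2⟩, hF2⟩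
    have hS3 : Static A B s2 := hS2.frame hF2 (by decide) (by decide)
    have h7 : s2.reg 7 = u := by rw [hF2.1 7 (by decide)]; simpa using h7
    rw [run_assign]
    refine ⟨(u + low u, t2), ⟨?_, by simp; omega, hT2, fun _ _ => (hle _ _).trans (hle2 _ _), ?_, ?_⟩,
      ?_⟩
    · simp (disch := omega) [h7, hS3.low u (by omega) (by omega), wrap_of_le hK]
    · intro u' v'
      dsimp only
      rcases hor2 u' v' with h | ⟨h, rfl, h'⟩
      · rw [h]; exact hor u' v'
      · exact .inr ⟨h, hu, h'⟩
    · intro u' v' h1 h2 h3 h4 h5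
      dsimp only at *
      by_cases hux : u' < u
      · exact (hcov u' v' hux h2 h3 h4 h5).trans (hle2 _ _)
      · by_cases huu : u' = u
        · subst huu
          exact hcov2 v' h3 h5
        · -- a later node that covers `x` covers `u`, so the walk does not skip it
          exfalso
          have h6 : InNode u' u := ⟨by omega, by have := h4.2; omega⟩
          have := h6.add_low_le (by omega)
          omega
    · rw [up_of_lt (by omega) hpu]
      simp only [cost_op, cost_load, cost_reg, cost_add, Nat.mul_add]
      omega
  · left
    refine ⟨by simp [hpu], by simp, t1, hT1, hle, hor,
      fun u' v' h1 h2 => hcov u' v' (by omega) h1 h2⟩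

/-! ### Processing the matching pairs of one integer -/

variable (A) in
theorem prevOcc_eq {v : ℤ} {x p : ℕ} (h1 : p < x) (h2 : p = 0 ∨ val A p = v)
    (h3 : ∀ z, p < z → z < x → val A z ≠ v) : prevOcc A v x = p := by
  rw [prevOcc, Nat.findGreatest_eq_iff]
  exact ⟨by omega, fun h => h2.resolve_left h, fun z hz hz' => h3 z hz (by omega)⟩

variable (A) in
theorem prevOcc_nextOcc (v : ℤ) (x : ℕ) :
    prevOcc A v (nextOcc A v (x + 1)) = prevOcc A v (x + 1) := by
  have h0 := prevOcc_lt A v (x := x + 1) (by omega)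
  have h1 := le_nextOcc A v (x + 1)
  refine prevOcc_eq A (by omega) ?_ fun z h2 h3 => ?_
  · by_cases h : prevOcc A v (x + 1) = 0
    · exact .inl h
    · exact .inr (val_prevOcc A (by omega))
  · by_cases h : z < x + 1
    · exact val_ne_of_prevOcc_lt A h2 h
    · exact val_ne_of_lt_nextOcc A (by omega) h3

variable (A) in
/-- The positions from `x` on that carry the integer `v`. -/
def occFrom (v : ℤ) (x : ℕ) : Finset ℕ := (Finset.Icc x n).filter fun z => val A z = v

theorem mem_occFrom {v : ℤ} {x z : ℕ} : z ∈ occFrom A v x ↔ x ≤ z ∧ z ≤ n ∧ val A z = v := by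
  simp [occFrom, and_assoc]

theorem occFrom_eq_insert {v : ℤ} {x : ℕ} (hx : x ≤ n) (hv : val A x = v) :
    occFrom A v x = insert x (occFrom A v (nextOcc A v (x + 1))) := by
  ext z
  simp only [Finset.mem_insert, mem_occFrom]
  have h1 := le_nextOcc A v (x + 1)
  constructor
  · rintro ⟨h2, h3, h4⟩
    by_cases h : z = x
    · exact .inl h
    · exact .inr ⟨nextOcc_le A (by omega) (.inr h4), h3, h4⟩
  · rintro (rfl | ⟨h2, h3, h4⟩)
    · exact ⟨le_rfl, hx, hv⟩
    · exact ⟨by omega, h3, h4⟩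

theorem sum_occFrom {v : ℤ} {x : ℕ} (hx : x ≤ n) (hv : val A x = v) (f : ℕ → ℕ) :
    ∑ z ∈ occFrom A v x, f z = f x + ∑ z ∈ occFrom A v (nextOcc A v (x + 1)), f z := by
  rw [occFrom_eq_insert hx hv, Finset.sum_insert]
  have h1 := le_nextOcc A v (x + 1)
  simp only [mem_occFrom]
  omega

theorem occFrom_nextOcc (v : ℤ) (x : ℕ) : occFrom A v (nextOcc A v x) = occFrom A v x := by
  have h1 := le_nextOcc A v x
  ext z
  simp only [mem_occFrom]
  refine ⟨fun h => ⟨by omega, h.2⟩, fun h => ⟨?_, h.2⟩⟩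
  exact nextOcc_le A h.1 (.inr h.2.2)

variable (A B) in
/-- The Fenwick tree `t` represents the values of `lenAt` at the matching pairs of the integers in
`D`.  The entry at `(u, v)` bounds all values in the range of the node; it need not be their maximum,
but it is attained or exceeded by a value in the prefix that ends at `(u, v)`, which suffices for
prefix maxima. -/
structure TableOk (D : Finset ℤ) (t : ℕ → ℕ → ℕ) : Prop where
  sound : ∀ u v, t u v = 0 ∨ ∃ x y, Match A B x y ∧ val A x ∈ D ∧ x ≤ u ∧ y ≤ v ∧
    t u v ≤ lenAt A B x y
  complete : ∀ x y u v, Match A B x y → val A x ∈ D → u ≤ n → v ≤ n → InNode u x → InNode v y →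
    lenAt A B x y ≤ t u v

theorem lenAt_le_len (x y : ℕ) : lenAt A B x y ≤ n := by
  by_cases h : Match A B x y
  · exact (lenAt_le x y).trans h.2.1
  · rw [lenAt_eq_zero h]; omega

theorem TableOk.le {D : Finset ℤ} {t : ℕ → ℕ → ℕ} (h : TableOk A B D t) (u v : ℕ) : t u v ≤ n := by
  rcases h.sound u v with h | ⟨x, y, -, -, -, -, h⟩
  · omega
  · exact h.trans (lenAt_le_len x y)

/-- The recursion that the query evaluates: a chain that ends before `(x, y)` with a smaller
integer ends before the previous occurrence in `A`, or before the previous occurrence in `B`, or in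
the rectangle between these occurrences and `(x, y)`. -/
theorem query_eq_lenAt {D : Finset ℤ} {t : ℕ → ℕ → ℕ} (h : TableOk A B D t) {a : ℤ}
    (hD : ∀ x, 1 ≤ x → x ≤ n → val A x < a → val A x ∈ D) (hDa : ∀ d ∈ D, d < a) {x y : ℕ}
    (hm : Match A B x y) (ha : val A x = a) {p q g : ℕ} (hp : prevOcc A a x = p)
    (hq : prevOcc B a y = q)
    (hg : max (lenAt A B x q - 1) (lenAt A B p y - 1) ≤ g)
    (hub : ∀ c, max (lenAt A B x q - 1) (lenAt A B p y - 1) ≤ c →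
      (∀ u v, 1 ≤ u → u ≤ x → 1 ≤ v → v ≤ y → t u v ≤ c) → g ≤ c)
    (hcov : ∀ x' y', p < x' → x' ≤ x → q < y' → y' ≤ y →
      ∃ u v, u ≤ x ∧ v ≤ y ∧ InNode u x' ∧ InNode v y' ∧ t u v ≤ g) :
    g + 1 = lenAt A B x y := by
  obtain ⟨hx1, hxn, hy1, hyn, hxy⟩ := id hm
  have h1 := one_le_lenAt hm
  have hpx : p < x := hp ▸ prevOcc_lt A _ hx1
  have hqy : q < y := hq ▸ prevOcc_lt B _ hy1
  have hpm : 1 ≤ p → val A p = a ∧ Match A B p y := fun hp1 => by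
    have h2 : val A p = a := by subst hp; exact val_prevOcc A hp1
    exact ⟨h2, hp1, by omega, hy1, hyn, by rw [h2, ← hxy, ha]⟩
  have hqm : 1 ≤ q → val B q = a ∧ Match A B x q := fun hq1 => by
    have h2 : val B q = a := by subst hq; exact val_prevOcc B hq1
    exact ⟨h2, hx1, hxn, hq1, by omega, by rw [h2, ha]⟩
  apply le_antisymm
  · have h2 : g ≤ lenAt A B x y - 1 := by
      apply hub
      · apply max_le
        · rcases Nat.eq_zero_or_pos q with rfl | hq1
          · rw [lenAt_eq_zero (fun h => by have := h.2.2.1; omega)]; omega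
          · have := lenAt_mono hm (hqm hq1).2 rfl le_rfl hqy.le
            omega
        · rcases Nat.eq_zero_or_pos p with rfl | hp1
          · rw [lenAt_eq_zero (fun h => by have := h.1; omega)]; omega
          · have := lenAt_mono hm (hpm hp1).2 (by rw [(hpm hp1).1, ha]) hpx.le le_rfl
            omega
      · intro u v _ hu _ hv
        rcases h.sound u v with h2 | ⟨x', y', hm', hD', hx', hy', h2⟩
        · omega
        · have hlt := hDa _ hD'
          have hne : x' ≠ x := fun h => by rw [h] at hlt; omega
          have hne' : y' ≠ y := fun h => by rw [hm'.2.2.2.2, h] at hlt; omega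
          have := lenAt_lt hm hm' (by omega) (by omega) (by omega)
          omega
    omega
  · rcases exists_lenAt hm with h2 | ⟨x', y', hm', hx', hy', hv, h2⟩
    · omega
    · suffices lenAt A B x' y' ≤ g by omega
      by_cases hxp : x' ≤ p
      · obtain ⟨h3, h4⟩ := hpm (by have := hm'.1; omega)
        have hne : x' ≠ p := fun h => by rw [h] at hv; omega
        have := lenAt_lt h4 hm' (by omega) hy' (by omega)
        omega
      · by_cases hyq : y' ≤ q
        · obtain ⟨h3, h4⟩ := hqm (by have := hm'.2.2.1; omega)
          have hne : y' ≠ q := fun h => by rw [hm'.2.2.2.2, h] at hv; omega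
          have := lenAt_lt h4 hm' hx' (by omega) (by omega)
          omega
        · obtain ⟨u, v, hu, hv', hux, hvy, h3⟩ := hcov x' y' (by omega) hx'.le (by omega) hy'.le
          exact (h.complete x' y' u v hm' (hD x' hm'.1 hm'.2.1 (by omega)) (by omega) (by omega)
            hux hvy).trans h3

/-- Inserting each value of `lenAt` only into the nodes before the next occurrences suffices,
because `lenAt` is monotone among the pairs that carry the same integer. -/
theorem TableOk.insert {D : Finset ℤ} {t t' : ℕ → ℕ → ℕ} (h : TableOk A B D t) {a : ℤ}
    (hle : ∀ u v, t u v ≤ t' u v)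
    (hor : ∀ u v, t' u v = t u v ∨ ∃ x y, Match A B x y ∧ val A x = a ∧ x ≤ u ∧ y ≤ v ∧
      t' u v = lenAt A B x y)
    (hcov : ∀ x y u v, Match A B x y → val A x = a → u < nextOcc A a (x + 1) →
      v < nextOcc B a (y + 1) → InNode u x → InNode v y → lenAt A B x y ≤ t' u v) :
    TableOk A B (insert a D) t' := by
  constructor
  · intro u v
    rcases hor u v with h1 | ⟨x, y, hm, ha, hx, hy, h1⟩
    · rw [h1]
      rcases h.sound u v with h2 | ⟨x, y, hm, hD, h2⟩
      · exact .inl h2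
      · exact .inr ⟨x, y, hm, Finset.mem_insert_of_mem hD, h2⟩
    · exact .inr ⟨x, y, hm, by simp [ha], hx, hy, h1.le⟩
  · intro x y u v hm hD hu hv hux hvy
    rcases Finset.mem_insert.1 hD with ha | hD
    · -- the last occurrences up to `u` and `v` are in the range of the nodes, too
      obtain ⟨hx1, hxn, hy1, hyn, hxy⟩ := id hm
      have key : ∀ {C : Fin n → ℤ} {z w : ℕ}, 1 ≤ z → w ≤ n → val C z = a → InNode w z →
          ∃ z', z ≤ z' ∧ z' ≤ n ∧ val C z' = a ∧ InNode w z' ∧ w < nextOcc C a (z' + 1) := by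
        intro C z w hz hw hv hn
        have h1 : z ≤ prevOcc C a (w + 1) := by
          by_contra! h2
          exact val_ne_of_prevOcc_lt C h2 (by have := hn.1; omega) hv
        have h2 := prevOcc_lt C a (x := w + 1) (by omega)
        refine ⟨prevOcc C a (w + 1), h1, by omega, val_prevOcc C (by omega),
          ⟨by omega, by have := hn.2; omega⟩, ?_⟩
        by_contra! h3
        have h4 := le_nextOcc C a (prevOcc C a (w + 1) + 1)
        exact val_ne_of_prevOcc_lt C (v := a) (x := w + 1)
          (z := nextOcc C a (prevOcc C a (w + 1) + 1)) (by omega) (by omega)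
          (val_nextOcc C (by omega))
      obtain ⟨x', h1, h2, h3, h4, h5⟩ := key hx1 hu ha hux
      obtain ⟨y', h1', h2', h3', h4', h5'⟩ := key hy1 hv (by rw [← hxy, ha]) hvy
      have hm' : Match A B x' y' := ⟨by omega, h2, by omega, h2', by rw [h3, h3']⟩
      exact (lenAt_mono hm' hm (by rw [h3, ha]) h1 h1').trans (hcov x' y' u v hm' h3 h5 h5' h4 h4')
    · exact (h.complete x y u v hm hD hu hv hux hvy).trans (hle u v)

variable (A B) in
/-- The pairs in the list `o` have been output; register `10` holds the greatest length so far. -/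
structure Output (o : List (ℕ × ℕ)) (s : State) : Prop where
  count : s.reg 1 = o.length
  entries : ∀ (k : ℕ) (h : k < o.length), s.arr 2 k = ((o[k].1 : ℤ) - 1) ∧
    s.arr 3 k = ((o[k].2 : ℤ) - 1) ∧ s.arr 4 k = lenAt A B o[k].1 o[k].2
  best : ∃ b : ℕ, s.reg 10 = b ∧ b ≤ n ∧ (∀ p ∈ o, lenAt A B p.1 p.2 ≤ b) ∧
    (b = 0 ∨ ∃ p ∈ o, lenAt A B p.1 p.2 = b)

theorem Output.congr {o : List (ℕ × ℕ)} {s s' : State} (h : Output A B o s)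
    (h1 : s'.reg 1 = s.reg 1) (h10 : s'.reg 10 = s.reg 10) (h2 : s'.arr 2 = s.arr 2)
    (h3 : s'.arr 3 = s.arr 3) (h4 : s'.arr 4 = s.arr 4) : Output A B o s' :=
  ⟨by rw [h1, h.count], by rw [h2, h3, h4]; exact h.entries, by rw [h10]; exact h.best⟩

theorem Output.push {o : List (ℕ × ℕ)} {s s' : State} (h : Output A B o s) {x y b : ℕ}
    (hb : s.reg 10 = b) (h1 : s'.reg 1 = o.length + 1)
    (h10 : s'.reg 10 = (max b (lenAt A B x y) : ℕ))
    (h2 : ∀ z, s'.arr 2 z = if z = o.length then (x : ℤ) - 1 else s.arr 2 z)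
    (h3 : ∀ z, s'.arr 3 z = if z = o.length then (y : ℤ) - 1 else s.arr 3 z)
    (h4 : ∀ z, s'.arr 4 z = if z = o.length then (lenAt A B x y : ℤ) else s.arr 4 z) :
    Output A B (o ++ [(x, y)]) s' := by
  constructor
  · simp [h1]
  · intro k hk
    rw [h2, h3, h4]
    by_cases hko : k = o.length
    · subst hko; simp
    · have hk' : k < o.length := by simp at hk; omega
      have : (k : ℤ) ≠ o.length := by exact_mod_cast hko
      simp only [if_neg this, List.getElem_append_left hk']
      exact h.entries k hk'
  · obtain ⟨b', hb', hn, hle, hor⟩ := h.best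
    obtain rfl : b = b' := by omega
    refine ⟨_, h10, max_le hn (lenAt_le_len x y), ?_, ?_⟩
    · intro p hp
      rcases List.mem_append.1 hp with hp | hp
      · exact (hle p hp).trans (le_max_left _ _)
      · rw [List.mem_singleton] at hp
        subst hp; exact le_max_right _ _
    · rcases le_total (lenAt A B x y) b with hbl | hbl
      · rw [max_eq_left hbl]
        rcases hor with hor | ⟨p, hp, hp'⟩
        · exact .inl hor
        · exact .inr ⟨p, by simp [hp], hp'⟩
      · rw [max_eq_right hbl]
        exact .inr ⟨(x, y), by simp, rfl⟩

theorem length_le_of_nodup {o : List (ℕ × ℕ)} (h : o.Nodup) (hm : ∀ p ∈ o, Match A B p.1 p.2) :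
    o.length ≤ n * n := by
  rw [← List.toFinset_card_of_nodup h]
  calc o.toFinset.card ≤ (Finset.Icc 1 n ×ˢ Finset.Icc 1 n).card := by
        apply Finset.card_le_card
        intro p hp
        have := hm p (List.mem_toFinset.1 hp)
        simp only [Finset.mem_product, Finset.mem_Icc]
        exact ⟨⟨this.1, this.2.1⟩, this.2.2.1, this.2.2.2.1⟩
    _ = n * n := by simp

/-- Output the matching pair `(x, y)` (registers `4` and `5`) with the length `g + 1`, where `g` is
register `6`, store `g` for the next row, and advance `y`. -/
def emit : Program :=
  .seq (.store 15 (.reg 5) (.reg 6)) <|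
  .seq (.store 2 (.reg 1) (.reg 4 - 1)) <|
  .seq (.store 3 (.reg 1) (.reg 5 - 1)) <|
  .seq (.store 4 (.reg 1) (.reg 6 + 1)) <|
  .seq (.assign 10 ((Expr.reg 10).max (.reg 6 + 1))) <|
  .seq (.assign 1 (.reg 1 + 1)) <|
  .assign 5 (.load 8 (.reg 5))

theorem run_emit {w : ℕ} {K : ℤ} (hw : Fits w n K) {s : State} (hS : Static A B s)
    {o : List (ℕ × ℕ)} (ho : Output A B o s) (hol : o.length ≤ n * n) {x y g : ℕ}
    (hx : 1 ≤ x) (hxn : x ≤ n) (hy : 1 ≤ y) (hyn : y ≤ n) (h4 : s.reg 4 = x) (h5 : s.reg 5 = y)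
    (h6 : s.reg 6 = g) (hg : g + 1 = lenAt A B x y) :
    Run w emit s fun τ s' => τ ≤ 40 ∧ (Output A B (o ++ [(x, y)]) s' ∧
      s'.reg 5 = nextOcc B (val B y) (y + 1) ∧
      ∀ z, s'.arr 15 z = if z = y then (g : ℤ) else s.arr 15 z) ∧ Frame emit s s' := by
  refine Run.and_frame ?_
  obtain ⟨hK, hl, hsq⟩ := id hw
  have hgn : g + 1 ≤ n := hg ▸ lenAt_le_len x y
  have hol' : (o.length : ℤ) ≤ K := by
    have : (o.length : ℤ) ≤ n * n := by exact_mod_cast hol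
    nlinarith
  obtain ⟨b, hb, hbn, -⟩ := ho.best
  have h1 := ho.count
  simp (disch := first | decide | omega) [emit, h1, h4, h5, h6, hb, wrap_of_le hK,
    wrapMax_of_le hK, hS.nextB y hy hyn]
  exact ho.push hb (by simp) (by simp [← hg]) (by simp) (by simp) (by simp [← hg])

variable (A B) in
/-- The list `d` consists of the matching pairs of the integer `a` that precede `(x, y)` in the
lexicographic order, and the list `o` of matching pairs of other integers. -/
structure Collected (a : ℤ) (o d : List (ℕ × ℕ)) (x y : ℕ) : Prop where
  nodup : (o ++ d).Nodup
  left : ∀ p ∈ o, Match A B p.1 p.2 ∧ val A p.1 ≠ a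
  mem : ∀ p : ℕ × ℕ, p ∈ d ↔ Match A B p.1 p.2 ∧ val A p.1 = a ∧ (p.1 < x ∨ p.1 = x ∧ p.2 < y)

theorem Collected.length_le {a : ℤ} {o d : List (ℕ × ℕ)} {x y : ℕ} (h : Collected A B a o d x y) :
    (o ++ d).length ≤ n * n :=
  length_le_of_nodup h.nodup fun p hp => (List.mem_append.1 hp).elim (fun h' => (h.left p h').1)
    fun h' => ((h.mem p).1 h').1

theorem Collected.push {a : ℤ} {o d : List (ℕ × ℕ)} {x y : ℕ} (h : Collected A B a o d x y)
    (hm : Match A B x y) (ha : val A x = a) : Collected A B a o (d ++ [(x, y)]) x (y + 1) := by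
  refine ⟨?_, h.left, fun p => ?_⟩
  · rw [← List.append_assoc, List.nodup_append]
    refine ⟨h.nodup, by simp, ?_⟩
    intro p hp q hq hpq
    rw [List.mem_singleton] at hq
    subst hpq; subst hq
    rcases List.mem_append.1 hp with h1 | h1
    · exact (h.left _ h1).2 ha
    · have := ((h.mem _).1 h1).2.2
      dsimp only at this
      omega
  · rw [List.mem_append, h.mem, List.mem_singleton]
    obtain ⟨x', y'⟩ := p
    simp only [Prod.mk.injEq]
    constructor
    · rintro (⟨h1, h2, h3⟩ | ⟨rfl, rfl⟩)
      · exact ⟨h1, h2, by omega⟩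
      · exact ⟨hm, ha, by omega⟩
    · rintro ⟨h1, h2, h3⟩
      by_cases h4 : x' = x ∧ y' = y
      · exact .inr h4
      · exact .inl ⟨h1, h2, by omega⟩

theorem Collected.congr {a : ℤ} {o d : List (ℕ × ℕ)} {x y x₁ y₁ : ℕ}
    (h : Collected A B a o d x y) (h' : ∀ x' y', Match A B x' y' → val A x' = a →
      ((x' < x ∨ x' = x ∧ y' < y) ↔ (x' < x₁ ∨ x' = x₁ ∧ y' < y₁))) :
    Collected A B a o d x₁ y₁ := by
  refine ⟨h.nodup, h.left, fun p => ?_⟩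
  rw [h.mem]
  constructor
  · rintro ⟨h1, h2, h3⟩; exact ⟨h1, h2, (h' _ _ h1 h2).1 h3⟩
  · rintro ⟨h1, h2, h3⟩; exact ⟨h1, h2, (h' _ _ h1 h2).2 h3⟩

/-- The number of nodes on the walk down from an occurrence to the previous one. -/
def downCost (A : Fin n → ℤ) (x : ℕ) : ℕ := down (prevOcc A (val A x) x) x

theorem one_le_downCost {x : ℕ} (hx : 1 ≤ x) : 1 ≤ downCost A x := by
  rw [downCost, down_of_lt (prevOcc_lt A _ hx)]; omega

/-- For the occurrence `x` in `A` (register `4`) of an integer, go through its occurrences `y` in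
`B`, starting with register `5`, and output the pairs `(x, y)` with their lengths. -/
def collectRow : Program :=
  .loop ((Expr.reg 5).lt (.reg 2)) <|
  .seq (.assign 6 ((Expr.reg 6).max (.load 15 (.reg 5)))) <|
  .seq query emit

/-- The array `15` holds `lenAt - 1` for the previous row before and for the row `x` afterwards;
within the loop, it holds the row `x` to the left of `y`. With truncated subtraction, the value `0`
of `lenAt` at the position `0` stands for the absence of a neighbour. -/
theorem run_collectRow {w : ℕ} {K : ℤ} (hw : Fits w n K) {s : State} (hS : Static A B s)
    {D : Finset ℤ} {t : ℕ → ℕ → ℕ} (hT : Table n t s) (ht : TableOk A B D t) {a : ℤ}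
    (hD : ∀ x, 1 ≤ x → x ≤ n → val A x < a → val A x ∈ D) (hDa : ∀ d ∈ D, d < a)
    {x p : ℕ} (hx : 1 ≤ x) (hxn : x ≤ n) (hxa : val A x = a) (hp : prevOcc A a x = p)
    {o d : List (ℕ × ℕ)} (hd : Collected A B a o d x 1) (hO : Output A B (o ++ d) s)
    (h4 : s.reg 4 = x) (h5 : s.reg 5 = nextOcc B a 1) (h6 : s.reg 6 = 0)
    (hH : ∀ y, 1 ≤ y → y ≤ n → val B y = a → s.arr 15 y = (lenAt A B p y - 1 : ℕ)) :
    Run w collectRow s fun τ s' =>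
      τ ≤ 200 * downCost A x * (∑ y ∈ occFrom B a 1, downCost B y) + 10 ∧
      (∃ d', Collected A B a o d' (x + 1) 1 ∧ Output A B (o ++ d') s' ∧
        (∀ y, 1 ≤ y → y ≤ n → val B y = a → s'.arr 15 y = (lenAt A B x y - 1 : ℕ)) ∧
        ∀ y, 1 ≤ y → y ≤ n → val B y ≠ a → s'.arr 15 y = s.arr 15 y) ∧
      Frame collectRow s s' := by
  obtain ⟨hK, hl, -⟩ := id hw
  have hlen : ∀ {x y}, lenAt A B x y - 1 ≤ n := fun {x y} => by
    have := lenAt_le_len (A := A) (B := B) x y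
    omega
  rw [← occFrom_nextOcc]
  refine run_loop (fun (b : ℕ × List (ℕ × ℕ)) s' => 1 ≤ b.1 ∧ b.1 ≤ n + 1 ∧
      (b.1 ≤ n → val B b.1 = a) ∧ Collected A B a o b.2 x b.1 ∧ Output A B (o ++ b.2) s' ∧
      s'.reg 5 = b.1 ∧ s'.reg 6 = (lenAt A B x (prevOcc B a b.1) - 1 : ℕ) ∧
      (∀ y, 1 ≤ y → y ≤ n → val B y = a →
        s'.arr 15 y = (lenAt A B (if y < b.1 then x else p) y - 1 : ℕ)) ∧
      ∀ y, 1 ≤ y → y ≤ n → val B y ≠ a → s'.arr 15 y = s.arr 15 y)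
    (fun b => 200 * downCost A x * (∑ y ∈ occFrom B a b.1, downCost B y) + 10) ?_
    (nextOcc B a 1, d) ?_
  swap
  · have h1 := le_nextOcc B a 1
    have hp0 : prevOcc B a (nextOcc B a 1) = 0 := by
      have := prevOcc_lt B a (x := 1) le_rfl
      rw [prevOcc_nextOcc B a 0]
      change prevOcc B a 1 = 0
      omega
    refine ⟨h1, nextOcc_le_succ B a (by omega), val_nextOcc B, ?_, hO, h5, ?_, ?_, fun _ _ _ _ => rfl⟩
    · refine hd.congr fun x' y' hm hv => ?_
      have := nextOcc_le B (v := a) (x := 1) (z := y') hm.2.2.1 (.inr (by rw [← hm.2.2.2.2, hv]))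
      have := hm.2.2.1
      dsimp only
      omega
    · rw [h6, hp0, lenAt_eq_zero (fun h => by have := h.2.2.1; omega)]; rfl
    · intro y hy1 hyn hya
      rw [hH y hy1 hyn hya, if_neg]
      have := nextOcc_le B (v := a) (x := 1) (z := y) hy1 (.inr hya)
      dsimp only
      omega
  rintro ⟨y, d1⟩ s1 hF ⟨hy1, hyn, hya, hd1, hO1, h5, h6, hH1, hH2⟩
  dsimp only at *
  have hS1 : Static A B s1 := hS.frame hF (by decide) (by decide)
  have h4' : s1.reg 4 = x := by rw [hF.1 4 (by decide), h4]
  have hT1 : Table n t s1 := hT.congr (hF.2 16 (by decide))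
  have hc : Expr.eval w s1 ((Expr.reg 5).lt (.reg 2)) = if y < n + 1 then 1 else 0 := by
    rw [eval_lt, eval_reg, eval_reg, h5, hS1.reg_succ, wrap_ite (by omega)]
    norm_cast
  rw [hc]
  by_cases hyn' : y ≤ n
  · right
    refine ⟨by simp; omega, ?_⟩
    have hya := hya hyn'
    have hm : Match A B x y := ⟨hx, hxn, hy1, hyn', by rw [hxa, hya]⟩
    have hld : Expr.eval w s1 (.load 15 (.reg 5)) = (lenAt A B p y - 1 : ℕ) := by
      rw [eval_load, eval_reg, h5, hH1 y hy1 hyn' hya, if_neg (lt_irrefl _)]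
    rw [run_seq, run_assign, hw.eval_max (e₁ := .reg 6) h6 hld hlen hlen, run_seq]
    set g0 := max (lenAt A B x (prevOcc B a y) - 1) (lenAt A B p y - 1)
    have hS2 := hS1.setReg (r := 6) g0 (by decide)
    refine Run.mono (run_query hw hS2 (t := t) (g := g0) (p := p) hT1 ht.le hx hxn hy1 hyn'
      (max_le hlen hlen) (by rw [hxa]; exact hp) (by rw [hya]) (by simpa using h4')
      (by simpa using h5) (by simp)) ?_
    rintro τ s2 ⟨hτ, ⟨g, h6, hg, hub, hcov⟩, hF2⟩
    have hgl := query_eq_lenAt ht hD hDa hm hxa hp rfl hg hub hcov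
    have hO2 : Output A B (o ++ d1) s2 := by
      refine hO1.congr ?_ ?_ ?_ ?_ ?_
      · rw [hF2.1 1 (by decide)]; simp
      · rw [hF2.1 10 (by decide)]; simp
      · rw [hF2.2 2 (by decide), setReg_arr]
      · rw [hF2.2 3 (by decide), setReg_arr]
      · rw [hF2.2 4 (by decide), setReg_arr]
    have hS3 : Static A B s2 := hS2.frame hF2 (by decide) (by decide)
    refine Run.mono (run_emit hw hS3 hO2 hd1.length_le hx hxn hy1 hyn'
      (by rw [hF2.1 4 (by decide)]; simpa using h4') (by rw [hF2.1 5 (by decide)]; simpa using h5)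
      h6 hgl) ?_
    rintro τ' s3 ⟨hτ', ⟨hO3, h5', hH3⟩, hF3⟩
    have h15 : s2.arr 15 = s1.arr 15 := by rw [hF2.2 15 (by decide), setReg_arr]
    have hln := le_nextOcc B a (y + 1)
    refine ⟨(nextOcc B a (y + 1), d1 ++ [(x, y)]), ⟨by dsimp only; omega,
      nextOcc_le_succ B _ (by omega), val_nextOcc B, ?_, ?_, ?_, ?_, ?_, ?_⟩, ?_⟩
    · refine (hd1.push hm hxa).congr fun x' y' hm hv => ?_
      have := fun h => nextOcc_le B (v := a) (x := y + 1) (z := y') h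
        (.inr (by rw [← hm.2.2.2.2, hv]))
      dsimp only
      omega
    · rwa [← List.append_assoc]
    · rw [h5', hya]
    · rw [hF3.1 6 (by decide), h6, prevOcc_nextOcc, prevOcc_step_of_eq B hya, ← hgl]; simp
    · intro y' hy1' hyn' hya'
      rw [hH3, h15]
      split_ifs with h1 h2 h2
      · obtain rfl : y' = y := by exact_mod_cast h1
        rw [← hgl]; simp
      · dsimp only at h2; omega
      · have h3 : y' < y := by
          by_contra! h4
          have : y' ≠ y := by exact_mod_cast h1
          exact val_ne_of_lt_nextOcc B (v := a) (x := y + 1) (z := y') (by omega) h2 hya'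
        rw [hH1 y' hy1' hyn' hya', if_pos h3]
      · dsimp only at h2
        rw [hH1 y' hy1' hyn' hya', if_neg (by omega)]
    · intro y' hy1' hyn' hya'
      rw [hH3, h15, if_neg, hH2 y' hy1' hyn' hya']
      intro h
      obtain rfl : y' = y := by exact_mod_cast h
      exact hya' hya
    · rw [sum_occFrom hyn' hya, Nat.mul_add]
      have e1 : down p x = downCost A x := by rw [downCost, hxa, hp]
      have e2 : down (prevOcc B a y) y = downCost B y := by rw [downCost, hya]
      rw [e1, e2] at hτ
      have : 1 ≤ downCost A x * downCost B y := Nat.mul_pos (one_le_downCost hx) (one_le_downCost hy1)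
      have : 200 * downCost A x * downCost B y = 200 * (downCost A x * downCost B y) := by ring
      simp only [cost_op, cost_load, cost_reg, cost_max]
      omega
  · left
    obtain rfl : y = n + 1 := by omega
    refine ⟨by simp, by simp, d1, ?_, hO1, ?_, hH2⟩
    · refine hd1.congr fun x' y' hm hv => ?_
      have := hm.2.2.1
      have := hm.2.2.2.1
      omega
    · intro y' hy1' hyn' hya'
      rw [hH1 y' hy1' hyn' hya', if_pos (by omega)]

/-- Output all matching pairs of one integer, where register `4` is its first occurrence in `A` and
register `12` its first occurrence in `B`. -/
def collect : Program :=
  .loop ((Expr.reg 4).lt (.reg 2)) <|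
  .seq (.assign 6 0) <|
  .seq (.assign 5 (.reg 12)) <|
  .seq collectRow <|
  .assign 4 (.load 6 (.reg 4))

theorem run_collect {w : ℕ} {K : ℤ} (hw : Fits w n K) {s : State} (hS : Static A B s)
    {D : Finset ℤ} {t : ℕ → ℕ → ℕ} (hT : Table n t s) (ht : TableOk A B D t) {a : ℤ}
    (hD : ∀ x, 1 ≤ x → x ≤ n → val A x < a → val A x ∈ D) (hDa : ∀ d ∈ D, d < a)
    {o : List (ℕ × ℕ)} (hnd : o.Nodup) (hle : ∀ p ∈ o, Match A B p.1 p.2 ∧ val A p.1 ≠ a)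
    (hO : Output A B o s) (h4 : s.reg 4 = nextOcc A a 1) (h12 : s.reg 12 = nextOcc B a 1)
    (hH : ∀ y, 1 ≤ y → y ≤ n → val B y = a → s.arr 15 y = 0) :
    Run w collect s fun τ s' =>
      τ ≤ ∑ x ∈ occFrom A a 1, (200 * downCost A x * (∑ y ∈ occFrom B a 1, downCost B y) + 40) + 10 ∧
      (∃ d, Collected A B a o d (n + 1) 1 ∧ Output A B (o ++ d) s' ∧
        ∀ y, 1 ≤ y → y ≤ n → val B y ≠ a → s'.arr 15 y = s.arr 15 y) ∧
      Frame collect s s' := by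
  obtain ⟨hK, hl, -⟩ := id hw
  rw [← occFrom_nextOcc (A := A)]
  refine run_loop (fun (b : ℕ × List (ℕ × ℕ)) s' => 1 ≤ b.1 ∧ b.1 ≤ n + 1 ∧
      (b.1 ≤ n → val A b.1 = a) ∧ Collected A B a o b.2 b.1 1 ∧ Output A B (o ++ b.2) s' ∧
      s'.reg 4 = b.1 ∧
      (∀ y, 1 ≤ y → y ≤ n → val B y = a →
        s'.arr 15 y = (lenAt A B (prevOcc A a b.1) y - 1 : ℕ)) ∧
      ∀ y, 1 ≤ y → y ≤ n → val B y ≠ a → s'.arr 15 y = s.arr 15 y)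
    (fun b => ∑ x ∈ occFrom A a b.1,
      (200 * downCost A x * (∑ y ∈ occFrom B a 1, downCost B y) + 40) + 10) ?_
    (nextOcc A a 1, []) ?_
  swap
  · have h1 := le_nextOcc A a 1
    have hp0 : prevOcc A a (nextOcc A a 1) = 0 := by
      have := prevOcc_lt A a (x := 1) le_rfl
      rw [prevOcc_nextOcc A a 0]
      change prevOcc A a 1 = 0
      omega
    refine ⟨h1, nextOcc_le_succ A a (by omega), val_nextOcc A, ⟨by simpa using hnd, hle, ?_⟩,
      by simpa using hO, h4, ?_, fun _ _ _ _ => rfl⟩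
    · rintro ⟨x', y'⟩
      simp only [List.not_mem_nil, false_iff]
      rintro ⟨hm, hv, h2⟩
      have := nextOcc_le A (v := a) (x := 1) (z := x') hm.1 (.inr hv)
      have := hm.2.2.1
      omega
    · intro y hy1 hyn hya
      rw [hH y hy1 hyn hya, hp0, lenAt_eq_zero (fun h => by have := h.1; omega)]; rfl
  rintro ⟨x, d⟩ s1 hF ⟨hx1, hxn, hxa, hd1, hO1, h4, hH1, hH2⟩
  dsimp only at *
  have hS1 : Static A B s1 := hS.frame hF (by decide) (by decide)
  have h12' : s1.reg 12 = nextOcc B a 1 := by rw [hF.1 12 (by decide), h12]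
  have hT1 : Table n t s1 := hT.congr (hF.2 16 (by decide))
  have hc : Expr.eval w s1 ((Expr.reg 4).lt (.reg 2)) = if x < n + 1 then 1 else 0 := by
    rw [eval_lt, eval_reg, eval_reg, h4, hS1.reg_succ, wrap_ite (by omega)]
    norm_cast
  rw [hc]
  by_cases hxn' : x ≤ n
  · right
    refine ⟨by simp; omega, ?_⟩
    have hxa := hxa hxn'
    rw [run_seq, run_assign, run_seq, run_assign, run_seq]
    have hS2 := (hS1.setReg (r := 6) (Expr.eval w s1 0) (by decide)).setReg (r := 5)
      (Expr.eval w (s1.setReg 6 (Expr.eval w s1 0)) (.reg 12)) (by decide)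
    refine Run.mono (run_collectRow hw hS2 (t := t) hT1 ht hD hDa hx1 hxn' hxa rfl hd1
      (hO1.congr (by simp) (by simp) rfl rfl rfl) (by simp [h4]) (by simp [h12'])
      (by simp (disch := omega) [wrap_of_le hK]) (fun y h1 h2 h3 => hH1 y h1 h2 h3)) ?_
    rintro τ s2 ⟨hτ, ⟨d', hd2, hO2, hH3, hH4⟩, hF2⟩
    have hS3 : Static A B s2 := hS2.frame hF2 (by decide) (by decide)
    have h4' : s2.reg 4 = x := by rw [hF2.1 4 (by decide)]; simpa using h4
    have hln := le_nextOcc A a (x + 1)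
    rw [run_assign]
    refine ⟨(nextOcc A a (x + 1), d'), ⟨by dsimp only; omega,
      nextOcc_le_succ A _ (by omega), val_nextOcc A, ?_, ?_, ?_, ?_, ?_⟩, ?_⟩
    · refine hd2.congr fun x' y' hm hv => ?_
      have := fun h => nextOcc_le A (v := a) (x := x + 1) (z := x') h (.inr hv)
      have := hm.2.2.1
      dsimp only
      omega
    · exact hO2.congr (by simp) (by simp) rfl rfl rfl
    · simp [h4', hS3.nextA x hx1 hxn', hxa]
    · intro y hy1 hyn hya
      rw [prevOcc_nextOcc, prevOcc_step_of_eq A hxa]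
      exact hH3 y hy1 hyn hya
    · intro y hy1 hyn hya
      exact (hH4 y hy1 hyn hya).trans (hH2 y hy1 hyn hya)
    · rw [sum_occFrom hxn' hxa]
      simp only [cost_op, cost_load, cost_reg, cost_ofNat]
      omega
  · left
    obtain rfl : x = n + 1 := by omega
    exact ⟨by simp, by simp, d, hd1, hO1, hH2⟩

/-- The number of nodes on the walk up from an occurrence to the next one. -/
noncomputable def upCost (A : Fin n → ℤ) (x : ℕ) : ℕ := up (nextOcc A (val A x) (x + 1)) x

theorem one_le_upCost {x : ℕ} (hx : 1 ≤ x) : 1 ≤ upCost A x := by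
  rw [upCost, up_of_lt hx (le_nextOcc A _ _)]; omega

theorem Collected.sum_map {a : ℤ} {o d : List (ℕ × ℕ)} (h : Collected A B a o d (n + 1) 1)
    (f g : ℕ → ℕ) : (d.map fun p => f p.1 * g p.2).sum =
      (∑ x ∈ occFrom A a 1, f x) * ∑ y ∈ occFrom B a 1, g y := by
  have hd : d.Nodup := (List.nodup_append.1 h.nodup).2.1
  rw [← List.sum_toFinset _ hd, Finset.sum_mul_sum, ← Finset.sum_product']
  refine Finset.sum_congr ?_ fun _ _ => rfl
  ext ⟨x, y⟩
  rw [List.mem_toFinset, h.mem, Finset.mem_product, mem_occFrom, mem_occFrom]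
  constructor
  · rintro ⟨⟨h1, h2, h3, h4, h5⟩, h6, -⟩
    exact ⟨⟨h1, h2, h6⟩, h3, h4, by rw [← h5, h6]⟩
  · rintro ⟨⟨h1, h2, h6⟩, h3, h4, h5⟩
    dsimp only at *
    exact ⟨⟨h1, h2, h3, h4, by rw [h6, h5]⟩, h6, by omega⟩

/-- Insert the pairs that were output last into the Fenwick tree, from register `9` on. -/
def flush : Program :=
  .loop ((Expr.reg 9).lt (.reg 1)) <|
  .seq (.assign 4 (.load 2 (.reg 9) + 1)) <|
  .seq (.assign 5 (.load 3 (.reg 9) + 1)) <|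
  .seq (.assign 6 (.load 4 (.reg 9))) <|
  .seq update <|
  .assign 9 (.reg 9 + 1)

theorem run_flush {w : ℕ} {K : ℤ} (hw : Fits w n K) {s : State} (hS : Static A B s)
    {D : Finset ℤ} {t : ℕ → ℕ → ℕ} (hT : Table n t s) (ht : TableOk A B D t) {a : ℤ}
    {o d : List (ℕ × ℕ)} (hd : Collected A B a o d (n + 1) 1) (hO : Output A B (o ++ d) s)
    (h9 : s.reg 9 = o.length) :
    Run w flush s fun τ s' =>
      τ ≤ 150 * ((∑ x ∈ occFrom A a 1, upCost A x) * ∑ y ∈ occFrom B a 1, upCost B y) + 10 ∧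
      (∃ t', Table n t' s' ∧ TableOk A B (insert a D) t') ∧ Frame flush s s' := by
  obtain ⟨hK, hl, hsq⟩ := id hw
  rw [← hd.sum_map]
  refine run_loop (fun (b : List (ℕ × ℕ) × List (ℕ × ℕ) × (ℕ → ℕ → ℕ)) s' => d = b.1 ++ b.2.1 ∧
      s'.reg 9 = (o ++ b.1).length ∧ Table n b.2.2 s' ∧ (∀ u v, t u v ≤ b.2.2 u v) ∧
      (∀ u v, b.2.2 u v = t u v ∨ ∃ x y, Match A B x y ∧ val A x = a ∧ x ≤ u ∧ y ≤ v ∧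
        b.2.2 u v = lenAt A B x y) ∧
      ∀ x y u v, (x, y) ∈ b.1 → u < nextOcc A a (x + 1) → v < nextOcc B a (y + 1) →
        InNode u x → InNode v y → lenAt A B x y ≤ b.2.2 u v)
    (fun b => 150 * (b.2.1.map fun p => upCost A p.1 * upCost B p.2).sum + 10) ?_ ([], d, t) ?_
  swap
  · exact ⟨rfl, by simpa using h9, hT, fun _ _ => le_rfl, fun _ _ => .inl rfl, by simp⟩
  rintro ⟨d1, d2, t1⟩ s1 hF ⟨hd12, h9, hT1, hle, hor, hcov⟩
  dsimp only at *
  have hS1 : Static A B s1 := hS.frame hF (by decide) (by decide)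
  have hO1 : Output A B (o ++ d) s1 := hO.congr (hF.1 1 (by decide)) (hF.1 10 (by decide))
    (hF.2 2 (by decide)) (hF.2 3 (by decide)) (hF.2 4 (by decide))
  have hc : Expr.eval w s1 ((Expr.reg 9).lt (.reg 1)) =
      if (o ++ d1).length < (o ++ d).length then 1 else 0 := by
    rw [eval_lt, eval_reg, eval_reg, h9, hO1.count, wrap_ite (by omega)]
    norm_cast
  rw [hc]
  rcases d2 with _ | ⟨⟨x, y⟩, d2⟩
  · left
    rw [List.append_nil] at hd12
    subst hd12
    refine ⟨by simp, by simp, t1, hT1, ht.insert hle hor fun x y u v hm ha => ?_⟩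
    exact hcov x y u v ((hd.mem (x, y)).2 ⟨hm, ha, by have := hm.2.1; dsimp only; omega⟩)
  · right
    have hlt : (o ++ d1).length < (o ++ d).length := by rw [hd12]; simp
    refine ⟨by simp only [hlt]; simp, ?_⟩
    obtain ⟨hm, ha, -⟩ := (hd.mem (x, y)).1 (by rw [hd12]; simp)
    obtain ⟨hx1, hxn, hy1, hyn, hxy⟩ := id hm
    dsimp only at *
    have ht1 : ∀ u v, t1 u v ≤ n := by
      intro u v
      rcases hor u v with h | ⟨x, y, -, -, -, -, h⟩
      · rw [h]; exact ht.le u v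
      · rw [h]; exact lenAt_le_len x y
    have hxy' : (o ++ d)[(o ++ d1).length] = (x, y) := by
      subst hd12
      simp
    obtain ⟨e2, e3, e4⟩ := hO1.entries _ hlt
    rw [hxy'] at e2 e3 e4
    have hlen : (((o ++ d1).length : ℕ) : ℤ) ≤ K := by
      have := hd.length_le
      have : (((o ++ d1).length : ℕ) : ℤ) ≤ n * n := by exact_mod_cast hlt.le.trans this
      nlinarith
    generalize hk : (o ++ d1).length = k at *
    dsimp only at e2 e3 e4
    rw [run_seq, run_assign, run_seq, run_assign, run_seq, run_assign, run_seq]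
    have e2' : wrap w ((x : ℤ) - 1 + wrap w 1) = x := by
      simp (disch := omega) [wrap_of_le hK]
    have e3' : wrap w ((y : ℤ) - 1 + wrap w 1) = y := by
      simp (disch := omega) [wrap_of_le hK]
    simp only [eval_add, eval_load, eval_reg, eval_ofNat, setReg_reg, setReg_arr, h9, e2, e3, e4,
      Nat.reduceEqDiff, if_false, Nat.cast_one, e2', e3']
    have hS2 := ((hS1.setReg (r := 4) x (by decide)).setReg (r := 5) y (by decide)).setReg (r := 6)
      (lenAt A B x y) (by decide)
    refine Run.mono (run_update hw hS2 (t := t1) (g := lenAt A B x y) hT1 ht1 hx1 hxn hy1 hyn (lenAt_le_len x y) rfl rfl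
      (by simp) (by simp) (by simp)) ?_
    rintro τ s2 ⟨hτ, ⟨t2, hT2, hle2, hor2, hcov2⟩, hF2⟩
    have h9' : s2.reg 9 = k := by rw [hF2.1 9 (by decide)]; simpa using h9
    rw [run_assign]
    refine ⟨(d1 ++ [(x, y)], d2, t2), ⟨by simp [hd12], ?_, hT2, fun u v => (hle u v).trans (hle2 u v),
      ?_, ?_⟩, ?_⟩
    · have : (o ++ (d1 ++ [(x, y)])).length = k + 1 := by
        rw [← hk, ← List.append_assoc, List.length_append, List.length_singleton]
      rw [setReg_reg, if_pos rfl, this]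
      simp (disch := omega) [h9', wrap_of_le hK]
    · intro u v
      rcases hor2 u v with h | ⟨h, hu, hv⟩
      · dsimp only; rw [h]; exact hor u v
      · exact .inr ⟨x, y, hm, ha, hu, hv, h⟩
    · intro x' y' u v hp h1 h2 h3 h4
      rcases List.mem_append.1 hp with hp | hp
      · exact (hcov x' y' u v hp h1 h2 h3 h4).trans (hle2 u v)
      · simp only [List.mem_singleton, Prod.mk.injEq] at hp
        obtain ⟨rfl, rfl⟩ := hp
        exact hcov2 u v (by rwa [ha]) (by rwa [← hxy, ha]) h3 h4
    · have : 1 ≤ upCost A x * upCost B y := Nat.mul_pos (one_le_upCost hx1) (one_le_upCost hy1)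
      change _ ≤ 80 * (upCost A x * upCost B y) + 20 at hτ
      simp only [List.map_cons, List.sum_cons, cost_op, cost_load, cost_reg, cost_add, cost_ofNat]
      omega

/-- Process all matching pairs of the integer at the position of `A` in register `11`, which is its
first occurrence: output the pairs, then insert them into the Fenwick tree. -/
def processInt : Program :=
  .seq (.assign 4 (.reg 11)) <|
  .seq (.assign 12 (.reg 2 + .load 7 (.load 0 (.reg 11 - 1)))) <|
  .seq (.assign 9 (.reg 1)) <|
  .seq collect flush

variable (A B) in
/-- A bound on the running time of `processInt` for the integer `a`. -/
noncomputable def intCost (a : ℤ) : ℕ :=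
  ∑ x ∈ occFrom A a 1, (200 * downCost A x * (∑ y ∈ occFrom B a 1, downCost B y) + 40) +
  150 * ((∑ x ∈ occFrom A a 1, upCost A x) * ∑ y ∈ occFrom B a 1, upCost B y) + 50

theorem run_processInt {w : ℕ} {K : ℤ} (hw : Fits w n K) {s : State} (hS : Static A B s)
    {D : Finset ℤ} {t : ℕ → ℕ → ℕ} (hT : Table n t s) (ht : TableOk A B D t) {a : ℤ}
    (hD : ∀ x, 1 ≤ x → x ≤ n → val A x < a → val A x ∈ D) (hDa : ∀ d ∈ D, d < a)
    {o : List (ℕ × ℕ)} (hnd : o.Nodup) (hle : ∀ p ∈ o, Match A B p.1 p.2 ∧ val A p.1 ≠ a)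
    (hO : Output A B o s) {x₀ : ℕ} (hx0 : 1 ≤ x₀) (hx0n : x₀ ≤ n) (hxa : val A x₀ = a)
    (hfirst : nextOcc A a 1 = x₀) (h11 : s.reg 11 = x₀)
    (hH : ∀ y, 1 ≤ y → y ≤ n → val B y = a → s.arr 15 y = 0) :
    Run w processInt s fun τ s' => τ ≤ intCost A B a ∧
      (∃ d t', Collected A B a o d (n + 1) 1 ∧ Output A B (o ++ d) s' ∧ Table n t' s' ∧
        TableOk A B (insert a D) t' ∧
        ∀ y, 1 ≤ y → y ≤ n → val B y ≠ a → s'.arr 15 y = s.arr 15 y) ∧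
      Frame processInt s s' := by
  obtain ⟨hK, hl, hsq⟩ := id hw
  refine Run.and_frame ?_
  have hOl : (o.length : ℤ) ≤ K := by
    have := length_le_of_nodup hnd fun p hp => (hle p hp).1
    have : (o.length : ℤ) ≤ n * n := by exact_mod_cast this
    nlinarith
  have hh1 := le_nextOcc B a 1
  have hh2 := nextOcc_le_succ B a (x := 1) (by omega)
  have e12 : Expr.eval w (s.setReg 4 x₀) (.reg 2 + .load 7 (.load 0 (.reg 11 - 1))) =
      nextOcc B a 1 := by
    simp (disch := omega) [hS.reg_succ, h11, wrap_of_le hK, hS.seqA, hxa, hS.headB]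
  rw [processInt, run_seq, run_assign, eval_reg, h11, run_seq, run_assign, e12, run_seq, run_assign,
    run_seq]
  have hS1 := ((hS.setReg (r := 4) x₀ (by decide)).setReg (r := 12) (nextOcc B a 1)
    (by decide)).setReg (r := 9) o.length (by decide)
  have e9 : Expr.eval w ((s.setReg 4 x₀).setReg 12 (nextOcc B a 1)) (.reg 1) = o.length := by
    simp [hO.count]
  rw [e9]
  refine Run.mono (run_collect hw hS1 (t := t) hT ht hD hDa hnd hle
    (hO.congr (by simp) (by simp) rfl rfl rfl) (by simp [hfirst]) (by simp) hH) ?_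
  rintro τ s1 ⟨hτ, ⟨d, hd, hO1, hH1⟩, hF1⟩
  refine Run.mono (run_flush hw (hS1.frame hF1 (by decide) (by decide)) (t := t)
    (hT.congr (by rw [hF1.2 16 (by decide)]; rfl)) ht hd hO1
    (by rw [hF1.1 9 (by decide)]; simp)) ?_
  rintro τ' s2 ⟨hτ', ⟨t', hT2, ht2⟩, hF2⟩
  refine ⟨?_, d, t', hd, ?_, hT2, ht2, ?_⟩
  · simp only [intCost, cost_reg, cost_add, cost_load, cost_sub, cost_ofNat]
    omega
  · exact hO1.congr (hF2.1 1 (by decide)) (hF2.1 10 (by decide)) (hF2.2 2 (by decide))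
      (hF2.2 3 (by decide)) (hF2.2 4 (by decide))
  · intro y h1 h2 h3
    rw [hF2.2 15 (by decide)]
    exact hH1 y h1 h2 h3

/-! ### Enumerating the integers in increasing order with a tournament tree -/

/-- The position `z` wins against the position `c`; the value `0` stands for no position. -/
def Beats (A : Fin n → ℤ) (z c : ℕ) : Prop := c ≠ 0 → z ≠ 0 ∧ val A z ≤ val A c

theorem Beats.refl (z : ℕ) : Beats A z z := fun h => ⟨h, le_rfl⟩

theorem Beats.trans {z c d : ℕ} (h : Beats A z c) (h' : Beats A c d) : Beats A z d := fun hd =>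
  ⟨(h (h' hd).1).1, (h (h' hd).1).2.trans (h' hd).2⟩

/-- The node `k` of the tournament tree holds the winner of its children `2 * k` and
`2 * k + 1`. -/
def NodeOk (A : Fin n → ℤ) (f : ℕ → ℕ) (k : ℕ) : Prop :=
  (f k = f (2 * k) ∨ f k = f (2 * k + 1)) ∧ Beats A (f k) (f (2 * k)) ∧
    Beats A (f k) (f (2 * k + 1))

theorem beats_of_nodeOk {f : ℕ → ℕ} (h : ∀ k, 1 ≤ k → k < n → NodeOk A f k) {k : ℕ} (h1 : 1 ≤ k)
    (hk : k < 2 * n) : Beats A (f 1) (f k) := by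
  induction k using Nat.strong_induction_on with
  | _ k ih =>
    rcases h1.eq_or_lt with rfl | h1
    · exact Beats.refl _
    · have h2 := ih (k / 2) (by omega) (by omega) (by omega)
      obtain ⟨-, h3, h4⟩ := h (k / 2) (by omega) (by omega)
      rcases Nat.mod_two_eq_zero_or_one k with h5 | h5
      · rw [show 2 * (k / 2) = k by omega] at h3
        exact h2.trans h3
      · rw [show 2 * (k / 2) + 1 = k by omega] at h4
        exact h2.trans h4

theorem exists_leaf_of_nodeOk {f : ℕ → ℕ} (h : ∀ k, 1 ≤ k → k < n → NodeOk A f k) {k : ℕ}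
    (h1 : 1 ≤ k) (hk : k < 2 * n) : ∃ j, n ≤ j ∧ j < 2 * n ∧ f k = f j := by
  induction hm : 2 * n - k using Nat.strong_induction_on generalizing k with
  | _ m ih =>
    subst hm
    by_cases hn : n ≤ k
    · exact ⟨k, hn, hk, rfl⟩
    · rcases (h k h1 (by omega)).1 with h2 | h2
      · obtain ⟨j, h3⟩ := ih (2 * n - 2 * k) (by omega) (k := 2 * k) (by omega) (by omega) rfl
        exact ⟨j, by rw [h2]; exact h3⟩
      · obtain ⟨j, h3⟩ := ih (2 * n - (2 * k + 1)) (by omega) (k := 2 * k + 1) (by omega)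
          (by omega) rfl
        exact ⟨j, by rw [h2]; exact h3⟩

/-- Restore the tournament tree above the node in register `13`. -/
def climb : Program :=
  .loop ((1 : Expr).lt (.reg 13)) <|
  .seq (.assign 13 (.reg 13 / 2)) <|
  .seq (.store 14 (.reg 13) (.load 14 (2 * .reg 13))) <|
  .ite ((0 : Expr).lt (.load 14 (2 * .reg 13 + 1)) *
      ((Expr.eq (.load 14 (.reg 13)) 0) +
        (Expr.load 0 (.load 14 (2 * .reg 13 + 1) - 1)).lt (.load 0 (.load 14 (.reg 13) - 1))))
    (.store 14 (.reg 13) (.load 14 (2 * .reg 13 + 1))) .skip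

/-- Only the parent `j / 2` of the node `j` may violate the rule of the tournament tree. -/
theorem run_climb {w : ℕ} {K : ℤ} (hw : Fits w n K) {s : State}
    (hA : ∀ x : ℕ, s.arr 0 ((x : ℤ) - 1) = val A x) {f : ℕ → ℕ} (hfn : ∀ k, f k ≤ n)
    (hf : ∀ k : ℕ, 1 ≤ k → k < 2 * n → s.arr 14 k = f k) {j : ℕ} (hj : 1 ≤ j) (hjn : j < 2 * n)
    (h13 : s.reg 13 = j) (hok : ∀ k, 1 ≤ k → k < n → k ≠ j / 2 → NodeOk A f k) :
    Run w climb s fun τ s' => τ ≤ 60 * Nat.log 2 j + 10 ∧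
      (∃ f' : ℕ → ℕ, (∀ k : ℕ, 1 ≤ k → k < 2 * n → s'.arr 14 k = f' k) ∧ (∀ k, f' k ≤ n) ∧
        (∀ k, n ≤ k → f' k = f k) ∧ ∀ k, 1 ≤ k → k < n → NodeOk A f' k) ∧ Frame climb s s' := by
  obtain ⟨hK, hl, hsq⟩ := id hw
  refine run_loop (fun (b : ℕ × (ℕ → ℕ)) s' => 1 ≤ b.1 ∧ b.1 < 2 * n ∧ s'.reg 13 = b.1 ∧
      (∀ k : ℕ, 1 ≤ k → k < 2 * n → s'.arr 14 k = b.2 k) ∧ (∀ k, b.2 k ≤ n) ∧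
      (∀ k, n ≤ k → b.2 k = f k) ∧ ∀ k, 1 ≤ k → k < n → k ≠ b.1 / 2 → NodeOk A b.2 k)
    (fun b => 60 * Nat.log 2 b.1 + 10) ?_ (j, f) ?_
  swap
  · exact ⟨hj, hjn, h13, hf, hfn, fun _ _ => rfl, hok⟩
  rintro ⟨j, f1⟩ s1 hF ⟨hj, hjn, h13, hf1, hfn1, hfe, hok⟩
  dsimp only at *
  have hA1 : ∀ x : ℕ, s1.arr 0 ((x : ℤ) - 1) = val A x := by rw [hF.2 0 (by decide)]; exact hA
  have hc : Expr.eval w s1 ((1 : Expr).lt (.reg 13)) = if 1 < j then 1 else 0 := by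
    rw [eval_lt, eval_reg, eval_ofNat, h13, wrap_ite (by omega), Nat.cast_one,
      wrap_of_le hK (by omega) (by omega)]
    norm_cast
  rw [hc]
  by_cases h1j : 1 < j
  · right
    refine ⟨by simp [h1j], ?_⟩
    obtain ⟨i, hi⟩ : ∃ i, i = j / 2 := ⟨_, rfl⟩
    have hlog : Nat.log 2 j = Nat.log 2 i + 1 := by
      rw [hi, Nat.log_of_one_lt_of_le (by omega) (by omega)]
    rw [← hi] at hok
    have e13 : Expr.eval w s1 (.reg 13 / 2) = i := by
      simp (disch := omega) [h13, wrap_of_le hK, hi]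
    have hl := hfn1 (2 * i)
    have hr := hfn1 (2 * i + 1)
    have el : Expr.eval w (s1.setReg 13 i) (.load 14 (2 * .reg 13)) = f1 (2 * i) := by
      have := hf1 (2 * i) (by omega) (by omega)
      push_cast at this
      simp (disch := omega) [wrap_of_le hK, this]
    rw [run_seq, run_assign, e13, run_seq, run_store, el, eval_reg, setReg_reg, if_pos rfl]
    obtain ⟨s2, hs2⟩ : ∃ s2, s2 = (s1.setReg 13 i).setArr 14 i (f1 (2 * i)) := ⟨_, rfl⟩
    rw [← hs2]
    have h13' : s2.reg 13 = i := by simp [hs2]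
    have h14' : ∀ k : ℕ, 1 ≤ k → k < 2 * n →
        s2.arr 14 k = (if k = i then f1 (2 * i) else f1 k : ℕ) := by
      intro k hk hk'
      simp [hs2, hf1 k hk hk']
    have hA2 : ∀ x : ℕ, s2.arr 0 ((x : ℤ) - 1) = val A x := by
      intro x; simp [hs2, hA1]
    have er : Expr.eval w s2 (.load 14 (2 * .reg 13 + 1)) = f1 (2 * i + 1) := by
      have := h14' (2 * i + 1) (by omega) (by omega)
      rw [if_neg (by omega)] at this
      push_cast at this
      simp (disch := omega) [wrap_of_le hK, this, h13']
    have el' : Expr.eval w s2 (.load 14 (.reg 13)) = f1 (2 * i) := by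
      have := h14' i (by omega) (by omega)
      rw [if_pos rfl] at this
      simp [this, h13']
    obtain ⟨f2, hf2⟩ : ∃ f2 : ℕ → ℕ → ℕ, ∀ v k, f2 v k = if k = i then v else f1 k :=
      ⟨fun v k => if k = i then v else f1 k, fun _ _ => rfl⟩
    -- the new winner `v` repairs the node `i` and may only break its parent
    have key : ∀ (s3 : State) (v τ : ℕ), s3.reg 13 = i →
        (∀ k : ℕ, 1 ≤ k → k < 2 * n → s3.arr 14 k = (if k = i then v else f1 k : ℕ)) →
        (v = f1 (2 * i) ∨ v = f1 (2 * i + 1)) → Beats A v (f1 (2 * i)) →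
        Beats A v (f1 (2 * i + 1)) → τ ≤ 54 →
        ∃ g' : ℕ × (ℕ → ℕ), (1 ≤ g'.1 ∧ g'.1 < 2 * n ∧ s3.reg 13 = g'.1 ∧
          (∀ k : ℕ, 1 ≤ k → k < 2 * n → s3.arr 14 k = g'.2 k) ∧ (∀ k, g'.2 k ≤ n) ∧
          (∀ k, n ≤ k → g'.2 k = f k) ∧ ∀ k, 1 ≤ k → k < n → k ≠ g'.1 / 2 → NodeOk A g'.2 k) ∧
          τ + 60 * Nat.log 2 g'.1 ≤ 60 * Nat.log 2 j := by
      intro s3 v τ h13 h14 hv hb1 hb2 hτ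
      refine ⟨(i, fun k => if k = i then v else f1 k), ⟨by dsimp only; omega, by dsimp only; omega,
        h13, h14, ?_, ?_, ?_⟩, by dsimp only; omega⟩
      · intro k
        dsimp only
        split_ifs
        · rcases hv with rfl | rfl <;> assumption
        · exact hfn1 k
      · intro k hk
        dsimp only
        rw [if_neg (by omega)]
        exact hfe k hk
      · intro k hk hkn hki
        dsimp only at *
        by_cases hk' : k = i
        · subst hk'
          simp only [NodeOk, if_pos, if_neg (show 2 * k ≠ k by omega),
            if_neg (show 2 * k + 1 ≠ k by omega)]
          exact ⟨hv, hb1, hb2⟩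
        · have := hok k hk hkn hk'
          simp only [NodeOk, if_neg hk', if_neg (show 2 * k ≠ i by omega),
            if_neg (show 2 * k + 1 ≠ i by omega)]
          exact this
    have hcond : Expr.eval w s2 ((0 : Expr).lt (.load 14 (2 * .reg 13 + 1)) *
      ((Expr.eq (.load 14 (.reg 13)) 0) + (Expr.load 0 (.load 14 (2 * .reg 13 + 1) - 1)).lt
        (.load 0 (.load 14 (.reg 13) - 1)))) =
        (if 0 < f1 (2 * i + 1) then 1 else 0) * ((if f1 (2 * i) = 0 then 1 else 0) +
          if val A (f1 (2 * i + 1)) < val A (f1 (2 * i)) then 1 else 0) := by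
      rw [eval_mul, eval_add, eval_lt, eval_eq, eval_lt, eval_load 0, eval_load 0, eval_sub, eval_sub,
        er, el', eval_ofNat, eval_ofNat]
      rw [wrap_of_le hK (z := ((0 : ℕ) : ℤ)) (by omega) (by omega),
        wrap_of_le hK (z := ((1 : ℕ) : ℤ)) (by omega) (by omega),
        wrap_of_le hK (z := ((f1 (2 * i + 1) : ℕ) : ℤ) - _) (by omega) (by omega),
        wrap_of_le hK (z := ((f1 (2 * i) : ℕ) : ℤ) - _) (by omega) (by omega)]
      rw [Nat.cast_one, hA2, hA2]
      simp only [Nat.cast_pos, Nat.cast_eq_zero, Nat.cast_zero]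
      split_ifs <;> simp (disch := omega) [wrap_of_le hK]
    by_cases hwin : 0 < f1 (2 * i + 1) ∧
        (f1 (2 * i) = 0 ∨ val A (f1 (2 * i + 1)) < val A (f1 (2 * i)))
    · refine run_ite_of_ne ?_ ?_
      · rw [hcond, if_pos hwin.1]
        rcases hwin.2 with h | h
        · rw [if_pos h]; split_ifs <;> simp
        · rw [if_pos h]; split_ifs <;> simp
      · rw [run_store, er, eval_reg, h13']
        obtain ⟨g', h1, h2⟩ := key (s2.setArr 14 i (f1 (2 * i + 1))) (f1 (2 * i + 1)) 54
          h13' (by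
            intro k hk hk'
            simp [h14' k hk hk']
            split_ifs <;> rfl) (.inr rfl)
          (fun h => ⟨by omega, by rcases hwin.2 with h' | h'; exacts [absurd h' h, h'.le]⟩)
          (Beats.refl _) le_rfl
        refine ⟨g', h1, ?_⟩
        simp only [cost_op, cost_load, cost_reg, cost_add, cost_mul, cost_sub, cost_div, cost_ofNat]
        omega
    · refine run_ite_of_eq ?_ ?_
      · rw [hcond]
        by_cases h1 : 0 < f1 (2 * i + 1)
        · rw [if_pos h1, if_neg fun h => hwin ⟨h1, .inl h⟩, if_neg fun h => hwin ⟨h1, .inr h⟩]; rfl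
        · rw [if_neg h1, zero_mul]
      · rw [run_skip]
        obtain ⟨g', h1, h2⟩ := key s2 (f1 (2 * i)) 54 h13' h14' (.inl rfl) (Beats.refl _)
          (fun h => by
            rw [not_and_or, not_or] at hwin
            rcases hwin with h' | h'
            · omega
            · exact ⟨h'.1, not_lt.1 h'.2⟩) le_rfl
        refine ⟨g', h1, ?_⟩
        simp only [cost_op, cost_load, cost_reg, cost_add, cost_mul, cost_sub, cost_div, cost_ofNat]
        omega
  · left
    refine ⟨by simp [h1j], by simp, f1, hf1, hfn1, hfe, fun k h1 h2 => hok k h1 h2 (by omega)⟩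

/-- The array `14` holds a tournament tree whose leaves are `n, …, 2 * n - 1`: the leaf of the
position `x` holds `x` if `x` belongs to `L`, and `0` otherwise. -/
def Tournament (A : Fin n → ℤ) (L : Finset ℕ) (s : State) : Prop :=
  ∃ f : ℕ → ℕ, (∀ k : ℕ, 1 ≤ k → k < 2 * n → s.arr 14 k = f k) ∧ (∀ k, f k ≤ n) ∧
    (∀ x, 1 ≤ x → x ≤ n → f (n + x - 1) = if x ∈ L then x else 0) ∧
    ∀ k, 1 ≤ k → k < n → NodeOk A f k

theorem Tournament.congr {L : Finset ℕ} {s s' : State} (h : Tournament A L s)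
    (h' : s'.arr 14 = s.arr 14) : Tournament A L s' := by
  unfold Tournament; rw [h']; exact h

/-- The root is a position of a smallest integer. -/
theorem Tournament.root {L : Finset ℕ} {s : State} (h : Tournament A L s) (hn : 1 ≤ n) :
    ∃ x : ℕ, s.arr 14 1 = x ∧ x ≤ n ∧ (x = 0 → ∀ z ∈ L, 1 ≤ z → ¬ z ≤ n) ∧
      (x ≠ 0 → x ∈ L ∧ ∀ z ∈ L, 1 ≤ z → z ≤ n → val A x ≤ val A z) := by
  obtain ⟨f, h14, hfn, hleaf, hok⟩ := h
  have hb : ∀ z ∈ L, 1 ≤ z → z ≤ n → Beats A (f 1) z := by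
    intro z hz h1 h2
    have := beats_of_nodeOk hok (k := n + z - 1) (by omega) (by omega)
    rwa [hleaf z h1 h2, if_pos hz] at this
  refine ⟨f 1, by exact_mod_cast h14 1 le_rfl (by omega), hfn 1, ?_, ?_⟩
  · intro h0 z hz h1 h2
    exact ((hb z hz h1 h2) (by omega)).1 h0
  · intro h0
    refine ⟨?_, fun z hz h1 h2 => (hb z hz h1 h2 (by omega)).2⟩
    obtain ⟨j, hj1, hj2, hj⟩ := exists_leaf_of_nodeOk hok (k := 1) le_rfl (by omega)
    have h3 := hleaf (j - n + 1) (by omega) (by omega)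
    rw [show n + (j - n + 1) - 1 = j by omega, ← hj] at h3
    split_ifs at h3 with h4
    · rwa [h3]
    · exact absurd h3 h0

/-- Store `e` in the leaf of the position in register `r`, and restore the tournament tree. -/
def setLeaf (r : ℕ) (e : Expr) : Program :=
  .seq (.assign 13 (.reg 0 + (.reg r - 1))) <|
  .seq (.store 14 (.reg 13) e) climb

theorem run_setLeaf {w : ℕ} {K : ℤ} (hw : Fits w n K) {s : State} (h0 : s.reg 0 = n)
    (hA : ∀ x : ℕ, s.arr 0 ((x : ℤ) - 1) = val A x) {L L' : Finset ℕ} (hT : Tournament A L s)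
    {r x v : ℕ} {e : Expr} (hx : 1 ≤ x) (hxn : x ≤ n) (hr : s.reg r = x)
    (he : e.eval w (s.setReg 13 ((n : ℤ) + (x - 1))) = v) (hec : e.cost ≤ 1)
    (hL : ∀ z, z ≠ x → (z ∈ L' ↔ z ∈ L)) (hv : v = if x ∈ L' then x else 0) :
    Run w (setLeaf r e) s fun τ s' => τ ≤ 60 * Nat.log 2 n + 80 ∧ Tournament A L' s' ∧
      Frame (setLeaf r e) s s' := by
  refine Run.and_frame ?_
  obtain ⟨hK, hl, hsq⟩ := id hw
  obtain ⟨f, h14, hfn, hleaf, hok⟩ := hT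
  have e13 : Expr.eval w s (.reg 0 + (.reg r - 1)) = (n : ℤ) + (x - 1) := by
    simp (disch := omega) [h0, hr, wrap_of_le hK]
  have hlog : Nat.log 2 (n + x - 1) ≤ Nat.log 2 n + 1 := by
    rw [← Nat.log_mul_base (by omega) (by omega)]
    exact Nat.log_mono_right (by omega)
  have hcast : (n : ℤ) + (x - 1) = (n + x - 1 : ℕ) := by omega
  have hvn : v ≤ n := by rw [hv]; split_ifs <;> omega
  rw [setLeaf, run_seq, run_assign, e13, run_seq, run_store, he, eval_reg, setReg_reg, if_pos rfl]
  refine Run.mono (run_climb (A := A) hw (f := fun k => if k = n + x - 1 then v else f k)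
    (j := n + x - 1) ?_ ?_ ?_ (by omega) (by omega) ?_ ?_) ?_
  · intro z; simp [hA]
  · intro k; split_ifs
    · exact hvn
    · exact hfn k
  · intro k hk hk'
    rw [setArr_arr_self, setReg_arr, hcast]
    by_cases h : k = n + x - 1
    · simp [h]
    · rw [if_neg (by exact_mod_cast h), if_neg h, h14 k hk hk']
  · rw [setArr_reg, setReg_reg, if_pos rfl, hcast]
  · intro k hk hkn hki
    have := hok k hk hkn
    simp only [NodeOk, if_neg (show k ≠ n + x - 1 by omega),
      if_neg (show 2 * k ≠ n + x - 1 by omega), if_neg (show 2 * k + 1 ≠ n + x - 1 by omega)]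
    exact this
  · rintro τ s' ⟨hτ, ⟨f', h14', hfn', hfe, hok'⟩, -⟩
    refine ⟨?_, f', h14', hfn', ?_, hok'⟩
    · simp only [cost_reg, cost_add, cost_sub, cost_ofNat]
      omega
    · intro z hz hzn
      rw [hfe _ (by omega)]
      by_cases h : z = x
      · subst h
        rw [if_pos rfl, hv]
      · rw [if_neg (by omega), hleaf z hz hzn]
        exact if_congr (hL z h).symm rfl rfl

/-! ### The links between the occurrences of the same integer -/

/-- Link the position in register `3` of the sequence in the array `c` to the next occurrence; the
array `h` holds the first occurrences, and the array `nx` the links. -/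
def linkNext (c h nx : ℕ) : Program :=
  .seq (.store nx (.reg 3) (.reg 2 + .load h (.load c (.reg 3 - 1)))) <|
  .store h (.load c (.reg 3 - 1)) (.reg 3 - .reg 2)

/-- The array `h` holds the first occurrences after the position `i`, and the array `nx` the links
to the next occurrences of the positions after `i`. -/
def NextOk (C : Fin n → ℤ) (h nx i : ℕ) (s : State) : Prop :=
  (∀ v : ℤ, s.arr h v = nextOcc C v (i + 1) - ((n : ℤ) + 1)) ∧
    ∀ x : ℕ, i < x → x ≤ n → s.arr nx x = nextOcc C (val C x) (x + 1)

theorem NextOk.congr {C : Fin n → ℤ} {h nx i : ℕ} {s s' : State} (hn : NextOk C h nx i s)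
    (h1 : s'.arr h = s.arr h) (h2 : s'.arr nx = s.arr nx) : NextOk C h nx i s' := by
  unfold NextOk; rw [h1, h2]; exact hn

theorem run_linkNext {w : ℕ} {K : ℤ} (hw : Fits w n K) {s : State} {C : Fin n → ℤ} {c h nx i : ℕ}
    (hcn : c ≠ nx) (hhn : h ≠ nx) (h2 : s.reg 2 = n + 1)
    (hC : ∀ x : ℕ, s.arr c ((x : ℤ) - 1) = val C x) (hi : i + 1 ≤ n) (h3 : s.reg 3 = (i + 1 : ℕ))
    (hN : NextOk C h nx (i + 1) s) :
    Run w (linkNext c h nx) s fun τ s' => τ ≤ 20 ∧ NextOk C h nx i s' ∧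
      Frame (linkNext c h nx) s s' := by
  refine Run.and_frame ?_
  obtain ⟨hK, hl, hsq⟩ := id hw
  have h4 := le_nextOcc C (val C (i + 1)) (i + 1 + 1)
  have h5 := nextOcc_le_succ C (val C (i + 1)) (x := i + 1 + 1) (by omega)
  have ha : s.arr c (i + 1 - 1) = val C (i + 1) := by exact_mod_cast hC (i + 1)
  rw [linkNext, run_seq, run_store, run_store]
  have e1 : Expr.eval w s (.load c (.reg 3 - 1)) = val C (i + 1) := by
    simp (disch := omega) [h3, wrap_of_le hK]
    simpa using ha
  have e2 : Expr.eval w s (.reg 2 + .load h (.load c (.reg 3 - 1))) =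
      nextOcc C (val C (i + 1)) (i + 1 + 1) := by
    rw [eval_add, eval_load, e1, hN.1, eval_reg, h2, wrap_of_le hK (by omega) (by omega)]
    omega
  rw [e2, eval_reg, h3]
  set s1 := s.setArr nx ((i + 1 : ℕ) : ℤ) (nextOcc C (val C (i + 1)) (i + 1 + 1)) with hs1
  have e3 : Expr.eval w s1 (.load c (.reg 3 - 1)) = val C (i + 1) := by
    rw [← e1]
    simp [hs1, hcn]
  have e4 : Expr.eval w s1 (.reg 3 - .reg 2) = (i + 1 : ℕ) - ((n : ℤ) + 1) := by
    simp only [eval_sub, eval_reg, hs1, setArr_reg, h2, h3]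
    rw [wrap_of_le hK (by omega) (by omega)]
  rw [e3, e4]
  refine ⟨by simp, ?_, ?_⟩
  · intro v
    rw [setArr_arr_self]
    split_ifs with hv
    · rw [nextOcc_step_of_eq C hv.symm]
    · rw [nextOcc_step_of_ne C hi (fun h => hv h.symm), ← hN.1 v, hs1,
        setArr_arr_of_ne _ _ _ hhn]
  · intro x hx hxn
    rw [setArr_arr_of_ne _ _ _ hhn.symm, hs1, setArr_arr_self]
    split_ifs with hxi
    · obtain rfl : x = i + 1 := by exact_mod_cast hxi
      rfl
    · exact hN.2 x (by have : x ≠ i + 1 := by exact_mod_cast hxi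
                       omega) hxn

/-- Link the position in register `3` of the sequence in the array `c` to the previous occurrence;
the array `l` holds the last occurrences, and the array `pv` the links. -/
def linkPrev (c l pv : ℕ) : Program :=
  .seq (.store pv (.reg 3) (.load l (.load c (.reg 3 - 1)))) <|
  .store l (.load c (.reg 3 - 1)) (.reg 3)

/-- The array `l` holds the last occurrences before the position `i`, and the array `pv` the links
to the previous occurrences of the positions before `i`. -/
def PrevOk (C : Fin n → ℤ) (l pv i : ℕ) (s : State) : Prop :=
  (∀ v : ℤ, s.arr l v = prevOcc C v i) ∧
    ∀ x : ℕ, 1 ≤ x → x < i → s.arr pv x = prevOcc C (val C x) x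

theorem PrevOk.congr {C : Fin n → ℤ} {h nx i : ℕ} {s s' : State} (hn : PrevOk C h nx i s)
    (h1 : s'.arr h = s.arr h) (h2 : s'.arr nx = s.arr nx) : PrevOk C h nx i s' := by
  unfold PrevOk; rw [h1, h2]; exact hn

theorem run_linkPrev {w : ℕ} {K : ℤ} (hw : Fits w n K) {s : State} {C : Fin n → ℤ} {c l pv i : ℕ}
    (hcp : c ≠ pv) (hlp : l ≠ pv)
    (hC : ∀ x : ℕ, s.arr c ((x : ℤ) - 1) = val C x) (hi : 1 ≤ i) (hin : i ≤ n) (h3 : s.reg 3 = i)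
    (hN : PrevOk C l pv i s) :
    Run w (linkPrev c l pv) s fun τ s' => τ ≤ 20 ∧ PrevOk C l pv (i + 1) s' ∧
      Frame (linkPrev c l pv) s s' := by
  refine Run.and_frame ?_
  obtain ⟨hK, hl, hsq⟩ := id hw
  rw [linkPrev, run_seq, run_store, run_store]
  have e1 : Expr.eval w s (.load c (.reg 3 - 1)) = val C i := by
    simp (disch := omega) [h3, wrap_of_le hK, hC]
  rw [eval_load, e1, hN.1, eval_reg, h3]
  set s1 := s.setArr pv (i : ℤ) (prevOcc C (val C i) i) with hs1
  have e3 : Expr.eval w s1 (.load c (.reg 3 - 1)) = val C i := by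
    rw [← e1]
    simp [hs1, hcp]
  rw [e3, eval_reg, hs1, setArr_reg, h3]
  refine ⟨by simp, ?_, ?_⟩
  · intro v
    rw [setArr_arr_self]
    split_ifs with hv
    · rw [prevOcc_step_of_eq C hv.symm]
    · rw [prevOcc_step_of_ne C hi (fun h => hv h.symm), ← hN.1 v, setArr_arr_of_ne _ _ _ hlp]
  · intro x hx hxn
    rw [setArr_arr_of_ne _ _ _ hlp.symm, setArr_arr_self]
    split_ifs with hxi
    · obtain rfl : x = i := by exact_mod_cast hxi
      rfl
    · exact hN.2 x hx (by have : x ≠ i := by exact_mod_cast hxi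
                          omega)

/-- Link all positions to the next occurrences, in a scan from right to left. -/
def scanDown : Program :=
  .seq (.assign 3 (.reg 0)) <|
  .loop ((0 : Expr).lt (.reg 3)) <|
  .seq (linkNext 0 5 6) <|
  .seq (linkNext 1 7 8) <|
  .assign 3 (.reg 3 - 1)

theorem run_scanDown {w : ℕ} {K : ℤ} (hw : Fits w n K) {s : State} (h0 : s.reg 0 = n)
    (h2 : s.reg 2 = n + 1) (hA : ∀ x : ℕ, s.arr 0 ((x : ℤ) - 1) = val A x)
    (hB : ∀ x : ℕ, s.arr 1 ((x : ℤ) - 1) = val B x) (h5 : ∀ z, s.arr 5 z = 0)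
    (h7 : ∀ z, s.arr 7 z = 0) :
    Run w scanDown s fun τ s' => τ ≤ 60 * n + 10 ∧
      (NextOk A 5 6 0 s' ∧ NextOk B 7 8 0 s') ∧ Frame scanDown s s' := by
  obtain ⟨hK, hl, hsq⟩ := id hw
  refine Run.and_frame ?_
  have hend : ∀ {C : Fin n → ℤ} {v : ℤ}, nextOcc C v (n + 1) = n + 1 := fun {C v} =>
    le_antisymm (nextOcc_le_succ C v le_rfl) (le_nextOcc C v _)
  rw [scanDown, run_seq, run_assign, eval_reg, h0]
  refine Run.mono (run_loop (fun (i : ℕ) s' => i ≤ n ∧ s'.reg 3 = i ∧ NextOk A 5 6 i s' ∧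
    NextOk B 7 8 i s') (fun i => 60 * i + 5) (R := fun s' => NextOk A 5 6 0 s' ∧ NextOk B 7 8 0 s')
    ?_ n ?_) ?_
  rotate_left
  · refine ⟨le_rfl, by simp, ⟨fun v => ?_, fun x h1 h2 => by omega⟩, fun v => ?_,
      fun x h1 h2 => by omega⟩
    · rw [setReg_arr, h5, hend]; push_cast; ring
    · rw [setReg_arr, h7, hend]; push_cast; ring
  · rintro τ s' ⟨h1, h2, -⟩
    exact ⟨by simp only [cost_reg]; omega, h2⟩
  rintro i s1 hF ⟨hi, h3, hN1, hN2⟩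
  have h2' : s1.reg 2 = n + 1 := by rw [hF.1 2 (by decide)]; simpa using h2
  have hA1 : ∀ x : ℕ, s1.arr 0 ((x : ℤ) - 1) = val A x := by rw [hF.2 0 (by decide)]; exact hA
  have hB1 : ∀ x : ℕ, s1.arr 1 ((x : ℤ) - 1) = val B x := by rw [hF.2 1 (by decide)]; exact hB
  have hc : Expr.eval w s1 ((0 : Expr).lt (.reg 3)) = if 0 < i then 1 else 0 := by
    rw [eval_lt, eval_reg, eval_ofNat, h3, wrap_ite (by omega), Nat.cast_zero,
      wrap_of_le hK (by omega) (by omega)]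
    norm_cast
  rw [hc]
  rcases i with _ | i
  · exact .inl ⟨by simp, by simp, hN1, hN2⟩
  · right
    refine ⟨by simp, ?_⟩
    rw [run_seq]
    refine Run.mono (run_linkNext hw (by decide) (by decide) h2' hA1 hi h3 hN1) ?_
    rintro τ s2 ⟨hτ, hN3, hF2⟩
    rw [run_seq]
    refine Run.mono (run_linkNext hw (C := B) (i := i) (by decide) (by decide)
      (by rw [hF2.1 2 (by decide), h2']) (by rw [hF2.2 1 (by decide)]; exact hB1) hi
      (by rw [hF2.1 3 (by decide), h3])
      (hN2.congr (hF2.2 7 (by decide)) (hF2.2 8 (by decide)))) ?_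
    rintro τ' s3 ⟨hτ', hN4, hF3⟩
    rw [run_assign]
    have h3' : s3.reg 3 = (i + 1 : ℕ) := by rw [hF3.1 3 (by decide), hF2.1 3 (by decide), h3]
    refine ⟨i, ⟨by omega, ?_, ?_, hN4⟩, ?_⟩
    · simp (disch := omega) [h3', wrap_of_le hK]
    · exact hN3.congr (hF3.2 5 (by decide)) (hF3.2 6 (by decide))
    · simp only [cost_op, cost_reg, cost_sub, cost_ofNat]
      omega

/-- Compute the entry of the table of `low` at the position in register `3`. -/
def fillLow : Program :=
  .ite (.eq (.reg 3) (2 * (.reg 3 / 2))) (.store 13 (.reg 3) (2 * .load 13 (.reg 3 / 2)))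
    (.store 13 (.reg 3) 1)

theorem run_fillLow {w : ℕ} {K : ℤ} (hw : Fits w n K) {s : State} {i : ℕ} (hi : 1 ≤ i) (hin : i ≤ n)
    (h3 : s.reg 3 = i) (h : ∀ u : ℕ, 1 ≤ u → u < i → s.arr 13 u = low u) :
    Run w fillLow s fun τ s' => τ ≤ 20 ∧ (∀ u : ℕ, 1 ≤ u → u < i + 1 → s'.arr 13 u = low u) ∧
      Frame fillLow s s' := by
  refine Run.and_frame ?_
  obtain ⟨hK, hl, hsq⟩ := id hw
  have hc : Expr.eval w s (.eq (.reg 3) (2 * (.reg 3 / 2))) = if i % 2 = 0 then 1 else 0 := by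
    rw [eval_eq, wrap_ite (by omega)]
    simp (disch := omega) only [eval_reg, eval_mul, eval_ofNat, eval_div, h3, wrap_of_le hK]
    exact if_congr (by omega) rfl rfl
  have hlow := low_le i
  by_cases hpar : i % 2 = 0
  · have := h (i / 2) (by omega) (by omega)
    rw [low_even hpar] at hlow
    push_cast at this
    refine run_ite_of_ne (by rw [hc, if_pos hpar]; simp) ?_
    rw [run_store]
    refine ⟨by simp, fun u hu hui => ?_⟩
    simp (disch := omega) [h3, wrap_of_le hK, this]
    split_ifs with hu'
    · rw [hu', low_even hpar]; simp
    · exact h u hu (by omega)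
  · refine run_ite_of_eq (by rw [hc, if_neg hpar]) ?_
    rw [run_store]
    refine ⟨by simp, fun u hu hui => ?_⟩
    simp (disch := omega) [h3, wrap_of_le hK]
    split_ifs with hu'
    · rw [hu', low_odd (by omega)]; simp
    · exact h u hu (by omega)

/-- Link all positions to the previous occurrences, compute the table of `low`, and enter the first
occurrences in `A` into the tournament tree, in a scan from left to right. -/
def scanUp : Program :=
  .seq (.assign 3 1) <|
  .loop ((Expr.reg 3).lt (.reg 2)) <|
  .seq (linkPrev 0 9 10) <|
  .seq (linkPrev 1 11 12) <|
  .seq fillLow <|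
  .seq (.ite (.eq (.load 10 (.reg 3)) 0) (setLeaf 3 (.reg 3)) .skip) <|
  .assign 3 (.reg 3 + 1)

variable (A) in
/-- The first occurrences in `A`, up to the position `i`, of the integers that are not in `D`. -/
def firsts (D : Finset ℤ) (i : ℕ) : Finset ℕ :=
  (Finset.Icc 1 i).filter fun z => prevOcc A (val A z) z = 0 ∧ val A z ∉ D

theorem mem_firsts {D : Finset ℤ} {i z : ℕ} :
    z ∈ firsts A D i ↔ 1 ≤ z ∧ z ≤ i ∧ prevOcc A (val A z) z = 0 ∧ val A z ∉ D := by
  simp [firsts, and_assoc]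

theorem run_scanUp {w : ℕ} {K : ℤ} (hw : Fits w n K) {s : State} (h0 : s.reg 0 = n)
    (h2 : s.reg 2 = n + 1) (hA : ∀ x : ℕ, s.arr 0 ((x : ℤ) - 1) = val A x)
    (hB : ∀ x : ℕ, s.arr 1 ((x : ℤ) - 1) = val B x) (h9 : ∀ z, s.arr 9 z = 0)
    (h11 : ∀ z, s.arr 11 z = 0) (h14 : ∀ z, s.arr 14 z = 0) :
    Run w scanUp s fun τ s' => τ ≤ n * (60 * Nat.log 2 n + 200) + 10 ∧
      (PrevOk A 9 10 (n + 1) s' ∧ PrevOk B 11 12 (n + 1) s' ∧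
        (∀ u : ℕ, 1 ≤ u → u < n + 1 → s'.arr 13 u = low u) ∧ Tournament A (firsts A ∅ n) s') ∧
      Frame scanUp s s' := by
  obtain ⟨hK, hl, hsq⟩ := id hw
  refine Run.and_frame ?_
  have hone : ∀ {C : Fin n → ℤ} {v : ℤ}, prevOcc C v 1 = 0 := fun {C v} => by
    have := prevOcc_lt C v (x := 1) le_rfl
    omega
  have e1 : Expr.eval w s 1 = 1 := by simp (disch := omega) [wrap_of_le hK]
  rw [scanUp, run_seq, run_assign, e1]
  refine Run.mono (run_loop (fun (i : ℕ) s' => 1 ≤ i ∧ i ≤ n + 1 ∧ s'.reg 3 = i ∧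
    PrevOk A 9 10 i s' ∧ PrevOk B 11 12 i s' ∧
      (∀ u : ℕ, 1 ≤ u → u < i → s'.arr 13 u = low u) ∧ Tournament A (firsts A ∅ (i - 1)) s')
    (fun i => (n + 1 - i) * (60 * Nat.log 2 n + 200) + 5)
    (R := fun s' => PrevOk A 9 10 (n + 1) s' ∧ PrevOk B 11 12 (n + 1) s' ∧
        (∀ u : ℕ, 1 ≤ u → u < n + 1 → s'.arr 13 u = low u) ∧ Tournament A (firsts A ∅ n) s')
    ?_ 1 ?_) ?_
  rotate_left
  · refine ⟨le_rfl, by omega, by simp, ⟨fun v => ?_, fun x h1 h2 => by omega⟩, ⟨fun v => ?_,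
      fun x h1 h2 => by omega⟩, fun u h1 h2 => by omega, fun _ => 0, ?_, fun _ => Nat.zero_le _, ?_, ?_⟩
    · rw [setReg_arr, h9, hone]; rfl
    · rw [setReg_arr, h11, hone]; rfl
    · intro k _ _; rw [setReg_arr, h14]; rfl
    · intro x hx _
      rw [if_neg (fun h => by have := (mem_firsts.1 h).2.1; omega)]
    · intro k _ _
      exact ⟨.inl rfl, Beats.refl _, Beats.refl _⟩
  · rintro τ s' ⟨h1, h2, -⟩
    refine ⟨?_, h2⟩
    rw [Nat.add_sub_cancel] at h1
    simp only [cost_ofNat]; omega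
  rintro i s1 hF ⟨hi, hin, h3, hP1, hP2, hlow, hT⟩
  have h0' : s1.reg 0 = n := by rw [hF.1 0 (by decide)]; simpa using h0
  have h2' : s1.reg 2 = n + 1 := by rw [hF.1 2 (by decide)]; simpa using h2
  have hA1 : ∀ x : ℕ, s1.arr 0 ((x : ℤ) - 1) = val A x := by rw [hF.2 0 (by decide)]; exact hA
  have hB1 : ∀ x : ℕ, s1.arr 1 ((x : ℤ) - 1) = val B x := by rw [hF.2 1 (by decide)]; exact hB
  have hc : Expr.eval w s1 ((Expr.reg 3).lt (.reg 2)) = if i < n + 1 then 1 else 0 := by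
    rw [eval_lt, eval_reg, eval_reg, h3, h2', wrap_ite (by omega)]
    norm_cast
  rw [hc]
  by_cases hin' : i ≤ n
  · right
    refine ⟨by simp; omega, ?_⟩
    rw [run_seq]
    refine Run.mono (run_linkPrev hw (by decide) (by decide) hA1 hi hin' h3 hP1) ?_
    rintro τ1 s2 ⟨hτ1, hP3, hF2⟩
    rw [run_seq]
    have h32 : s2.reg 3 = i := by rw [hF2.1 3 (by decide), h3]
    refine Run.mono (run_linkPrev hw (C := B) (i := i) (by decide) (by decide)
      (by rw [hF2.2 1 (by decide)]; exact hB1) hi hin' h32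
      (hP2.congr (hF2.2 11 (by decide)) (hF2.2 12 (by decide)))) ?_
    rintro τ2 s3 ⟨hτ2, hP4, hF3⟩
    have h33 : s3.reg 3 = i := by rw [hF3.1 3 (by decide), h32]
    rw [run_seq]
    refine Run.mono (run_fillLow hw hi hin' h33
      (by rw [hF3.2 13 (by decide), hF2.2 13 (by decide)]; exact hlow)) ?_
    rintro τ3 s4 ⟨hτ3, hlow4, hF4⟩
    have h34 : s4.reg 3 = i := by rw [hF4.1 3 (by decide), h33]
    have hP34 : PrevOk A 9 10 (i + 1) s4 := by
      refine hP3.congr ?_ ?_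
      · rw [hF4.2 9 (by decide), hF3.2 9 (by decide)]
      · rw [hF4.2 10 (by decide), hF3.2 10 (by decide)]
    have hT4 : Tournament A (firsts A ∅ (i - 1)) s4 := by
      refine hT.congr ?_
      rw [hF4.2 14 (by decide), hF3.2 14 (by decide), hF2.2 14 (by decide)]
    have hpv := hP34.2 i hi (by omega)
    have hstep : ∀ (s5 : State) (τ : ℕ), Frame (setLeaf 3 (.reg 3)) s4 s5 →
        Tournament A (firsts A ∅ i) s5 → τ ≤ 60 * Nat.log 2 n + 100 →
        Run w (.assign 3 (.reg 3 + 1)) s5 fun t s' => ∃ g', (1 ≤ g' ∧ g' ≤ n + 1 ∧ s'.reg 3 = (g' : ℕ) ∧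
          PrevOk A 9 10 g' s' ∧ PrevOk B 11 12 g' s' ∧
          (∀ u : ℕ, 1 ≤ u → u < g' → s'.arr 13 u = low u) ∧ Tournament A (firsts A ∅ (g' - 1)) s') ∧
          4 + (τ1 + (τ2 + (τ3 + (τ + t)))) + ((n + 1 - g') * (60 * Nat.log 2 n + 200) + 5) ≤
            (n + 1 - i) * (60 * Nat.log 2 n + 200) + 5 := by
      intro s5 τ hF5 hT5 hτ
      have h35 : s5.reg 3 = i := by rw [hF5.1 3 (by decide), h34]
      rw [run_assign]
      refine ⟨i + 1, ⟨by omega, by omega, ?_, ?_, ?_, ?_, hT5⟩, ?_⟩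
      · simp (disch := omega) [h35, wrap_of_le hK]
      · exact hP34.congr (hF5.2 9 (by decide)) (hF5.2 10 (by decide))
      · refine hP4.congr ?_ ?_
        · rw [setReg_arr, hF5.2 11 (by decide), hF4.2 11 (by decide)]
        · rw [setReg_arr, hF5.2 12 (by decide), hF4.2 12 (by decide)]
      · rw [setReg_arr, hF5.2 13 (by decide)]; exact hlow4
      · obtain ⟨m, hm⟩ : ∃ m, n + 1 - i = m + 1 := ⟨n - i, by omega⟩
        rw [hm, show n + 1 - (i + 1) = m by omega,
          Nat.succ_mul m (60 * Nat.log 2 n + 200)]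
        simp only [cost_reg, cost_add, cost_ofNat]
        omega
    have hc2 : Expr.eval w s4 (.eq (.load 10 (.reg 3)) 0) =
        if prevOcc A (val A i) i = 0 then 1 else 0 := by
      rw [eval_eq, eval_load, eval_reg, h34, hpv, eval_ofNat, wrap_ite (by omega), Nat.cast_zero,
        wrap_of_le hK (by omega) (by omega)]
      norm_cast
    rw [run_seq]
    by_cases hfirst : prevOcc A (val A i) i = 0
    · refine run_ite_of_ne (by rw [hc2, if_pos hfirst]; simp) ?_
      refine Run.mono (run_setLeaf hw (L' := firsts A ∅ i) (v := i) (x := i) ?_ ?_ hT4 hi hin' h34 ?_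
        le_rfl ?_ ?_) ?_
      · rw [hF4.1 0 (by decide), hF3.1 0 (by decide), hF2.1 0 (by decide), h0']
      · rw [hF4.2 0 (by decide), hF3.2 0 (by decide), hF2.2 0 (by decide)]; exact hA1
      · simp [h34]
      · intro z hz
        rw [mem_firsts, mem_firsts]
        exact and_congr_right fun _ => and_congr_left fun _ => by omega
      · rw [if_pos]
        exact mem_firsts.2 ⟨hi, le_rfl, hfirst, by simp⟩
      · rintro τ s5 ⟨hτ, hT5, hF5⟩
        refine Run.mono (hstep s5 (5 + τ) hF5 hT5 (by omega)) ?_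
        rintro t s6 ⟨g', h1, h2⟩
        exact ⟨g', h1, by simpa [add_assoc] using h2⟩
    · refine run_ite_of_eq (by rw [hc2, if_neg hfirst]) ?_
      rw [run_skip]
      have hL : firsts A ∅ i = firsts A ∅ (i - 1) := by
        ext z
        rw [mem_firsts, mem_firsts]
        constructor
        · rintro ⟨h1, h2, h3, h4⟩
          exact ⟨h1, by have : z ≠ i := fun h => hfirst (h ▸ h3)
                        omega, h3, h4⟩
        · rintro ⟨h1, h2, h3, h4⟩
          exact ⟨h1, by omega, h3, h4⟩
      refine Run.mono (hstep s4 6 (Frame.refl _ _) (hL ▸ hT4) (by omega)) ?_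
      rintro t s6 ⟨g', h1, h2⟩
      exact ⟨g', h1, by simpa using h2⟩
  · left
    obtain rfl : i = n + 1 := by omega
    exact ⟨by simp, by simp, hP1, hP2, hlow, hT⟩

/-! ### The whole program -/

/-- Process the integers of `A` in increasing order. -/
def mainLoop : Program :=
  .loop ((0 : Expr).lt (.load 14 1)) <|
  .seq (.assign 11 (.load 14 1)) <|
  .seq processInt (setLeaf 11 0)

theorem nextOcc_one_of_prevOcc_eq_zero {x : ℕ} (hx : 1 ≤ x) (hxn : x ≤ n)
    (h : prevOcc A (val A x) x = 0) : nextOcc A (val A x) 1 = x := by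
  have h1 := nextOcc_le A (v := val A x) hx (.inr rfl)
  refine le_antisymm h1 ?_
  by_contra! h2
  have h3 := le_nextOcc A (val A x) 1
  exact val_ne_of_prevOcc_lt A (by omega) h2 (val_nextOcc A (by omega))

/-- The ghost state of the loop consists of the set `D` of the integers that have been processed and
the list `o` of the pairs that have been output; every integer in `D` is less than every other
integer of `A`. -/
theorem run_mainLoop {w : ℕ} {K : ℤ} (hw : Fits w n K) (hn : 1 ≤ n) {s : State}
    (hS : Static A B s) (hT : Tournament A (firsts A ∅ n) s) (h1 : s.reg 1 = 0)
    (h10 : s.reg 10 = 0) (h15 : ∀ z, s.arr 15 z = 0) (h16 : ∀ z, s.arr 16 z = 0) :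
    Run w mainLoop s fun τ s' =>
      τ ≤ ∑ a ∈ Finset.univ.image A, (intCost A B a + (60 * Nat.log 2 n + 150)) + 10 ∧
      (∃ o, Output A B o s' ∧ o.Nodup ∧ ∀ p, p ∈ o ↔ Match A B p.1 p.2) ∧ Frame mainLoop s s' := by
  obtain ⟨hK, hl, hsq⟩ := id hw
  have hval : ∀ x, 1 ≤ x → x ≤ n → val A x ∈ Finset.univ.image A := fun x hx hxn => by
    rw [val_eq A hx hxn]; exact Finset.mem_image_of_mem _ (Finset.mem_univ _)
  refine run_loop (fun (b : Finset ℤ × List (ℕ × ℕ)) s' => b.1 ⊆ Finset.univ.image A ∧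
      (∀ d ∈ b.1, ∀ x, 1 ≤ x → x ≤ n → val A x ∉ b.1 → d < val A x) ∧
      (∃ t, Table n t s' ∧ TableOk A B b.1 t) ∧ Output A B b.2 s' ∧ b.2.Nodup ∧
      (∀ p : ℕ × ℕ, p ∈ b.2 ↔ Match A B p.1 p.2 ∧ val A p.1 ∈ b.1) ∧
      (∀ y, 1 ≤ y → y ≤ n → val B y ∉ b.1 → s'.arr 15 y = 0) ∧ Tournament A (firsts A b.1 n) s')
    (fun b => ∑ a ∈ Finset.univ.image A \ b.1, (intCost A B a + (60 * Nat.log 2 n + 150)) + 10)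
    (R := fun s' => ∃ o, Output A B o s' ∧ o.Nodup ∧ ∀ p : ℕ × ℕ, p ∈ o ↔ Match A B p.1 p.2)
    ?_ (∅, []) ?_ |>.mono fun τ s' h => ⟨by simpa using h.1, h.2⟩
  swap
  · refine ⟨by simp, by simp, ⟨fun _ _ => 0, fun u v _ _ _ _ => by simp [h16],
      fun _ _ => .inl rfl, by simp⟩, ⟨by simp [h1], by simp, 0, by simp [h10]⟩, by simp,
      by simp, fun _ _ _ _ => h15 _, hT⟩
  rintro ⟨D, o⟩ s1 hF ⟨hDA, hord, ⟨t, hTab, htok⟩, hO, hnd, hmem, hH, hT1⟩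
  dsimp only at *
  have hS1 : Static A B s1 := hS.frame hF (by decide) (by decide)
  obtain ⟨x, hx, hxn, hx0, hx1⟩ := hT1.root hn
  have ex : Expr.eval w s1 (.load 14 1) = x := by
    rw [eval_load, eval_ofNat, Nat.cast_one, wrap_of_le hK (by omega) (by omega), hx]
  have hc : Expr.eval w s1 ((0 : Expr).lt (.load 14 1)) = if 0 < x then 1 else 0 := by
    rw [eval_lt, ex, eval_ofNat, wrap_ite (by omega), Nat.cast_zero,
      wrap_of_le hK (by omega) (by omega)]
    norm_cast
  rw [hc]
  rcases Nat.eq_zero_or_pos x with rfl | hxpos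
  · left
    refine ⟨by simp, by simp, o, hO, hnd, fun p => ?_⟩
    rw [hmem, and_iff_left_of_imp]
    intro hm
    by_contra hD
    -- the first occurrence of an integer that is left would still be in the tree
    have hle : nextOcc A (val A p.1) 1 ≤ p.1 := nextOcc_le A hm.1 (.inr rfl)
    have hge := le_nextOcc A (val A p.1) 1
    have hpn := hm.2.1
    have hv := val_nextOcc A (v := val A p.1) (x := 1) (by omega)
    refine hx0 rfl (nextOcc A (val A p.1) 1) (mem_firsts.2 ⟨hge, by omega, ?_, ?_⟩) hge (by omega)
    · rw [hv]
      have := prevOcc_lt A (val A p.1) (x := 1) le_rfl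
      rw [prevOcc_nextOcc A _ 0]
      change prevOcc A (val A p.1) 1 = 0
      omega
    · rwa [hv]
  · right
    refine ⟨by simp; omega, ?_⟩
    obtain ⟨hxL, hmin⟩ := hx1 (by omega)
    obtain ⟨-, -, hfirst, hxD⟩ := mem_firsts.1 hxL
    obtain ⟨a, ha⟩ : ∃ a, a = val A x := ⟨_, rfl⟩
    have hmin' : ∀ z, 1 ≤ z → z ≤ n → val A z ∉ D → a ≤ val A z := by
      intro z hz hzn hzD
      have hle : nextOcc A (val A z) 1 ≤ z := nextOcc_le A hz (.inr rfl)
      have hge := le_nextOcc A (val A z) 1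
      have hv := val_nextOcc A (v := val A z) (x := 1) (by omega)
      rw [ha, ← hv]
      refine hmin _ (mem_firsts.2 ⟨hge, by omega, ?_, by rwa [hv]⟩) hge (by omega)
      rw [hv]
      have := prevOcc_lt A (val A z) (x := 1) le_rfl
      rw [prevOcc_nextOcc A _ 0]
      change prevOcc A (val A z) 1 = 0
      omega
    have haD : a ∉ D := ha ▸ hxD
    rw [run_seq, run_assign, ex, run_seq]
    have hS2 := hS1.setReg (r := 11) x (by decide)
    refine Run.mono (run_processInt hw hS2 (t := t) (D := D) (a := a) (o := o) hTab htok
      ?_ ?_ hnd ?_ (hO.congr (by simp) (by simp) rfl rfl rfl) hxpos hxn ha.symm ?_ (by simp) ?_) ?_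
    · intro z hz hzn hza
      by_contra hzD
      have := hmin' z hz hzn hzD
      omega
    · intro d hd
      rw [ha]
      exact hord d hd x hxpos hxn hxD
    · intro p hp
      obtain ⟨h1, h2⟩ := (hmem p).1 hp
      exact ⟨h1, fun h => haD (h ▸ h2)⟩
    · rw [ha]; exact nextOcc_one_of_prevOcc_eq_zero hxpos hxn hfirst
    · intro y hy hyn hya
      exact hH y hy hyn (hya ▸ haD)
    rintro τ s2 ⟨hτ, ⟨d, t', hd, hO2, hTab2, htok2, hH2⟩, hF2⟩
    have hS3 := hS2.frame hF2 (by decide) (by decide)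
    refine Run.mono (run_setLeaf hw (L := firsts A D n) (L' := firsts A (insert a D) n) (v := 0)
      (x := x) hS3.reg_len hS3.seqA (hT1.congr (by rw [hF2.2 14 (by decide)]; rfl)) hxpos hxn
      (by rw [hF2.1 11 (by decide)]; simp) (by simp (disch := omega) [wrap_of_le hK]) le_rfl
      ?_ ?_) ?_
    · intro z hz
      rw [mem_firsts, mem_firsts, Finset.mem_insert, not_or]
      constructor
      · rintro ⟨h1, h2, h3, h4⟩
        exact ⟨h1, h2, h3, h4.2⟩
      · rintro ⟨h1, h2, h3, h4⟩
        refine ⟨h1, h2, h3, fun h => hz ?_, h4⟩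
        have h5 := nextOcc_one_of_prevOcc_eq_zero h1 h2 h3
        have h6 := nextOcc_one_of_prevOcc_eq_zero hxpos hxn hfirst
        rw [h, ha] at h5
        omega
    · rw [if_neg]
      intro h
      exact (mem_firsts.1 h).2.2.2 (by simp [ha])
    rintro τ' s3 ⟨hτ', hT3, hF3⟩
    refine ⟨(insert a D, o ++ d), ⟨?_, ?_, ⟨t', hTab2.congr (hF3.2 16 (by decide)), htok2⟩, ?_,
      hd.nodup, ?_, ?_, hT3⟩, ?_⟩
    · exact Finset.insert_subset (ha ▸ hval x hxpos hxn) hDA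
    · intro d hd z hz hzn hzD
      rw [Finset.mem_insert, not_or] at hzD
      rcases Finset.mem_insert.1 hd with rfl | hd
      · exact lt_of_le_of_ne (hmin' z hz hzn hzD.2) (fun h => hzD.1 h.symm)
      · exact hord d hd z hz hzn hzD.2
    · exact hO2.congr (hF3.1 1 (by decide)) (hF3.1 10 (by decide)) (hF3.2 2 (by decide))
        (hF3.2 3 (by decide)) (hF3.2 4 (by decide))
    · intro p
      rw [List.mem_append, hmem, hd.mem, Finset.mem_insert]
      constructor
      · rintro (⟨h1, h2⟩ | ⟨h1, h2, -⟩)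
        · exact ⟨h1, .inr h2⟩
        · exact ⟨h1, .inl h2⟩
      · rintro ⟨h1, h2 | h2⟩
        · exact .inr ⟨h1, h2, by have := h1.2.1; omega⟩
        · exact .inl ⟨h1, h2⟩
    · intro y hy hyn hyD
      rw [Finset.mem_insert, not_or] at hyD
      rw [hF3.2 15 (by decide), hH2 y hy hyn hyD.1]
      exact hH y hy hyn hyD.2
    · have hsum : ∑ b ∈ Finset.univ.image A \ D, (intCost A B b + (60 * Nat.log 2 n + 150)) =
          (intCost A B a + (60 * Nat.log 2 n + 150)) +
          ∑ b ∈ Finset.univ.image A \ insert a D, (intCost A B b + (60 * Nat.log 2 n + 150)) := by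
        rw [← Finset.add_sum_erase _ _ (Finset.mem_sdiff.2 ⟨ha ▸ hval x hxpos hxn, haD⟩),
          Finset.sdiff_insert]
      rw [hsum]
      simp only [cost_op, cost_load, cost_ofNat]
      omega

/-- The program that computes the lengths of longest common increasing subsequences. -/
def program : Program :=
  .seq (.assign 2 (.reg 0 + 1)) <|
  .seq scanDown <|
  .seq scanUp <|
  .seq mainLoop <|
  .assign 0 (.reg 10)

theorem run_program {w : ℕ} {K : ℤ} (hw : Fits w n K) (hn : 1 ≤ n) (A B : Fin n → ℤ) :
    Run w program (initial w A B) fun τ s' =>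
      τ ≤ ∑ a ∈ Finset.univ.image A, (intCost A B a + (60 * Nat.log 2 n + 150)) +
        n * (60 * Nat.log 2 n + 300) ∧ IsOutput A B s' := by
  obtain ⟨hK, hl, hsq⟩ := id hw
  have h0 : (initial w A B).reg 0 = n := by
    simp only [initial, if_true]
    rw [wrap_of_le hK (by omega) (by omega)]
  have e2 : Expr.eval w (initial w A B) (.reg 0 + 1) = n + 1 := by
    simp (disch := omega) [h0, wrap_of_le hK]
  rw [program, run_seq, run_assign, e2, run_seq]
  refine Run.mono (run_scanDown (A := A) (B := B) hw (by simpa using h0) (by simp)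
    (fun x => by simp [initial, val]) (fun x => by simp [initial, val])
    (fun z => by simp [initial]) (fun z => by simp [initial])) ?_
  rintro τ1 s1 ⟨hτ1, ⟨hN1, hN2⟩, hF1⟩
  rw [run_seq]
  refine Run.mono (run_scanUp (A := A) (B := B) hw
    (by rw [hF1.1 0 (by decide)]; simpa using h0) (by rw [hF1.1 2 (by decide)]; simp)
    (fun x => by rw [hF1.2 0 (by decide)]; simp [initial, val])
    (fun x => by rw [hF1.2 1 (by decide)]; simp [initial, val])
    (fun z => by rw [hF1.2 9 (by decide)]; simp [initial])
    (fun z => by rw [hF1.2 11 (by decide)]; simp [initial])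
    (fun z => by rw [hF1.2 14 (by decide)]; simp [initial])) ?_
  rintro τ2 s2 ⟨hτ2, ⟨hP1, hP2, hlow, hT⟩, hF2⟩
  rw [run_seq]
  have hN1' := hN1.congr (hF2.2 5 (by decide)) (hF2.2 6 (by decide))
  have hN2' := hN2.congr (hF2.2 7 (by decide)) (hF2.2 8 (by decide))
  have hS : Static A B s2 := by
    constructor
    · rw [hF2.1 0 (by decide), hF1.1 0 (by decide)]; simpa using h0
    · rw [hF2.1 2 (by decide), hF1.1 2 (by decide)]; simp
    · intro x; rw [hF2.2 0 (by decide), hF1.2 0 (by decide)]; simp [initial, val]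
    · exact hN2'.1
    · exact fun x h1 h2 => hN1'.2 x h1 h2
    · exact fun x h1 h2 => hN2'.2 x h1 h2
    · exact fun x h1 h2 => hP1.2 x h1 (by omega)
    · exact fun x h1 h2 => hP2.2 x h1 (by omega)
    · exact fun x h1 h2 => hlow x h1 (by omega)
  refine Run.mono (run_mainLoop hw hn hS hT
    (by rw [hF2.1 1 (by decide), hF1.1 1 (by decide)]; simp [initial])
    (by rw [hF2.1 10 (by decide), hF1.1 10 (by decide)]; simp [initial])
    (fun z => by rw [hF2.2 15 (by decide), hF1.2 15 (by decide)]; simp [initial])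
    (fun z => by rw [hF2.2 16 (by decide), hF1.2 16 (by decide)]; simp [initial])) ?_
  rintro τ3 s3 ⟨hτ3, ⟨o, hO, hnd, hmem⟩, hF3⟩
  rw [run_assign]
  refine ⟨?_, ?_, ?_⟩
  · have : n * (60 * Nat.log 2 n + 300) = n * (60 * Nat.log 2 n + 200) + 100 * n := by ring
    simp only [cost_reg, cost_add, cost_ofNat]
    omega
  · obtain ⟨b, hb, -, hle, hex⟩ := hO.best
    refine ⟨b, isLength_of_lenAt (fun x y hm => hle (x, y) ((hmem _).2 hm)) ?_, by simp [hb]⟩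
    rcases hex with h | ⟨p, hp, h⟩
    · exact .inl h
    · exact .inr ⟨p.1, p.2, (hmem p).1 hp, h⟩
  · have hget : ∀ k : Fin o.length, Match A B (o[k]).1 (o[k]).2 :=
      fun k => (hmem _).1 (List.getElem_mem _)
    let e : Fin o.length → MatchingPair A B := fun k =>
      ⟨(⟨(o[k]).1 - 1, by have := hget k; have := this.1; have := (hget k).2.1; omega⟩,
        ⟨(o[k]).2 - 1, by have := (hget k).2.2.1; have := (hget k).2.2.2.1; omega⟩), by
        obtain ⟨h1, h2, h3, h4, h5⟩ := hget k
        rw [val_eq A h1 h2, val_eq B h3 h4] at h5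
        exact h5⟩
    have he : Function.Bijective e := by
      constructor
      · intro k k' hkk
        have h1 := congrArg (fun p : MatchingPair A B => (p.1.1 : ℕ)) hkk
        have h2 := congrArg (fun p : MatchingPair A B => (p.1.2 : ℕ)) hkk
        have h3 := hget k
        have h4 := hget k'
        simp only [e] at h1 h2
        have h5 : o[k] = o[k'] := by
          ext
          · have := h3.1; have := h4.1; omega
          · have := h3.2.2.1; have := h4.2.2.1; omega
        exact Fin.ext ((List.Nodup.getElem_inj_iff hnd).1 h5)
      · rintro ⟨⟨x, y⟩, hxy⟩
        have h1 : ((x : ℕ) + 1, (y : ℕ) + 1) ∈ o := (hmem _).2 ((match_add_one A B x y).2 hxy)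
        obtain ⟨k, hk, hk'⟩ := List.getElem_of_mem h1
        refine ⟨⟨k, hk⟩, ?_⟩
        simp [e, hk']
    refine ⟨o.length, Equiv.ofBijective e he, by simp [hO.count], fun k => ?_⟩
    obtain ⟨h2, h3, h4⟩ := hO.entries k k.2
    have hm := hget k
    have hm1 := hm.1
    have hm2 := hm.2.2.1
    refine ⟨?_, ?_, lenAt A B (o[k]).1 (o[k]).2, ?_, ?_⟩
    · rw [setReg_arr, h2]
      change _ = ((((o[k]).1 - 1 : ℕ)) : ℤ)
      rw [Nat.cast_sub hm1]; rfl
    · rw [setReg_arr, h3]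
      change _ = ((((o[k]).2 - 1 : ℕ)) : ℤ)
      rw [Nat.cast_sub hm2]; rfl
    · have := isLengthAt_lenAt (e k).2
      rw [show (((e k).1.1 : ℕ) + 1) = (o[k]).1 from Nat.sub_add_cancel hm1,
        show (((e k).1.2 : ℕ) + 1) = (o[k]).2 from Nat.sub_add_cancel hm2] at this
      exact this
    · rw [setReg_arr, h4]; rfl

/-! ### The running time -/

variable (A) in
theorem card_occFrom (a : ℤ) :
    (occFrom A a 1).card = (Finset.univ.filter fun i => A i = a).card := by
  symm
  refine Finset.card_bij (fun i _ => (i : ℕ) + 1) ?_ ?_ ?_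
  · intro i hi
    have := i.2
    rw [mem_occFrom, val_add_one]
    exact ⟨by omega, by omega, (Finset.mem_filter.1 hi).2⟩
  · intro i _ j _ h
    exact Fin.ext (by omega)
  · intro z hz
    obtain ⟨h1, h2, h3⟩ := mem_occFrom.1 hz
    rw [val_eq A h1 h2] at h3
    exact ⟨⟨z - 1, by omega⟩, by simpa using h3, by dsimp only; omega⟩

theorem occFrom_of_ne {v : ℤ} {x : ℕ} (hx : x ≤ n) (h : val A x ≠ v) :
    occFrom A v x = occFrom A v (x + 1) := by
  rw [← occFrom_nextOcc v x, nextOcc_step_of_ne A hx h, occFrom_nextOcc]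

variable (A) in
theorem sum_sub_prevOcc_le (v : ℤ) {x : ℕ} (hx : 1 ≤ x) (hxn : x ≤ n + 1) :
    ∑ z ∈ occFrom A v x, (z - prevOcc A v z) + prevOcc A v x ≤ n := by
  induction hk : n + 1 - x generalizing x with
  | zero =>
    have h1 : occFrom A v x = ∅ := by
      ext z; simp only [mem_occFrom, Finset.notMem_empty, iff_false]; omega
    have := prevOcc_lt A v hx
    rw [h1, Finset.sum_empty]; omega
  | succ k ih =>
    have h1 := ih (x := x + 1) (by omega) (by omega) (by omega)
    have h2 := prevOcc_lt A v hx
    by_cases hv : val A x = v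
    · rw [sum_occFrom (by omega) hv, occFrom_nextOcc]
      rw [prevOcc_step_of_eq A hv] at h1
      omega
    · rw [prevOcc_step_of_ne A hx hv, ← occFrom_of_ne (by omega) hv] at h1
      exact h1

variable (A) in
theorem sum_nextOcc_sub_le (v : ℤ) {x : ℕ} (hxn : x ≤ n + 1) :
    ∑ z ∈ occFrom A v x, (nextOcc A v (z + 1) - z) + nextOcc A v x ≤ n + 1 := by
  induction hk : n + 1 - x generalizing x with
  | zero =>
    have h1 : occFrom A v x = ∅ := by
      ext z; simp only [mem_occFrom, Finset.notMem_empty, iff_false]; omega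
    have := nextOcc_le_succ A v hxn
    rw [h1, Finset.sum_empty]; omega
  | succ k ih =>
    have h1 := ih (x := x + 1) (by omega) (by omega)
    have h2 := le_nextOcc A v (x + 1)
    by_cases hv : val A x = v
    · rw [sum_occFrom (by omega) hv, occFrom_nextOcc, nextOcc_step_of_eq A hv]
      omega
    · rw [nextOcc_step_of_ne A (by omega) hv, occFrom_of_ne (by omega) hv]
      exact h1

theorem natLog_le_logb {d : ℕ} (hd : 1 ≤ d) : (Nat.log 2 d : ℝ) ≤ Real.logb 2 d := by
  rw [← Real.natFloor_logb_natCast]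
  exact Nat.floor_le (Real.logb_nonneg (by norm_num) (by exact_mod_cast hd))

/-- Gaps of total length at most `n` have logarithms of sum at most about `c * log (n / c)`, if
there are at most `c` gaps; this is the concavity of the logarithm, in the form of its tangent at
`n / c`. -/
theorem sum_log_gap_le {s : Finset ℕ} {d : ℕ → ℕ} {c : ℕ} (hn : 1 ≤ n) (hc : 1 ≤ c)
    (hs : s.card ≤ c) (hd : ∀ z ∈ s, 1 ≤ d z) (hsum : ∑ z ∈ s, d z ≤ n) :
    ((∑ z ∈ s, (Nat.log 2 (d z) + 1) : ℕ) : ℝ) ≤ c * (|Real.logb 2 (n / c)| + 3) := by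
  have hn' : (0 : ℝ) < n := by exact_mod_cast hn
  have hc' : (0 : ℝ) < c := by exact_mod_cast hc
  have hs' : (s.card : ℝ) ≤ c := by exact_mod_cast hs
  have hl2 : (1 : ℝ) / 2 < Real.log 2 := by have := Real.log_two_gt_d9; linarith
  set l := |Real.logb 2 (n / c)| with hl
  have key : ∀ z ∈ s, ((Nat.log 2 (d z) + 1 : ℕ) : ℝ) ≤ (l + 1) + 2 * ((d z : ℝ) * (c / n)) := by
    intro z hz
    have hdz : (0 : ℝ) < d z := by exact_mod_cast hd z hz
    have h1 := natLog_le_logb (hd z hz)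
    have h2 : Real.logb 2 (d z) = Real.logb 2 (n / c) + Real.logb 2 (d z * (c / n)) := by
      rw [← Real.logb_mul (by positivity) (by positivity)]
      congr 1
      field_simp
    have h3 : Real.logb 2 (d z * (c / n)) ≤ 2 * ((d z : ℝ) * (c / n)) := by
      have h4 := Real.log_le_sub_one_of_pos (x := (d z : ℝ) * (c / n)) (by positivity)
      have h5 : (0 : ℝ) < (d z : ℝ) * (c / n) := by positivity
      rw [Real.logb, div_le_iff₀ (by linarith)]
      nlinarith
    have h6 := le_abs_self (Real.logb 2 ((n : ℝ) / c))
    push_cast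
    linarith
  have hl0 : 0 ≤ l := abs_nonneg _
  calc ((∑ z ∈ s, (Nat.log 2 (d z) + 1) : ℕ) : ℝ)
      = ∑ z ∈ s, ((Nat.log 2 (d z) + 1 : ℕ) : ℝ) := by push_cast; rfl
    _ ≤ ∑ z ∈ s, ((l + 1) + 2 * ((d z : ℝ) * (c / n))) := Finset.sum_le_sum key
    _ = s.card * (l + 1) + 2 * (((∑ z ∈ s, d z : ℕ) : ℝ) * (c / n)) := by
      rw [Finset.sum_add_distrib, Finset.sum_const, nsmul_eq_mul, ← Finset.mul_sum,
        ← Finset.sum_mul]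
      push_cast; rfl
    _ ≤ c * (l + 1) + 2 * ((n : ℝ) * (c / n)) := by
      gcongr
    _ = c * (l + 3) := by field_simp; ring

variable (A) in
theorem sum_downCost_le {a : ℤ} {c : ℕ} (hn : 1 ≤ n) (hc : 1 ≤ c)
    (hs : (occFrom A a 1).card ≤ c) :
    ((∑ x ∈ occFrom A a 1, downCost A x : ℕ) : ℝ) ≤ c * (|Real.logb 2 (n / c)| + 3) := by
  have h1 := sum_sub_prevOcc_le A a (x := 1) le_rfl (by omega)
  refine le_trans ?_ (sum_log_gap_le hn hc hs (d := fun z => z - prevOcc A a z) ?_ (by omega))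
  · rw [Nat.cast_le]
    refine Finset.sum_le_sum fun z hz => ?_
    obtain ⟨h2, h3, h4⟩ := mem_occFrom.1 hz
    rw [downCost, h4]
    exact down_le (prevOcc_lt A a h2)
  · intro z hz
    have := prevOcc_lt A a (mem_occFrom.1 hz).1
    omega

variable (A) in
theorem sum_upCost_le {a : ℤ} {c : ℕ} (hn : 1 ≤ n) (hc : 1 ≤ c)
    (hs : (occFrom A a 1).card ≤ c) :
    ((∑ x ∈ occFrom A a 1, upCost A x : ℕ) : ℝ) ≤ c * (|Real.logb 2 (n / c)| + 3) := by
  have h1 := sum_nextOcc_sub_le A a (x := 1) (by omega)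
  have h2 := le_nextOcc A a 1
  refine le_trans ?_ (sum_log_gap_le hn hc hs (d := fun z => nextOcc A a (z + 1) - z) ?_ (by omega))
  · rw [Nat.cast_le]
    refine Finset.sum_le_sum fun z hz => ?_
    obtain ⟨h2, h3, h4⟩ := mem_occFrom.1 hz
    rw [upCost, h4]
    exact up_le h2 (le_nextOcc A a _)
  · intro z hz
    have := le_nextOcc A a (z + 1)
    omega

/-- The work for `a` is within its share of the time bound; for the work of `O(log n)` per
occurrence this holds because of `log n = log (n / c) + log c` and `log c ≤ c`. -/
theorem cost_le {n : ℕ} {A B : Fin n → ℤ} (hn : 1 ≤ n) {a : ℤ} (ha : a ∈ Finset.univ.image A) :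
    ((intCost A B a + (60 * Nat.log 2 n + 150) +
      (occFrom A a 1).card * (60 * Nat.log 2 n + 300) : ℕ) : ℝ) ≤
      10000 * ((cnt A B a : ℝ) ^ 2 * (1 + Real.logb 2 ((n : ℝ) / (cnt A B a : ℝ)) ^ 2)) := by
  have hcnt : cnt A B a = (occFrom A a 1).card + (occFrom B a 1).card := by
    rw [card_occFrom, card_occFrom]; rfl
  have hp : 1 ≤ (occFrom A a 1).card := by
    rw [card_occFrom, Nat.one_le_iff_ne_zero, ← Nat.pos_iff_ne_zero, Finset.card_pos]
    obtain ⟨i, -, hi⟩ := Finset.mem_image.1 ha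
    exact ⟨i, by simp [hi]⟩
  set c := cnt A B a
  have hc : 1 ≤ c := by omega
  have hA : (occFrom A a 1).card ≤ c := by omega
  have hB : (occFrom B a 1).card ≤ c := by omega
  have d1 := sum_downCost_le A hn hc hA
  have d2 := sum_downCost_le B hn hc hB
  have u1 := sum_upCost_le A hn hc hA
  have u2 := sum_upCost_le B hn hc hB
  have hn' : (0 : ℝ) < n := by exact_mod_cast hn
  have hc1 : (1 : ℝ) ≤ c := by exact_mod_cast hc
  have hA' : ((occFrom A a 1).card : ℝ) ≤ c := by exact_mod_cast hA
  have hlog : (Nat.log 2 n : ℝ) ≤ |Real.logb 2 (n / c)| + c := by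
    have h1 := natLog_le_logb hn
    have h2 : Real.logb 2 n = Real.logb 2 (n / c) + Real.logb 2 c := by
      rw [← Real.logb_mul (by positivity) (by positivity)]
      congr 1
      field_simp
    have h3 : Real.logb 2 c ≤ c := by
      rw [Real.logb_le_iff_le_rpow (by norm_num) (by linarith), Real.rpow_natCast]
      exact_mod_cast Nat.lt_two_pow_self.le
    have h6 := le_abs_self (Real.logb 2 ((n : ℝ) / c))
    linarith
  rw [← sq_abs (Real.logb 2 ((n : ℝ) / c))]
  set l := |Real.logb 2 ((n : ℝ) / c)|
  have hl0 : 0 ≤ l := abs_nonneg _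
  set M := (c : ℝ) ^ 2 * (1 + l ^ 2) with hM
  have hcc : (c : ℝ) ≤ (c : ℝ) ^ 2 := by nlinarith
  have hM1 : (c : ℝ) ^ 2 ≤ M := by
    rw [hM]; nlinarith [mul_nonneg (sq_nonneg (c : ℝ)) (sq_nonneg l)]
  have hll : l ≤ 1 + l ^ 2 := by nlinarith [sq_nonneg (l - 1)]
  have hM2 : (c : ℝ) * l ≤ M := by
    rw [hM]
    gcongr
  have hM3 : ((c : ℝ) * (l + 3)) * (c * (l + 3)) ≤ 18 * M := by
    have : (l + 3) ^ 2 ≤ 18 * (1 + l ^ 2) := by nlinarith [sq_nonneg (l - 1)]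
    calc ((c : ℝ) * (l + 3)) * (c * (l + 3)) = (c : ℝ) ^ 2 * (l + 3) ^ 2 := by ring
      _ ≤ (c : ℝ) ^ 2 * (18 * (1 + l ^ 2)) := by gcongr
      _ = 18 * M := by rw [hM]; ring
  have hM4 : l ≤ M := le_trans (by nlinarith) hM2
  have hD := (mul_le_mul d1 d2 (Nat.cast_nonneg _) (by positivity)).trans hM3
  have hU := (mul_le_mul u1 u2 (Nat.cast_nonneg _) (by positivity)).trans hM3
  have hI : intCost A B a = 200 * ((∑ x ∈ occFrom A a 1, downCost A x) *
      ∑ y ∈ occFrom B a 1, downCost B y) + 40 * (occFrom A a 1).card +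
      150 * ((∑ x ∈ occFrom A a 1, upCost A x) * ∑ y ∈ occFrom B a 1, upCost B y) + 50 := by
    rw [intCost, Finset.sum_add_distrib, ← Finset.sum_mul, ← Finset.mul_sum, Finset.sum_const,
      smul_eq_mul]
    ring
  have hP : ((occFrom A a 1).card : ℝ) * (60 * Nat.log 2 n + 300) ≤ c * (60 * (l + c) + 300) := by
    gcongr
  rw [hI]
  push_cast at hD hU ⊢
  nlinarith

theorem time_le (hn : 1 ≤ n) (A B : Fin n → ℤ) :
    ((∑ a ∈ Finset.univ.image A, (intCost A B a + (60 * Nat.log 2 n + 150)) +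
        n * (60 * Nat.log 2 n + 300) : ℕ) : ℝ) ≤ 10000 * timeBound A B := by
  have hcard : n = ∑ a ∈ Finset.univ.image A, (occFrom A a 1).card := by
    simp only [card_occFrom]
    rw [← Finset.card_eq_sum_card_image, Finset.card_univ, Fintype.card_fin]
  calc ((∑ a ∈ Finset.univ.image A, (intCost A B a + (60 * Nat.log 2 n + 150)) +
        n * (60 * Nat.log 2 n + 300) : ℕ) : ℝ)
      = ((∑ a ∈ Finset.univ.image A, (intCost A B a + (60 * Nat.log 2 n + 150) +
          (occFrom A a 1).card * (60 * Nat.log 2 n + 300)) : ℕ) : ℝ) := by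
        rw [Finset.sum_add_distrib (g := fun a => (occFrom A a 1).card * (60 * Nat.log 2 n + 300)),
          ← Finset.sum_mul, ← hcard]
    _ ≤ ∑ a ∈ Finset.univ.image A,
        10000 * ((cnt A B a : ℝ) ^ 2 * (1 + Real.logb 2 ((n : ℝ) / (cnt A B a : ℝ)) ^ 2)) := by
        rw [Nat.cast_sum]
        exact Finset.sum_le_sum fun a ha => cost_le hn ha
    _ ≤ ∑ a ∈ alphabet A B,
        10000 * ((cnt A B a : ℝ) ^ 2 * (1 + Real.logb 2 ((n : ℝ) / (cnt A B a : ℝ)) ^ 2)) :=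
        Finset.sum_le_sum_of_subset_of_nonneg Finset.subset_union_left
          fun _ _ _ => by positivity
    _ = 10000 * timeBound A B := by rw [timeBound, Finset.mul_sum]

/-- The exponent `7` leaves room for the addresses in the Fenwick tree and for the factor `16`, as
`16 * (n + 1) ^ 2 < 2 ^ 5 * (2 * n) ^ 2`. -/
theorem fits_of_pow_le {n w : ℕ} (hn : 1 ≤ n) (h : (2 * n) ^ 7 ≤ 2 ^ w) :
    Fits w n (4 * ((n : ℤ) + 1) ^ 2) := by
  have h1 : 32 * (2 * n) ^ 2 ≤ (2 * n) ^ 7 := by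
    calc 32 * (2 * n) ^ 2 = 2 ^ 5 * (2 * n) ^ 2 := by norm_num
      _ ≤ (2 * n) ^ 5 * (2 * n) ^ 2 := by gcongr; omega
      _ = (2 * n) ^ 7 := by ring
  have h2 : 32 * (2 * (n : ℤ)) ^ 2 ≤ 2 ^ w := by exact_mod_cast h1.trans h
  have hn' : (1 : ℤ) ≤ n := by exact_mod_cast hn
  refine ⟨?_, ?_, ?_⟩ <;> nlinarith

end LCIS

theorem mainTheorem4 :
    ∃ (P : WordRAM.Program) (κ : ℕ) (C : ℝ),
      ∀ (n w : ℕ) (A B : Fin n → ℤ),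
        1 ≤ n →
        (2 * n) ^ κ ≤ 2 ^ w →
        (∀ i, WordRAM.IsWord w (A i)) →
        (∀ j, WordRAM.IsWord w (B j)) →
        ∃ (t : ℕ) (s : WordRAM.State),
          WordRAM.Exec w P (WordRAM.initial w A B) t s ∧
          (t : ℝ) ≤ C * LCIS.timeBound A B ∧
          LCIS.IsOutput A B s := by
  refine ⟨LCIS.program, 7, 10000, fun n w A B hn hw _ _ => ?_⟩
  obtain ⟨t, s, h, ht, ho⟩ := LCIS.run_program (LCIS.fits_of_pow_le hn hw) hn A B
  exact ⟨t, s, h, (Nat.cast_le.2 ht).trans (LCIS.time_le hn A B), ho⟩
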